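/- Let $c\in\mathbb C$, $c\neq0$, and put $$g(x,y)=\frac{c}{x-y},\quad f(x,y)=\frac{x-y+c}{x-y},\quad h(x,y)=\frac{x-y+c}{c},\quad t(x,y)=\frac{c^2}{(x-y+c)(x-y)} .$$ If one of these functions, or a function of one variable, is evaluated on finite sets, the product over all elements is meant, e.g. $f(\bar x,\bar y)=\prod_{x\in\bar x}\prod_{y\in\bar y}f(x,y)$. For sets with $\#\bar x=\#\bar y=k$ let $$\mathsf K_k(\bar x|\bar y)=\prod_{\ell<m}g(x_\ell,x_m)\,g(y_m,y_\ell)\cdot h(\bar x,\bar y)\,\det_{k}\,[t(x_i,y_j)]$$ be the Izergin–Korepin determinant, and $\bar y+c=\{y+c: y\in\bar y\}$. Let $V$ be a highest weight representation of the Yangian of $\mathfrak{gl}_3$: a complex vector space with operators $T_{ij}(u)$, $1\le i,j\le 3$, satisfying $R_{12}(u,v)T_1(u)T_2(v)=T_2(v)T_1(u)R_{12}(u,v)$ with $R(u,v)=(\mathbf I+g(u,v)\mathbf P)/f(u,v)$, where $\mathbf P$ is the permutation of the two factors of $\mathbb C^3\otimes\mathbb C^3$, and a vector $|0\rangle\ne0$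 with $T_{ij}(u)|0\rangle=0$ for $j<i$ and $T_{ii}(u)|0\rangle=\lambda_i(u)|0\rangle$. Write $T_{ij}(\bar u)=\prod_{u\in\bar u}T_{ij}(u)$ (these operators commute) and $\mathsf r_j=\lambda_j/\lambda_2$ for $j=1,3$. For finite sets $\bar u,\bar v\subset\mathbb C$ with $\#\bar u=a$, $\#\bar v=b$, the Bethe vector is $$\mathbb B^{a,b}(\bar u;\bar v)=\sum\frac{\mathsf K_k(\bar v_{\rm I}|\bar u_{\rm I})}{\lambda_2(\bar v_{\rm II})\lambda_2(\bar u)}\,\frac{f(\bar v_{\rm II},\bar v_{\rm I})f(\bar u_{\rm II},\bar u_{\rm I})}{f(\bar v_{\rm II},\bar u)f(\bar v_{\rm I},\bar u_{\rm I})}\,T_{12}(\bar u_{\rm II})T_{13}(\bar u_{\rm I})T_{23}(\bar v_{\rm II})|0\rangle ,$$ the sum being over all partitions $\bar u=\bar u_{\rm I}\sqcup\bar u_{\rm II}$, $\bar v=\bar v_{\rm I}\sqcup\bar v_{\rm II}$ with $\#\bar u_{\rm I}=\#\bar v_{\rm I}=k$, $0\le k\le\min(a,b)$. Here and below every scalar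 coefficient is read as a rational function of the spectral parameters (times values of the $\lambda_i$), i.e. it is extended to its removable singularities (these occur when an element of one set coincides with an element of another). **Theorem.** Let $\bar u,\bar v,\bar w\subset\mathbb C$ be finite sets with $\#\bar u=a$, $\#\bar v=b$, $\#\bar w=n$, $\bar u\cap\bar w=\bar v\cap\bar w=\emptyset$, such that no two elements of $\bar u\cup\bar v\cup\bar w$ differ by $c$ and $\lambda_2$ does not vanish on $\bar u\cup\bar v\cup\bar w$. Put $\bar\eta=\bar u\cup\bar w$ and $\bar\xi=\bar v\cup\bar w$. Then $$T_{22}(\bar w)\mathbb B^{a,b}(\bar u;\bar v)=\lambda_2(\bar w)\sum f(\bar\xi_{\rm II},\bar\xi_{\rm I})f(\bar\eta_{\rm I},\bar\eta_{\rm II})\,\mathsf K_n(\bar\xi_{\rm I}|\bar w+c)\,\mathsf K_n(\bar w|\bar\eta_{\rm I}+c)\,\mathbb B^{a,b}(\bar\eta_{\rm II};\bar\xi_{\rm II}),$$ $$T_{11}(\bar w)\mathbb B^{a,b}(\bar u;\bar v)=\lambda_2(\bar w)\sum \mathsf r_1(\bar\eta_{\rm I})\frac{f(\bar\xi_{\rm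 II},\bar\xi_{\rm I})f(\bar\eta_{\rm II},\bar\eta_{\rm I})}{f(\bar\xi_{\rm II},\bar\eta_{\rm I})}\,\mathsf K_n(\bar\xi_{\rm I}|\bar w+c)\,\mathsf K_n(\bar\eta_{\rm I}|\bar\xi_{\rm I}+c)\,\mathbb B^{a,b}(\bar\eta_{\rm II};\bar\xi_{\rm II}),$$ $$T_{33}(\bar w)\mathbb B^{a,b}(\bar u;\bar v)=\lambda_2(\bar w)\sum \mathsf r_3(\bar\xi_{\rm I})\frac{f(\bar\xi_{\rm I},\bar\xi_{\rm II})f(\bar\eta_{\rm I},\bar\eta_{\rm II})}{f(\bar\xi_{\rm I},\bar\eta_{\rm II})}\,\mathsf K_n(\bar w|\bar\eta_{\rm I}+c)\,\mathsf K_n(\bar\eta_{\rm I}|\bar\xi_{\rm I}+c)\,\mathbb B^{a,b}(\bar\eta_{\rm II};\bar\xi_{\rm II}),$$ where each sum is over all partitions $\bar\eta=\bar\eta_{\rm I}\sqcup\bar\eta_{\rm II}$ and $\bar\xi=\bar\xi_{\rm I}\sqcup\bar\xi_{\rm II}$ with $\#\bar\eta_{\rm I}=\#\bar\xi_{\rm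 I}=n$. -/

import Mathlib

open scoped Kronecker

namespace GL3

noncomputable section

/-! ### Scalar functions -/

/-- `g(x,y) = c / (x - y)`. -/
def g (c x y : ℂ) : ℂ := c / (x - y)

/-- `f(x,y) = 1 + g(x,y) = (x - y + c) / (x - y)` for `x ≠ y`. -/
def f (c x y : ℂ) : ℂ := (x - y + c) / (x - y)

/-- The rational function `1 / f(x,y) = (x - y) / (x - y + c)`, which vanishes at `x = y`. -/
def fInv (c x y : ℂ) : ℂ := (x - y) / (x - y + c)

/-- `h(x,y) = f(x,y) / g(x,y) = (x - y + c) / c`. -/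
def h (c x y : ℂ) : ℂ := (x - y + c) / c

/-- `t(x,y) = g(x,y) / h(x,y) = c² / ((x - y + c) (x - y))`. -/
def t (c x y : ℂ) : ℂ := c ^ 2 / ((x - y + c) * (x - y))

theorem f_eq (c x y : ℂ) (hxy : x ≠ y) : f c x y = 1 + g c x y := by
  have : x - y ≠ 0 := sub_ne_zero.2 hxy
  unfold f g; field_simp

theorem fInv_eq (c x y : ℂ) : fInv c x y = (f c x y)⁻¹ := by
  unfold f fInv; rw [inv_div]

/-- The shorthand `φ(X, Y) = ∏_{x ∈ X} ∏_{y ∈ Y} φ(x, y)`. -/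
def prodOn (φ : ℂ → ℂ → ℂ) (X Y : Finset ℂ) : ℂ := ∏ x ∈ X, ∏ y ∈ Y, φ x y

/-! ### The Izergin–Korepin determinant -/

/-- `∏_{ℓ < m} g(x_ℓ, x_m) g(y_m, y_ℓ)`. -/
def izerginPrefactor (c : ℂ) {k : ℕ} (x y : Fin k → ℂ) : ℂ :=
  ∏ l, ∏ m ∈ Finset.Ioi l, g c (x l) (x m) * g c (y m) (y l)

/-- The Izergin–Korepin determinant, literally
`K_k(x|y) = ∏_{ℓ<m} g(x_ℓ,x_m) g(y_m,y_ℓ) · h(x,y) · det [t(x_i,y_j)]`. -/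
def izerginLiteral (c : ℂ) {k : ℕ} (x y : Fin k → ℂ) : ℂ :=
  izerginPrefactor c x y * (∏ i, ∏ j, h c (x i) (y j)) *
    (Matrix.of fun i j => t c (x i) (y j)).det

/-- The same rational function `K_k(x|y)`, with the factor `h(x,y)` distributed over the rows of
the determinant by `h t = g`. It agrees with `izerginLiteral` where no `h(x_i,y_j)` vanishes
(`izergin_eq`), and it also has the right value at the removable singularities
`h(x_i,y_j) = 0`, which occur when `K_k(x|y+c)` is evaluated at `x_i = y_j`. -/
def izergin (c : ℂ) {k : ℕ} (x y : Fin k → ℂ) : ℂ :=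
  izerginPrefactor c x y *
    (Matrix.of fun i j => g c (x i) (y j) * ∏ l ∈ Finset.univ.erase j, h c (x i) (y l)).det

/-- The rational function `K_k(x|y) / f(x,y)`, again with the scalar factors distributed over the
rows, by `h t / f = 1 / h` and `h / f = 1 / g`. It agrees with the literal quotient where `x_i ≠ y_j`
and `h(x_i,y_j) ≠ 0` (`izerginDivF_eq`), and it also has the right value at the removable
singularities `x_i = y_j`. -/
def izerginDivF (c : ℂ) {k : ℕ} (x y : Fin k → ℂ) : ℂ :=
  izerginPrefactor c x y *
    (Matrix.of fun i j =>
      (h c (x i) (y j))⁻¹ * ∏ l ∈ Finset.univ.erase j, (x i - y l) / c).det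

theorem izergin_eq (c : ℂ) (hc : c ≠ 0) {k : ℕ} (x y : Fin k → ℂ)
    (hh : ∀ i j, x i - y j + c ≠ 0) : izergin c x y = izerginLiteral c x y := by
  unfold izergin izerginLiteral
  rw [mul_assoc, ← Matrix.det_mul_column]
  congr 2
  ext i j
  simp only [Matrix.of_apply]
  rw [← Finset.mul_prod_erase Finset.univ _ (Finset.mem_univ j)]
  have h1 : g c (x i) (y j) = h c (x i) (y j) * t c (x i) (y j) := by
    have := hh i j
    by_cases h0 : x i - y j = 0
    · simp [g, t, h0]
    · unfold g h t; field_simp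
  rw [h1]; ring

theorem izerginDivF_eq (c : ℂ) (hc : c ≠ 0) {k : ℕ} (x y : Fin k → ℂ)
    (hh : ∀ i j, x i - y j + c ≠ 0) (hne : ∀ i j, x i ≠ y j) :
    izerginDivF c x y = izerginLiteral c x y / ∏ i, ∏ j, f c (x i) (y j) := by
  unfold izerginDivF izerginLiteral
  rw [mul_assoc, mul_div_assoc, mul_div_right_comm, ← Finset.prod_div_distrib,
    ← Matrix.det_mul_column]
  congr 2
  ext i j
  simp only [Matrix.of_apply]
  rw [← Finset.prod_div_distrib, ← Finset.mul_prod_erase Finset.univ _ (Finset.mem_univ j)]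
  have hp : ∀ l, h c (x i) (y l) / f c (x i) (y l) = (x i - y l) / c := by
    intro l
    have := hh i l
    have := sub_ne_zero.2 (hne i l)
    unfold h f; field_simp
  simp only [hp]
  have h1 : (h c (x i) (y j))⁻¹ = (x i - y j) / c * t c (x i) (y j) := by
    have := hh i j
    have := sub_ne_zero.2 (hne i j)
    unfold h t; field_simp
  rw [h1]; ring

/-- An enumeration of a set with `k` elements. The order is immaterial: the Izergin–Korepin
determinant is symmetric in each of its two sets of variables. -/
def enum (k : ℕ) (X : Finset ℂ) : Fin k → ℂ := fun i => X.toList.getD i 0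

/-- `K_k(X|Y+c)` for sets `X`, `Y` of cardinality `k`. -/
def izerginShift (c : ℂ) (k : ℕ) (X Y : Finset ℂ) : ℂ :=
  izergin c (enum k X) (fun j => enum k Y j + c)

/-- `K_k(X|Y) / f(X,Y)` for sets `X`, `Y` of cardinality `k`. -/
def izerginQuot (c : ℂ) (k : ℕ) (X Y : Finset ℂ) : ℂ :=
  izerginDivF c (enum k X) (enum k Y)

/-! ### The monodromy matrix and highest weight representations -/

/-- The permutation matrix `P = ∑ e_ij ⊗ e_ji` on `ℂ³ ⊗ ℂ³`. -/
def permMatrix : Matrix (Fin 3 × Fin 3) (Fin 3 × Fin 3) ℂ :=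
  ∑ i : Fin 3, ∑ j : Fin 3, Matrix.single i j (1 : ℂ) ⊗ₖ Matrix.single j i (1 : ℂ)

/-- The `GL(3)`-invariant `R`-matrix `R(x,y) = (1 + g(x,y) P) / f(x,y)`. -/
def RMatrix (c x y : ℂ) : Matrix (Fin 3 × Fin 3) (Fin 3 × Fin 3) ℂ :=
  (f c x y)⁻¹ • (1 + g c x y • permMatrix)

/-- A highest weight representation of the `gl₃` Yangian on a complex vector space `V`: operators
`T_ij(u)` on `V` for complex `u`, subject to the relation `R₁₂ T₁ T₂ = T₂ T₁ R₁₂` at all pairs of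
arguments at which the `R`-matrix is defined, and a highest weight vector `|0⟩` with weights
`λ_i(u)`. The indices `1, 2, 3` are `0, 1, 2 : Fin 3`. (Where the `T_ij` of a
representation have poles, they may be set to zero, with zero weights, without affecting these
laws.) -/
structure HighestWeightRep (c : ℂ) (V : Type*) [AddCommGroup V] [Module ℂ V] where
  T : ℂ → Matrix (Fin 3) (Fin 3) (Module.End ℂ V)
  rtt : ∀ x y : ℂ, x - y ≠ 0 → x - y + c ≠ 0 →
    (RMatrix c x y).map (algebraMap ℂ (Module.End ℂ V)) * (T x ⊗ₖ 1) * (1 ⊗ₖ T y) =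
      (1 ⊗ₖ T y) * (T x ⊗ₖ 1) * (RMatrix c x y).map (algebraMap ℂ (Module.End ℂ V))
  vac : V
  vac_ne_zero : vac ≠ 0
  weight : Fin 3 → ℂ → ℂ
  lower : ∀ (u : ℂ) (i j : Fin 3), j < i → T u i j vac = 0
  diag : ∀ (u : ℂ) (i : Fin 3), T u i i vac = weight i u • vac

theorem permMatrix_apply (i k j l : Fin 3) :
    permMatrix (i, k) (j, l) = if i = l ∧ k = j then 1 else 0 := by
  unfold permMatrix
  simp only [Matrix.sum_apply, Matrix.kroneckerMap_apply, Matrix.single_apply]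
  revert i k j l
  simp [Fin.forall_fin_succ, Fin.sum_univ_succ]

/-- The exchange relation
`[T_ij(x), T_kl(y)] = g(x,y) (T_kj(y) T_il(x) - T_kj(x) T_il(y))` contained in the `RTT` relation. -/
theorem HighestWeightRep.exchange {c : ℂ} {V : Type*} [AddCommGroup V] [Module ℂ V]
    (M : HighestWeightRep c V) (x y : ℂ) (hxy : x - y ≠ 0) (hf : x - y + c ≠ 0)
    (i j k l : Fin 3) :
    M.T x i j * M.T y k l + g c x y • (M.T x k j * M.T y i l) =
      M.T y k l * M.T x i j + g c x y • (M.T y k j * M.T x i l) := by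
  have h := congrFun (congrFun (M.rtt x y hxy hf) (i, k)) (j, l)
  have hf' : (f c x y)⁻¹ ≠ 0 := inv_ne_zero (div_ne_zero hf hxy)
  have hR : (RMatrix c x y).map (algebraMap ℂ (Module.End ℂ V)) =
      (f c x y)⁻¹ • (1 + g c x y • permMatrix.map (algebraMap ℂ (Module.End ℂ V))) := by
    ext1 a b
    simp only [RMatrix, Matrix.one_apply, Algebra.algebraMap_eq_smul_one, smul_add,
      Matrix.map_apply, Matrix.add_apply, Matrix.smul_apply, smul_eq_mul]
    split_ifs <;> simp [add_smul, mul_smul]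
  rw [hR, Matrix.mul_assoc] at h
  simp only [Matrix.smul_mul, Matrix.mul_smul, Matrix.smul_apply] at h
  have h := smul_right_injective _ hf' h
  simp only [Matrix.add_mul, Matrix.mul_add, Matrix.add_apply, Matrix.one_mul, Matrix.mul_one,
    Matrix.smul_mul, Matrix.mul_smul, Matrix.smul_apply] at h
  simpa [Matrix.mul_apply, Fintype.sum_prod_type, permMatrix_apply, Matrix.one_apply, ite_and,
    apply_ite (algebraMap ℂ (Module.End ℂ V))] using h

theorem HighestWeightRep.commute {c : ℂ} {V : Type*} [AddCommGroup V] [Module ℂ V]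
    (M : HighestWeightRep c V) (i j : Fin 3) (x y : ℂ) :
    Commute (M.T x i j) (M.T y i j) := by
  have key : ∀ x y : ℂ, x - y ≠ 0 → x - y + c ≠ 0 → Commute (M.T x i j) (M.T y i j) := by
    intro x y hxy hf
    have h := M.exchange x y hxy hf i j i j
    have e : 1 + g c x y ≠ 0 := by
      rw [← f_eq c x y (sub_ne_zero.1 hxy)]; exact div_ne_zero hf hxy
    have h' : (1 + g c x y) • (M.T x i j * M.T y i j) =
        (1 + g c x y) • (M.T y i j * M.T x i j) := by
      simpa only [add_smul, one_smul] using h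
    exact smul_right_injective _ e h'
  by_cases hxy : x - y = 0
  · rw [sub_eq_zero.1 hxy]
  by_cases hf : x - y + c = 0
  · refine (key y x (fun e => hxy (by linear_combination -e)) fun e => hxy ?_).symm
    linear_combination (hf - e) / 2
  · exact key x y hxy hf

/-- The product `T_ij(X) = ∏_{x ∈ X} T_ij(x)` of commuting operators. -/
def HighestWeightRep.prodT {c : ℂ} {V : Type*} [AddCommGroup V] [Module ℂ V]
    (M : HighestWeightRep c V) (i j : Fin 3) (X : Finset ℂ) : Module.End ℂ V :=
  X.noncommProd (fun x => M.T x i j) fun x _ y _ _ => M.commute i j x y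

/-- The shorthand `λ_i(X) = ∏_{x ∈ X} λ_i(x)`. -/
def HighestWeightRep.prodWeight {c : ℂ} {V : Type*} [AddCommGroup V] [Module ℂ V]
    (M : HighestWeightRep c V) (i : Fin 3) (X : Finset ℂ) : ℂ := ∏ x ∈ X, M.weight i x

/-- `r₁(X) = λ₁(X) / λ₂(X)`. -/
def HighestWeightRep.r1 {c : ℂ} {V : Type*} [AddCommGroup V] [Module ℂ V]
    (M : HighestWeightRep c V) (X : Finset ℂ) : ℂ := ∏ x ∈ X, M.weight 0 x / M.weight 1 x

/-- `r₃(X) = λ₃(X) / λ₂(X)`. -/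
def HighestWeightRep.r3 {c : ℂ} {V : Type*} [AddCommGroup V] [Module ℂ V]
    (M : HighestWeightRep c V) (X : Finset ℂ) : ℂ := ∏ x ∈ X, M.weight 2 x / M.weight 1 x

/-- The Bethe vector
`B(u;v) = ∑ K_k(v_I|u_I) / (λ₂(v_II) λ₂(u)) · f(v_II,v_I) f(u_II,u_I) / (f(v_II,u) f(v_I,u_I))
  · T₁₂(u_II) T₁₃(u_I) T₂₃(v_II) |0⟩`,
the sum being over all partitions `u = u_I ⊔ u_II`, `v = v_I ⊔ v_II` with `#u_I = #v_I = k`.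
The coefficients are rational functions without singularity at `u_i = v_j`; by the use of `fInv` and
`izerginQuot` they take their right values also when `u` and `v` have common elements. -/
def HighestWeightRep.bethe {c : ℂ} {V : Type*} [AddCommGroup V] [Module ℂ V]
    (M : HighestWeightRep c V) (u v : Finset ℂ) : V :=
  ∑ uI ∈ u.powerset, ∑ vI ∈ v.powersetCard uI.card,
    (izerginQuot c uI.card vI uI * prodOn (f c) (v \ vI) vI * prodOn (f c) (u \ uI) uI *
        prodOn (fInv c) (v \ vI) u / (M.prodWeight 1 (v \ vI) * M.prodWeight 1 u)) •
      (M.prodT 0 1 (u \ uI) * M.prodT 0 2 uI * M.prodT 1 2 (v \ vI)) M.vac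

end

end GL3

namespace GL3

open Finset

/-! ### Scalar functions under `c ↦ -c` -/

/-! After division of every `T_ij(x)` by `λ₂(x)`, the theorem is an iteration of the case of a
single point `z`. That case becomes uniform when written for sets `U`, `X` that both contain `z`,
and for the vector `B(U∖z; X∖z)`: here `T₁₃(z)` produces `B(U; X)`, `T₁₂(z)` a sum over `x ∈ X` of
multiples of `B(U; X∖x)`, `T₂₃(z)` a sum over `y ∈ U` of multiples of `B(U∖y; X)`, and each
`T_ii(z)` a double sum of multiples of `B(U∖y; X∖x)`. Because `1/f` vanishes on the diagonal,
boundary terms drop out by themselves and sums extend freely to larger index sets.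

The source of these formulas is a recursion of the Bethe vector in its first set (`bethe_insert`).
It comes from moving `T₁₃(w)` through the operators `T₁₂`; the coefficients match by two identities
for `K/f`: an expansion in one variable (`kQuot_insert`) and an exchange of one variable for another
(`kQuot_exchange`). Both follow from the expansion of the Izergin–Korepin determinant over its
simple poles (`izergin_recursion_left`), proved by Lagrange interpolation. At coinciding arguments
they hold by continuity. Specialising the recursion gives the actions of `T₁₃` and `T₁₂`.

The diagonal operators are treated by induction on `#U`, using only exchange relations and the
actions of `T₁₂`, `T₁₃` (`action_diagonal`, `action_middle`). If another point `w` of `U` lies in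
`X`, the vector is `T₁₃(w)` of a smaller one, and the operator is commuted past `T₁₃(w)`. Otherwise
it is one term of `T₁₂(w)` applied to a smaller vector, all other terms being of the first kind, so
it can be solved for. `T₂₂` and `T₂₃` are coupled and handled together. `T₃₃` is `T₁₁` with the two
sets exchanged and `c` replaced by `-c`, the role of `T₁₂` being played by `T₂₃`.

Finally, products of operators are built up one point at a time. The sum over the point removed at
each step is the expansion of `K_{n+1}(·|·+c)` in one variable (`izerginShift_insert`), which yields
the determinants in the theorem. -/

theorem g_neg (c x y : ℂ) : g (-c) x y = g c y x := by
  unfold g; rw [← neg_sub y x, neg_div_neg_eq]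

theorem f_neg (c x y : ℂ) : f (-c) x y = f c y x := by
  unfold f; rw [← neg_sub y x, ← neg_add, neg_div_neg_eq]

theorem fInv_neg (c x y : ℂ) : fInv (-c) x y = fInv c y x := by
  unfold fInv; rw [← neg_sub y x, ← neg_add, neg_div_neg_eq]

theorem h_neg (c x y : ℂ) : h (-c) x y = h c y x := by
  unfold h; rw [← neg_sub y x, ← neg_add, neg_div_neg_eq]

/-! ### Products over `Fin (n + 1)` with one index removed -/

theorem prod_erase_fin {M : Type*} [CommMonoid M] {n : ℕ} (j : Fin (n + 1))
    (F : Fin (n + 1) → M) :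
    ∏ l ∈ univ.erase j, F l = ∏ l, F (j.succAbove l) := by
  rw [← sdiff_singleton_eq_erase, ← compl_eq_univ_sdiff, ← Fin.image_succAbove_univ,
    prod_image fun a _ b _ hab => Fin.succAbove_right_injective hab]

/-! ### Vandermonde form of the prefactor of the Izergin–Korepin determinant -/

/-- The sign in `-c ^ 2` comes from reversing `x_ℓ - x_m` in each pair. With inverses in place of
quotients no injectivity is needed. -/
theorem izerginPrefactor_eq (c : ℂ) {k : ℕ} (x y : Fin k → ℂ) :
    izerginPrefactor c x y = (∏ l : Fin k, ∏ _m ∈ Ioi l, -c ^ 2) *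
      ((Matrix.vandermonde x).det⁻¹ * (Matrix.vandermonde y).det⁻¹) := by
  rw [Matrix.det_vandermonde, Matrix.det_vandermonde]
  simp only [← prod_inv_distrib, ← prod_mul_distrib, izerginPrefactor]
  refine prod_congr rfl fun l _ => prod_congr rfl fun m _ => ?_
  unfold g
  rw [← neg_sub (x m) (x l)]
  simp only [div_eq_mul_inv, neg_inv.symm]
  ring

theorem det_vandermonde_comp_perm {k : ℕ} (x : Fin k → ℂ) (σ : Equiv.Perm (Fin k)) :
    (Matrix.vandermonde (x ∘ σ)).det = (Equiv.Perm.sign σ : ℤ) * (Matrix.vandermonde x).det := by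
  rw [← Matrix.det_permute]; rfl

theorem det_vandermonde_succ {n : ℕ} (x : Fin (n + 1) → ℂ) :
    (Matrix.vandermonde x).det =
      (∏ i : Fin n, (x i.succ - x 0)) * (Matrix.vandermonde (x ∘ Fin.succ)).det := by
  simp only [Matrix.det_vandermonde, Fin.prod_univ_succ, Fin.prod_Ioi_zero, Fin.prod_Ioi_succ,
    Function.comp]

/-- Bringing the index `j` to the front costs `(-1) ^ j`, which will cancel the sign of the cofactor
in a Laplace expansion. -/
theorem det_vandermonde_succAbove {n : ℕ} (y : Fin (n + 1) → ℂ) (j : Fin (n + 1)) :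
    (Matrix.vandermonde y).det = (-1) ^ (j : ℕ) * ((∏ l : Fin n, (y (j.succAbove l) - y j)) *
      (Matrix.vandermonde (y ∘ j.succAbove)).det) := by
  have h1 := det_vandermonde_comp_perm y j.cycleRange.symm
  have h2 := det_vandermonde_succ (y ∘ j.cycleRange.symm)
  have h3 : (y ∘ j.cycleRange.symm) ∘ Fin.succ = y ∘ j.succAbove := by
    ext l; simp
  rw [h3] at h2
  simp only [Function.comp_apply, Fin.cycleRange_symm_zero, Fin.cycleRange_symm_succ] at h2
  rw [← h2, h1, Equiv.Perm.sign_symm, Fin.sign_cycleRange]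
  push_cast
  rw [← mul_assoc, ← mul_pow]; simp

theorem sign_sq_cast {k : ℕ} (σ : Equiv.Perm (Fin k)) :
    (((Equiv.Perm.sign σ : ℤ) : ℂ))⁻¹ * ((Equiv.Perm.sign σ : ℤ) : ℂ) = 1 := by
  rcases Int.units_eq_one_or (Equiv.Perm.sign σ) with hs | hs <;> simp [hs]

theorem izerginPrefactor_comp_left (c : ℂ) {k : ℕ} (x y : Fin k → ℂ) (σ : Equiv.Perm (Fin k)) :
    izerginPrefactor c (x ∘ σ) y =
      (((Equiv.Perm.sign σ : ℤ) : ℂ))⁻¹ * izerginPrefactor c x y := by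
  rw [izerginPrefactor_eq, izerginPrefactor_eq, det_vandermonde_comp_perm, mul_inv]; ring

theorem izerginPrefactor_comp_right (c : ℂ) {k : ℕ} (x y : Fin k → ℂ) (σ : Equiv.Perm (Fin k)) :
    izerginPrefactor c x (y ∘ σ) =
      (((Equiv.Perm.sign σ : ℤ) : ℂ))⁻¹ * izerginPrefactor c x y := by
  rw [izerginPrefactor_eq, izerginPrefactor_eq, det_vandermonde_comp_perm, mul_inv]; ring

theorem prefactor_mul_det_comp_left (c : ℂ) {k : ℕ} (x y : Fin k → ℂ) (σ : Equiv.Perm (Fin k))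
    (A : Matrix (Fin k) (Fin k) ℂ) :
    izerginPrefactor c (x ∘ σ) y * (A.submatrix σ id).det = izerginPrefactor c x y * A.det := by
  rw [izerginPrefactor_comp_left, Matrix.det_permute]
  linear_combination (izerginPrefactor c x y * A.det) * sign_sq_cast σ

theorem prefactor_mul_det_comp_right (c : ℂ) {k : ℕ} (x y : Fin k → ℂ)
    (σ : Equiv.Perm (Fin k)) (A : Matrix (Fin k) (Fin k) ℂ) :
    izerginPrefactor c x (y ∘ σ) * (A.submatrix id σ).det = izerginPrefactor c x y * A.det := by
  rw [izerginPrefactor_comp_right, Matrix.det_permute']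
  linear_combination (izerginPrefactor c x y * A.det) * sign_sq_cast σ

theorem prod_erase_perm {k : ℕ} (σ : Equiv.Perm (Fin k)) (j : Fin k) (F : Fin k → ℂ) :
    ∏ l ∈ univ.erase j, F (σ l) = ∏ l ∈ univ.erase (σ j), F l :=
  prod_equiv σ (by simp) (by simp)

theorem izergin_comp_left (c : ℂ) {k : ℕ} (x y : Fin k → ℂ) (σ : Equiv.Perm (Fin k)) :
    izergin c (x ∘ σ) y = izergin c x y :=
  prefactor_mul_det_comp_left c x y σ
    (Matrix.of fun i j => g c (x i) (y j) * ∏ l ∈ univ.erase j, h c (x i) (y l))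

theorem izergin_comp_right (c : ℂ) {k : ℕ} (x y : Fin k → ℂ) (σ : Equiv.Perm (Fin k)) :
    izergin c x (y ∘ σ) = izergin c x y := by
  refine Eq.trans ?_ (prefactor_mul_det_comp_right c x y σ _)
  unfold izergin
  congr 2
  ext i j
  simp only [Matrix.of_apply, Matrix.submatrix_apply, Function.comp_apply, id]
  rw [← prod_erase_perm σ j fun l => h c (x i) (y l)]

theorem izerginDivF_comp_left (c : ℂ) {k : ℕ} (x y : Fin k → ℂ) (σ : Equiv.Perm (Fin k)) :
    izerginDivF c (x ∘ σ) y = izerginDivF c x y :=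
  prefactor_mul_det_comp_left c x y σ
    (Matrix.of fun i j => (h c (x i) (y j))⁻¹ * ∏ l ∈ univ.erase j, (x i - y l) / c)

theorem izerginDivF_comp_right (c : ℂ) {k : ℕ} (x y : Fin k → ℂ) (σ : Equiv.Perm (Fin k)) :
    izerginDivF c x (y ∘ σ) = izerginDivF c x y := by
  refine Eq.trans ?_ (prefactor_mul_det_comp_right c x y σ _)
  unfold izerginDivF
  congr 2
  ext i j
  simp only [Matrix.of_apply, Matrix.submatrix_apply, Function.comp_apply, id]
  rw [← prod_erase_perm σ j fun l => (x i - y l) / c]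

/-! ### Transposition symmetry -/

theorem prod_prod_erase_perm {k : ℕ} (H : Fin k → Fin k → ℂ) (σ : Equiv.Perm (Fin k)) :
    ∏ i, ∏ l ∈ univ.erase i, H (σ i) l = ∏ i, ∏ l ∈ univ.erase (σ i), H l i := by
  rw [prod_sigma', prod_sigma']
  refine prod_bij' (fun p _ => ⟨p.2, σ p.1⟩) (fun p _ => ⟨σ.symm p.2, p.1⟩) ?_ ?_ ?_ ?_ ?_
  · rintro ⟨i, l⟩ hp
    simp only [mem_sigma, mem_univ, mem_erase, true_and, and_true] at hp ⊢
    exact fun e => hp (σ.injective e).symm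
  · rintro ⟨i, l⟩ hp
    simp only [mem_sigma, mem_univ, mem_erase, true_and, and_true] at hp ⊢
    rintro rfl
    simp at hp
  · rintro ⟨i, l⟩ _; simp
  · rintro ⟨i, l⟩ _; simp
  · rintro ⟨i, l⟩ _; rfl

/-- In the Leibniz term of `σ`, both products of `H` run over the matrix positions outside the graph
of `σ`. -/
theorem det_mul_prod_erase {k : ℕ} (G H : Fin k → Fin k → ℂ) :
    (Matrix.of fun i j => G i j * ∏ l ∈ univ.erase j, H i l).det =
      (Matrix.of fun i j => G i j * ∏ l ∈ univ.erase i, H l j).det := by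
  rw [Matrix.det_apply, Matrix.det_apply]
  refine sum_congr rfl fun σ _ => ?_
  simp only [Matrix.of_apply, prod_mul_distrib]
  rw [prod_prod_erase_perm H σ]

theorem izerginPrefactor_neg (c : ℂ) {k : ℕ} (x y : Fin k → ℂ) :
    izerginPrefactor (-c) y x = izerginPrefactor c x y := by
  unfold izerginPrefactor
  refine prod_congr rfl fun l _ => prod_congr rfl fun m _ => ?_
  rw [g_neg, g_neg, mul_comm]

/-- Exchange of the two sets of variables amounts to `c ↦ -c`. This symmetry later carries `T₁₁` to
`T₃₃`. -/
theorem izergin_neg (c : ℂ) {k : ℕ} (x y : Fin k → ℂ) :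
    izergin (-c) y x = izergin c x y := by
  unfold izergin
  rw [izerginPrefactor_neg, ← Matrix.det_transpose]
  congr 1
  rw [det_mul_prod_erase (fun i j => g c (x i) (y j)) (fun i j => h c (x i) (y j))]
  congr 1
  ext i j
  simp only [Matrix.transpose_apply, Matrix.of_apply, g_neg, h_neg]

/-! ### Recursion of the Izergin–Korepin determinant -/

/-- The matrix in the definition of `izergin`. -/
noncomputable def izerginMatrix (c : ℂ) {k : ℕ} (x y : Fin k → ℂ) : Matrix (Fin k) (Fin k) ℂ :=
  Matrix.of fun i j => g c (x i) (y j) * ∏ l ∈ univ.erase j, h c (x i) (y l)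

/-- The entries of a minor still contain the deleted variable `y j`, but only through one factor
`h(x_i, y_j)` per row. -/
theorem det_izerginMatrix_minor (c : ℂ) {n : ℕ} (x y : Fin (n + 1) → ℂ) (j : Fin (n + 1)) :
    ((izerginMatrix c x y).submatrix Fin.succ j.succAbove).det =
      (∏ i : Fin n, h c (x i.succ) (y j)) *
        (izerginMatrix c (x ∘ Fin.succ) (y ∘ j.succAbove)).det := by
  rw [← Matrix.det_mul_column]
  congr 1
  ext i m
  simp only [izerginMatrix, Matrix.submatrix_apply, Matrix.of_apply, Function.comp_apply]
  have : ∏ l ∈ univ.erase (j.succAbove m), h c (x i.succ) (y l) =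
      h c (x i.succ) (y j) *
        ∏ l ∈ univ.erase m, h c (x i.succ) (y (j.succAbove l)) := by
    rw [← mul_prod_erase (univ.erase (j.succAbove m)) _
      (mem_erase.2 ⟨(Fin.succAbove_ne j m).symm, mem_univ j⟩), erase_right_comm]
    congr 1
    refine (prod_nbij j.succAbove ?_ (fun a _ b _ e => Fin.succAbove_right_injective e) ?_
      fun _ _ => rfl).symm
    · intro l hl
      simp only [mem_erase, mem_univ, and_true] at hl ⊢
      exact ⟨fun e => hl (Fin.succAbove_right_injective e), Fin.succAbove_ne j l⟩
    · intro l hl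
      simp only [coe_erase, coe_univ, Set.mem_sdiff, Set.mem_univ, Set.mem_singleton_iff,
        true_and, Set.mem_image] at hl ⊢
      obtain ⟨a, rfl⟩ := Fin.exists_succAbove_eq hl.1
      exact ⟨a, fun e => hl.2 (by rw [e]), rfl⟩
  rw [this]; ring

theorem vandermonde_det_ne_zero {k : ℕ} {x : Fin k → ℂ} (hx : Function.Injective x) :
    (Matrix.vandermonde x).det ≠ 0 := Matrix.det_vandermonde_ne_zero_iff.2 hx

theorem det_izerginMatrix_eq (c : ℂ) (hc : c ≠ 0) {k : ℕ} (x y : Fin k → ℂ)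
    (hx : Function.Injective x) (hy : Function.Injective y) :
    (izerginMatrix c x y).det = izergin c x y * ((Matrix.vandermonde x).det *
      (Matrix.vandermonde y).det * (∏ l : Fin k, ∏ _m ∈ Ioi l, -c ^ 2)⁻¹) := by
  have h1 := vandermonde_det_ne_zero hx
  have h2 := vandermonde_det_ne_zero hy
  have h3 : (∏ l : Fin k, ∏ _m ∈ Ioi l, -c ^ 2) ≠ 0 :=
    prod_ne_zero_iff.2 fun _ _ => prod_ne_zero_iff.2 fun _ _ => by simp [hc]
  have h4 : izergin c x y = izerginPrefactor c x y * (izerginMatrix c x y).det := rfl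
  rw [h4, izerginPrefactor_eq]
  field_simp

/-- Laplace expansion of `izerginMatrix` along its first row. -/
theorem det_izerginMatrix_succ (c : ℂ) (hc : c ≠ 0) {n : ℕ} (x y : Fin (n + 1) → ℂ)
    (hx : Function.Injective (x ∘ Fin.succ)) (hy : Function.Injective y) :
    (izerginMatrix c x y).det =
      (∑ j : Fin (n + 1), g c (x 0) (y j) * (∏ l : Fin n, h c (x 0) (y (j.succAbove l))) *
        (∏ i : Fin n, h c (x i.succ) (y j)) * (∏ l : Fin n, (y (j.succAbove l) - y j))⁻¹ *
        izergin c (x ∘ Fin.succ) (y ∘ j.succAbove)) *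
      ((Matrix.vandermonde (x ∘ Fin.succ)).det * (Matrix.vandermonde y).det *
        (∏ l : Fin n, ∏ _m ∈ Ioi l, -c ^ 2)⁻¹) := by
  rw [Matrix.det_succ_row_zero, sum_mul]
  refine sum_congr rfl fun j _ => ?_
  rw [det_izerginMatrix_minor, det_izerginMatrix_eq c hc _ _ hx
    (hy.comp Fin.succAbove_right_injective), det_vandermonde_succAbove y j]
  have h1 : (∏ l : Fin n, (y (j.succAbove l) - y j)) ≠ 0 :=
    prod_ne_zero_iff.2 fun l _ => sub_ne_zero.2 fun e => Fin.succAbove_ne j l (hy e)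
  have h2 : izerginMatrix c x y 0 j =
      g c (x 0) (y j) * ∏ l : Fin n, h c (x 0) (y (j.succAbove l)) := by
    rw [← prod_erase_fin j fun l => h c (x 0) (y l)]; rfl
  rw [h2]
  field_simp

theorem izergin_succ (c : ℂ) (hc : c ≠ 0) {n : ℕ} (x y : Fin (n + 1) → ℂ)
    (hx : Function.Injective x) (hy : Function.Injective y) :
    izergin c x y = (∏ i : Fin n, -c ^ 2 / (x i.succ - x 0)) *
      ∑ j : Fin (n + 1), g c (x 0) (y j) * (∏ l : Fin n, h c (x 0) (y (j.succAbove l))) *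
        (∏ i : Fin n, h c (x i.succ) (y j)) * (∏ l : Fin n, (y (j.succAbove l) - y j))⁻¹ *
        izergin c (x ∘ Fin.succ) (y ∘ j.succAbove) := by
  have h4 : izergin c x y = izerginPrefactor c x y * (izerginMatrix c x y).det := rfl
  have hx' : Function.Injective (x ∘ Fin.succ) := hx.comp (Fin.succ_injective n)
  rw [h4, det_izerginMatrix_succ c hc x y hx' hy, izerginPrefactor_eq, det_vandermonde_succ x,
    prod_div_distrib]
  have h1 := vandermonde_det_ne_zero hx'
  have h2 := vandermonde_det_ne_zero hy
  have h3 : (∏ l : Fin n, ∏ _m ∈ Ioi l, -c ^ 2) ≠ 0 :=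
    prod_ne_zero_iff.2 fun _ _ => prod_ne_zero_iff.2 fun _ _ => by simp [hc]
  have h5 : (∏ i : Fin n, (x i.succ - x 0)) ≠ 0 :=
    prod_ne_zero_iff.2 fun l _ => sub_ne_zero.2 fun e => Fin.succ_ne_zero l (hx e)
  rw [Fin.prod_univ_succ, Fin.prod_Ioi_zero fun _ => -c ^ 2]
  have h6 : ∀ a : Fin n, ∏ _m ∈ Ioi a.succ, -c ^ 2 = ∏ _m ∈ Ioi a, -c ^ 2 :=
    fun a => Fin.prod_Ioi_succ (fun _ => -c ^ 2) a
  simp only [h6]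
  field_simp

/-- Lagrange interpolation of a polynomial of degree at most `2 n` which is a combination of
`∏_{l ≠ j} (X - y_l) (X - y_l + c)` and vanishes at `n` further points. -/
theorem interpolate_double {n : ℕ} (c : ℂ) (a y : Fin (n + 1) → ℂ) (x : Fin n → ℂ) (x0 : ℂ)
    (hx : Function.Injective x) (hy : Function.Injective y) (hxy : ∀ i j, x i ≠ y j)
    (hq : ∀ i, ∑ j, a j * ∏ l : Fin n, ((x i - y (j.succAbove l)) *
      (x i - y (j.succAbove l) + c)) = 0) :
    ∑ j, a j * ∏ l : Fin n, ((x0 - y (j.succAbove l)) * (x0 - y (j.succAbove l) + c)) =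
      ∑ j, a j * ∏ l : Fin n, ((y j - y (j.succAbove l) + c) *
        (x0 - y (j.succAbove l)) * ((x0 - x l) / (y j - x l))) := by
  set q : Polynomial ℂ := ∑ j, Polynomial.C (a j) * ∏ l : Fin n,
    ((Polynomial.X - Polynomial.C (y (j.succAbove l))) *
      (Polynomial.X - Polynomial.C (y (j.succAbove l) - c))) with hqdef
  have hev : ∀ t, q.eval t = ∑ j, a j * ∏ l : Fin n, ((t - y (j.succAbove l)) *
      (t - y (j.succAbove l) + c)) := by
    intro t
    simp only [hqdef, Polynomial.eval_finsetSum, Polynomial.eval_mul, Polynomial.eval_C,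
      Polynomial.eval_prod, Polynomial.eval_sub, Polynomial.eval_X]
    refine sum_congr rfl fun j _ => ?_
    congr 1
    refine prod_congr rfl fun l _ => ?_
    ring
  -- Degree at most `2 n` against `2 n + 1` nodes: the `n` zeros `x i` and the `n + 1` points `y j`,
  -- at each of which a single summand of `q` survives.
  have hdeg : q.degree < #(univ : Finset (Fin n ⊕ Fin (n + 1))) := by
    have : q.degree ≤ ((2 * n : ℕ) : WithBot ℕ) := by
      refine (Polynomial.degree_sum_le _ _).trans (Finset.sup_le fun j _ => ?_)
      refine (Polynomial.degree_mul_le _ _).trans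
        ((add_le_add Polynomial.degree_C_le le_rfl).trans ?_)
      rw [zero_add, Polynomial.degree_prod]
      simp only [Polynomial.degree_mul, Polynomial.degree_X_sub_C]
      rw [sum_const, card_univ, Fintype.card_fin, nsmul_eq_mul]
      norm_cast
      exact (mul_comm _ _).le
    refine this.trans_lt ?_
    simp only [card_univ, Fintype.card_sum, Fintype.card_fin]
    norm_cast
    omega
  have hinj : Set.InjOn (Sum.elim x y) (univ : Finset (Fin n ⊕ Fin (n + 1))) := by
    refine Function.Injective.injOn ?_
    exact Function.Injective.sumElim hx hy hxy
  have key := congrArg (Polynomial.eval x0) (Lagrange.eq_interpolate hinj hdeg)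
  rw [hev, Lagrange.interpolate_apply, Polynomial.eval_finsetSum, Fintype.sum_sum_type] at key
  simp only [Polynomial.eval_mul, Polynomial.eval_C, Sum.elim_inl, Sum.elim_inr] at key
  have hz : ∑ i, Polynomial.eval (x i) q *
      Polynomial.eval x0 (Lagrange.basis univ (Sum.elim x y) (Sum.inl i)) = 0 :=
    sum_eq_zero fun i _ => by rw [hev, hq, zero_mul]
  rw [hz, zero_add] at key
  rw [key]
  refine sum_congr rfl fun j _ => ?_
  have hevj : q.eval (y j) = a j * ∏ l : Fin n, ((y j - y (j.succAbove l)) *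
      (y j - y (j.succAbove l) + c)) := by
    rw [hev, sum_eq_single j _ (by simp)]
    intro j' _ hj'
    obtain ⟨l, hl⟩ := Fin.exists_succAbove_eq hj'.symm
    rw [prod_eq_zero (mem_univ l) (by rw [hl]; ring), mul_zero]
  have hbas : ((Lagrange.basis univ (Sum.elim x y) (Sum.inr j)).eval x0) =
      ∏ l : Fin n, (((y j - x l)⁻¹ * (x0 - x l)) *
        ((y j - y (j.succAbove l))⁻¹ * (x0 - y (j.succAbove l)))) := by
    have he : (univ : Finset (Fin n ⊕ Fin (n + 1))).erase (Sum.inr j) =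
        univ.disjSum (univ.erase j) := by
      ext z; rcases z with z | z <;> simp
    rw [Lagrange.basis, he, prod_disjSum, Polynomial.eval_mul, Polynomial.eval_prod,
      Polynomial.eval_prod, prod_erase_fin j, prod_mul_distrib]
    simp [Lagrange.basisDivisor]
  rw [hevj, hbas, mul_assoc, ← prod_mul_distrib]
  congr 1
  refine prod_congr rfl fun l _ => ?_
  have h1 : y j - y (j.succAbove l) ≠ 0 :=
    sub_ne_zero.2 fun e => Fin.succAbove_ne j l (hy e).symm
  field_simp

/-- Laplace expansion gives numerators depending on `x 0`. Up to an explicit factor the sum is a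
polynomial in `x 0` of degree at most `2 n` that vanishes at the other `x i`, so interpolation at
the `y j` replaces `x 0` by `y j` in the numerators and leaves a sum over simple poles. -/
theorem izergin_recursion_left (c : ℂ) (hc : c ≠ 0) {n : ℕ} (x y : Fin (n + 1) → ℂ)
    (hx : Function.Injective x) (hy : Function.Injective y) (hxy : ∀ i j, x i ≠ y j) :
    izergin c x y = ∑ j : Fin (n + 1), g c (x 0) (y j) *
      (∏ l : Fin n, f c (y j) (y (j.succAbove l))) * (∏ i : Fin n, f c (x i.succ) (y j)) *
        izergin c (x ∘ Fin.succ) (y ∘ j.succAbove) := by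
  have hx' : Function.Injective (x ∘ Fin.succ) := hx.comp (Fin.succ_injective n)
  set a : Fin (n + 1) → ℂ := fun j => (∏ i : Fin n, h c (x i.succ) (y j)) *
    (∏ l : Fin n, (y (j.succAbove l) - y j))⁻¹ *
      izergin c (x ∘ Fin.succ) (y ∘ j.succAbove) with ha
  have hrow : ∀ t : ℂ, (∀ j, t ≠ y j) →
      ∑ j : Fin (n + 1), g c t (y j) * (∏ l : Fin n, h c t (y (j.succAbove l))) *
        (∏ i : Fin n, h c (x i.succ) (y j)) * (∏ l : Fin n, (y (j.succAbove l) - y j))⁻¹ *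
        izergin c (x ∘ Fin.succ) (y ∘ j.succAbove) =
      (c * (∏ j, (t - y j))⁻¹ * (∏ _l : Fin n, c)⁻¹) * ∑ j, a j * ∏ l : Fin n,
        ((t - y (j.succAbove l)) * (t - y (j.succAbove l) + c)) := by
    intro t ht
    rw [mul_sum]
    refine sum_congr rfl fun j _ => ?_
    have h1 : t - y j ≠ 0 := sub_ne_zero.2 (ht j)
    have h2 : (∏ l : Fin n, (t - y (j.succAbove l))) ≠ 0 :=
      prod_ne_zero_iff.2 fun l _ => sub_ne_zero.2 (ht _)
    rw [Fin.prod_univ_succAbove _ j]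
    simp only [ha, g, h, prod_mul_distrib, prod_div_distrib]
    field_simp
  -- Replacing `x 0` by `x i.succ` produces a matrix with two equal rows.
  have hq : ∀ i : Fin n, ∑ j, a j * ∏ l : Fin n, ((x i.succ - y (j.succAbove l)) *
      (x i.succ - y (j.succAbove l) + c)) = 0 := by
    intro i
    have hd := det_izerginMatrix_succ c hc (Fin.cons (x i.succ) (x ∘ Fin.succ)) y
      (by simpa [Function.comp_def] using hx') hy
    rw [Matrix.det_zero_of_row_eq (Fin.succ_ne_zero i).symm (by ext j; simp [izerginMatrix])]
      at hd
    have hcs : (Fin.cons (x i.succ) (x ∘ Fin.succ) : Fin (n + 1) → ℂ) ∘ Fin.succ =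
      x ∘ Fin.succ := by ext; simp
    simp only [hcs, Fin.cons_zero, Fin.cons_succ, Function.comp_apply] at hd
    rw [hrow _ (hxy i.succ)] at hd
    have h1 := vandermonde_det_ne_zero hx'
    have h2 := vandermonde_det_ne_zero hy
    have h3 : (∏ l : Fin n, ∏ _m ∈ Ioi l, -c ^ 2) ≠ 0 :=
      prod_ne_zero_iff.2 fun _ _ => prod_ne_zero_iff.2 fun _ _ => by simp [hc]
    have h4 : (∏ j, (x i.succ - y j)) ≠ 0 :=
      prod_ne_zero_iff.2 fun j _ => sub_ne_zero.2 (hxy _ _)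
    have h5 : (∏ _l : Fin n, c) ≠ 0 := prod_ne_zero_iff.2 fun j _ => hc
    have h6 := (mul_eq_zero.1 hd.symm).resolve_right
      (mul_ne_zero (mul_ne_zero h1 h2) (inv_ne_zero h3))
    exact (mul_eq_zero.1 h6).resolve_left
      (mul_ne_zero (mul_ne_zero hc (inv_ne_zero h4)) (inv_ne_zero h5))
  rw [izergin_succ c hc x y hx hy, hrow _ (hxy 0),
    interpolate_double c a y (fun i => x i.succ) (x 0) hx' hy (fun i j => hxy _ _) hq, mul_sum,
    mul_sum]
  refine sum_congr rfl fun j _ => ?_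
  have h1 : x 0 - y j ≠ 0 := sub_ne_zero.2 (hxy _ _)
  rw [Fin.prod_univ_succAbove _ j]
  have key : (∏ i : Fin n, -c ^ 2 / (x i.succ - x 0)) *
      (∏ l : Fin n, (x 0 - y (j.succAbove l)))⁻¹ * (∏ _l : Fin n, c)⁻¹ *
      (∏ i : Fin n, h c (x i.succ) (y j)) * (∏ l : Fin n, (y (j.succAbove l) - y j))⁻¹ *
      (∏ l : Fin n, ((y j - y (j.succAbove l) + c) *
        (x 0 - y (j.succAbove l)) * ((x 0 - x l.succ) / (y j - x l.succ)))) =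
      (∏ l : Fin n, f c (y j) (y (j.succAbove l))) * (∏ i : Fin n, f c (x i.succ) (y j)) := by
    simp only [← prod_inv_distrib, ← prod_mul_distrib]
    refine prod_congr rfl fun l _ => ?_
    have h2 : x l.succ - x 0 ≠ 0 := sub_ne_zero.2 fun e => Fin.succ_ne_zero l (hx e)
    have h3 : x 0 - y (j.succAbove l) ≠ 0 := sub_ne_zero.2 (hxy _ _)
    have h4 : y (j.succAbove l) - y j ≠ 0 := sub_ne_zero.2 fun e => Fin.succAbove_ne j l (hy e)
    have h5 : x l.succ - y j ≠ 0 := sub_ne_zero.2 (hxy _ _)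
    have h6 : y j - y (j.succAbove l) ≠ 0 := by rw [← neg_sub]; exact neg_ne_zero.2 h4
    have h7 : y j - x l.succ ≠ 0 := by rw [← neg_sub]; exact neg_ne_zero.2 h5
    unfold h f
    field_simp
    ring
  have hg : g c (x 0) (y j) = c * (x 0 - y j)⁻¹ := rfl
  rw [hg, mul_inv]
  simp only [ha]
  linear_combination (c * (x 0 - y j)⁻¹ * izergin c (x ∘ Fin.succ) (y ∘ j.succAbove)) * key

theorem izergin_recursion_right (c : ℂ) (hc : c ≠ 0) {n : ℕ} (x y : Fin (n + 1) → ℂ)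
    (hx : Function.Injective x) (hy : Function.Injective y) (hxy : ∀ i j, x i ≠ y j) :
    izergin c x y = ∑ i : Fin (n + 1), g c (x i) (y 0) *
      (∏ l : Fin n, f c (x (i.succAbove l)) (x i)) * (∏ l : Fin n, f c (x i) (y l.succ)) *
        izergin c (x ∘ i.succAbove) (y ∘ Fin.succ) := by
  rw [← izergin_neg, izergin_recursion_left (-c) (neg_ne_zero.2 hc) y x hy hx
    fun i j => (hxy j i).symm]
  simp only [g_neg, f_neg, izergin_neg]

/-! ### Partial fractions -/

theorem partial_fractions {ι : Type*} [DecidableEq ι] (s : Finset ι) (z a : ι → ℂ)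
    (hz : Set.InjOn z s) (w : ℂ) (hw : ∀ i ∈ s, w ≠ z i) :
    ∏ i ∈ s, (w - z i + a i) / (w - z i) =
      1 + ∑ i ∈ s, a i / (w - z i) * ∏ j ∈ s.erase i, (z i - z j + a j) / (z i - z j) := by
  induction s using Finset.induction_on generalizing w with
  | empty => simp
  | insert k s hk ih =>
    have hz' : Set.InjOn z s := hz.mono (by simp)
    have hne : ∀ i ∈ s, z k ≠ z i := fun i hi e =>
      hk (hz (by simp) (by simp [hi]) e ▸ hi)
    have hw' : ∀ i ∈ s, w ≠ z i := fun i hi => hw i (mem_insert_of_mem hi)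
    have hwk : w - z k ≠ 0 := sub_ne_zero.2 (hw k (mem_insert_self _ _))
    have h1 := ih hz' w hw'
    -- The induction hypothesis at the new pole supplies the product that multiplies `a k / (w - z
    -- k)`.
    have h2 := ih hz' (z k) hne
    rw [prod_insert hk, sum_insert hk, erase_insert hk]
    have h3 : ∀ i ∈ s, a i / (w - z i) * ∏ j ∈ (insert k s).erase i,
        (z i - z j + a j) / (z i - z j) =
        a i / (w - z i) * (∏ j ∈ s.erase i, (z i - z j + a j) / (z i - z j)) +
          a k / (w - z k) * (a i / (w - z i) * (∏ j ∈ s.erase i, (z i - z j + a j) / (z i - z j)) -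
          a i / (z k - z i) * (∏ j ∈ s.erase i, (z i - z j + a j) / (z i - z j))) := by
      intro i hi
      have hki : k ≠ i := fun e => hk (e ▸ hi)
      have e1 : z i - z k ≠ 0 := sub_ne_zero.2 (hne i hi).symm
      have e2 : z k - z i ≠ 0 := sub_ne_zero.2 (hne i hi)
      have e3 : w - z i ≠ 0 := sub_ne_zero.2 (hw' i hi)
      rw [erase_insert_of_ne hki, prod_insert (fun e => hk (mem_of_mem_erase e))]
      have : a i / (w - z i) * ((z i - z k + a k) / (z i - z k)) = a i / (w - z i) +
          a k / (w - z k) * (a i / (w - z i) - a i / (z k - z i)) := by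
        rw [← neg_sub (z i) (z k)] at *
        field_simp
        ring
      rw [← mul_assoc, this]; ring
    rw [sum_congr rfl h3, sum_add_distrib, ← mul_sum, sum_sub_distrib, h2, h1]
    field_simp
    ring

/-- Partial fractions in `w`, with poles at all `x i` and `y j` and numerator shifts `-c` and `c`
respectively. -/
theorem partial_fractions_f (c : ℂ) {n : ℕ} (x y : Fin (n + 1) → ℂ)
    (hx : Function.Injective x) (hy : Function.Injective y) (hxy : ∀ i j, x i ≠ y j) (w : ℂ)
    (hwx : ∀ i, w ≠ x i) (hwy : ∀ i, w ≠ y i) :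
    (∏ i, f c (x i) w) * ∏ j, f c w (y j) = 1 +
      (∑ i, g c (x i) w * (∏ l, f c (x (i.succAbove l)) (x i)) * ∏ j, f c (x i) (y j)) +
      ∑ j, g c w (y j) * (∏ l, f c (y j) (y (j.succAbove l))) * ∏ i, f c (x i) (y j) := by
  have key := partial_fractions (univ : Finset (Fin (n + 1) ⊕ Fin (n + 1))) (Sum.elim x y)
    (Sum.elim (fun _ => -c) (fun _ => c)) (Function.Injective.sumElim hx hy hxy).injOn w
    (by rintro (i | i) _ <;> simp [hwx, hwy])
  have e1 : ∀ j : Fin (n + 1), (univ : Finset (Fin (n + 1) ⊕ Fin (n + 1))).erase (Sum.inr j) =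
      univ.disjSum (univ.erase j) := by
    intro j; ext z; rcases z with z | z <;> simp
  have e2 : ∀ j : Fin (n + 1), (univ : Finset (Fin (n + 1) ⊕ Fin (n + 1))).erase (Sum.inl j) =
      (univ.erase j).disjSum univ := by
    intro j; ext z; rcases z with z | z <;> simp
  have e3 : ∀ a b : ℂ, (a - b + -c) / (a - b) = f c b a := by
    intro a b; rw [← f_neg]; rfl
  have e4 : ∀ a b : ℂ, (a - b + c) / (a - b) = f c a b := fun _ _ => rfl
  have e5 : ∀ a b : ℂ, -c / (a - b) = g c b a := by
    intro a b; rw [← g_neg]; rfl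
  have e6 : ∀ a b : ℂ, c / (a - b) = g c a b := fun _ _ => rfl
  simp only [Fintype.prod_sum_type, Fintype.sum_sum_type, e1, e2, prod_disjSum, Sum.elim_inl,
    Sum.elim_inr, prod_erase_fin, e3, e4, e5, e6] at key
  rw [key, add_assoc]
  congr 2
  · exact sum_congr rfl fun i _ => by ring
  · exact sum_congr rfl fun i _ => by ring

/-! ### The quotient `K_k(x|y) / f(x,y)` at generic arguments -/

theorem f_ne_zero {c x y : ℂ} (h1 : x ≠ y) (h2 : x - y + c ≠ 0) : f c x y ≠ 0 :=
  div_ne_zero h2 (sub_ne_zero.2 h1)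

theorem izerginDivF_eq_izergin (c : ℂ) (hc : c ≠ 0) {k : ℕ} (x y : Fin k → ℂ)
    (hxy : ∀ i j, x i ≠ y j) (hh : ∀ i j, x i - y j + c ≠ 0) :
    izerginDivF c x y = izergin c x y / ∏ i, ∏ j, f c (x i) (y j) := by
  rw [izerginDivF_eq c hc x y hh hxy, izergin_eq c hc x y hh]

/-- Division by `f(x, y)` removes the factors `f(x_i, y_j)` with `i ≠ 0` from the recursion, so that
the coefficients depend on `x 0` and the set of the `y j` alone. -/
theorem izerginDivF_mul_f_left_zero (c : ℂ) (hc : c ≠ 0) {n : ℕ} (x y : Fin (n + 1) → ℂ)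
    (hx : Function.Injective x) (hy : Function.Injective y) (hxy : ∀ i j, x i ≠ y j)
    (hh : ∀ i j, x i - y j + c ≠ 0) :
    izerginDivF c x y * ∏ j, f c (x 0) (y j) = ∑ j : Fin (n + 1), g c (x 0) (y j) *
      (∏ l : Fin n, f c (y j) (y (j.succAbove l))) *
        izerginDivF c (x ∘ Fin.succ) (y ∘ j.succAbove) := by
  have hf : ∀ i j, f c (x i) (y j) ≠ 0 := fun i j => f_ne_zero (hxy i j) (hh i j)
  rw [izerginDivF_eq_izergin c hc x y hxy hh, izergin_recursion_left c hc x y hx hy hxy,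
    sum_div, sum_mul]
  refine sum_congr rfl fun j _ => ?_
  rw [izerginDivF_eq_izergin c hc (x ∘ Fin.succ) (y ∘ j.succAbove) (fun a b => hxy _ _)
    (fun a b => hh _ _), Fin.prod_univ_succ]
  have h1 : ∏ i : Fin n, ∏ j, f c (x i.succ) (y j) = (∏ i : Fin n, f c (x i.succ) (y j)) *
      ∏ i : Fin n, ∏ l : Fin n, f c (x i.succ) (y (j.succAbove l)) := by
    rw [← prod_mul_distrib]
    exact prod_congr rfl fun i _ => Fin.prod_univ_succAbove _ j
  rw [h1]
  have h2 : ∏ j, f c (x 0) (y j) ≠ 0 := prod_ne_zero_iff.2 fun j _ => hf _ _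
  have h3 : ∏ i : Fin n, f c (x i.succ) (y j) ≠ 0 := prod_ne_zero_iff.2 fun j _ => hf _ _
  have h4 : ∏ i : Fin n, ∏ l : Fin n, f c (x i.succ) (y (j.succAbove l)) ≠ 0 :=
    prod_ne_zero_iff.2 fun j _ => prod_ne_zero_iff.2 fun j _ => hf _ _
  simp only [Function.comp_apply]
  field_simp

theorem izerginDivF_mul_f_left (c : ℂ) (hc : c ≠ 0) {n : ℕ} (x y : Fin (n + 1) → ℂ)
    (hx : Function.Injective x) (hy : Function.Injective y) (hxy : ∀ i j, x i ≠ y j)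
    (hh : ∀ i j, x i - y j + c ≠ 0) (i : Fin (n + 1)) :
    izerginDivF c x y * ∏ j, f c (x i) (y j) = ∑ j : Fin (n + 1), g c (x i) (y j) *
      (∏ l : Fin n, f c (y j) (y (j.succAbove l))) *
        izerginDivF c (x ∘ i.succAbove) (y ∘ j.succAbove) := by
  have key := izerginDivF_mul_f_left_zero c hc (x ∘ i.cycleRange.symm) y
    (hx.comp i.cycleRange.symm.injective) hy (fun a b => hxy _ _) fun a b => hh _ _
  have h3 : (x ∘ i.cycleRange.symm) ∘ Fin.succ = x ∘ i.succAbove := by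
    ext l; simp
  rw [h3, izerginDivF_comp_left] at key
  simpa using key

theorem izerginDivF_mul_f_right_zero (c : ℂ) (hc : c ≠ 0) {n : ℕ} (x y : Fin (n + 1) → ℂ)
    (hx : Function.Injective x) (hy : Function.Injective y) (hxy : ∀ i j, x i ≠ y j)
    (hh : ∀ i j, x i - y j + c ≠ 0) :
    izerginDivF c x y * ∏ i, f c (x i) (y 0) = ∑ i : Fin (n + 1), g c (x i) (y 0) *
      (∏ l : Fin n, f c (x (i.succAbove l)) (x i)) *
        izerginDivF c (x ∘ i.succAbove) (y ∘ Fin.succ) := by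
  have hf : ∀ i j, f c (x i) (y j) ≠ 0 := fun i j => f_ne_zero (hxy i j) (hh i j)
  rw [izerginDivF_eq_izergin c hc x y hxy hh, izergin_recursion_right c hc x y hx hy hxy,
    sum_div, sum_mul]
  refine sum_congr rfl fun i _ => ?_
  rw [izerginDivF_eq_izergin c hc (x ∘ i.succAbove) (y ∘ Fin.succ) (fun a b => hxy _ _)
    (fun a b => hh _ _), prod_comm,
    Fin.prod_univ_succ]
  have h1 : ∏ j : Fin n, ∏ i, f c (x i) (y j.succ) = (∏ j : Fin n, f c (x i) (y j.succ)) *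
      ∏ l : Fin n, ∏ j : Fin n, f c (x (i.succAbove l)) (y j.succ) := by
    rw [prod_comm (s := univ) (t := univ) (f := fun (l j : Fin n) =>
      f c (x (i.succAbove l)) (y j.succ)), ← prod_mul_distrib]
    exact prod_congr rfl fun j _ => Fin.prod_univ_succAbove _ i
  rw [h1]
  have h2 : ∏ i, f c (x i) (y 0) ≠ 0 := prod_ne_zero_iff.2 fun j _ => hf _ _
  have h3 : ∏ j : Fin n, f c (x i) (y j.succ) ≠ 0 := prod_ne_zero_iff.2 fun j _ => hf _ _
  have h4 : ∏ l : Fin n, ∏ j : Fin n, f c (x (i.succAbove l)) (y j.succ) ≠ 0 :=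
    prod_ne_zero_iff.2 fun j _ => prod_ne_zero_iff.2 fun j _ => hf _ _
  simp only [Function.comp_apply]
  field_simp

theorem izerginDivF_mul_f_right (c : ℂ) (hc : c ≠ 0) {n : ℕ} (x y : Fin (n + 1) → ℂ)
    (hx : Function.Injective x) (hy : Function.Injective y) (hxy : ∀ i j, x i ≠ y j)
    (hh : ∀ i j, x i - y j + c ≠ 0) (j : Fin (n + 1)) :
    izerginDivF c x y * ∏ i, f c (x i) (y j) = ∑ i : Fin (n + 1), g c (x i) (y j) *
      (∏ l : Fin n, f c (x (i.succAbove l)) (x i)) *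
        izerginDivF c (x ∘ i.succAbove) (y ∘ j.succAbove) := by
  have key := izerginDivF_mul_f_right_zero c hc x (y ∘ j.cycleRange.symm) hx
    (hy.comp j.cycleRange.symm.injective) (fun a b => hxy _ _) fun a b => hh _ _
  have h3 : (y ∘ j.cycleRange.symm) ∘ Fin.succ = y ∘ j.succAbove := by
    ext l; simp
  rw [h3, izerginDivF_comp_right] at key
  simpa using key

theorem h_inv_eq (c : ℂ) (hc : c ≠ 0) {x y : ℂ} (hxy : x ≠ y) (hh : x - y + c ≠ 0) :
    (h c x y)⁻¹ = fInv c x y * g c x y := by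
  have := sub_ne_zero.2 hxy
  unfold h fInv g; field_simp

theorem fInv_mul_f {c x y : ℂ} (hxy : x ≠ y) (hh : x - y + c ≠ 0) : fInv c x y * f c x y = 1 := by
  have := sub_ne_zero.2 hxy
  unfold fInv f; field_simp

/-- Since `g / f = 1 / h`, this form has no pole at `x i = y j` and can be extended to coinciding
arguments. -/
theorem izerginDivF_recursion_generic (c : ℂ) (hc : c ≠ 0) {n : ℕ} (x y : Fin (n + 1) → ℂ)
    (hx : Function.Injective x) (hy : Function.Injective y) (hxy : ∀ i j, x i ≠ y j)
    (hh : ∀ i j, x i - y j + c ≠ 0) :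
    izerginDivF c x y = ∑ i : Fin (n + 1), (h c (x i) (y 0))⁻¹ *
      (∏ l : Fin n, fInv c (x (i.succAbove l)) (y 0)) *
      (∏ l : Fin n, f c (x (i.succAbove l)) (x i)) *
        izerginDivF c (x ∘ i.succAbove) (y ∘ Fin.succ) := by
  have key := congrArg (fun t => (∏ i, fInv c (x i) (y 0)) * t)
    (izerginDivF_mul_f_right_zero c hc x y hx hy hxy hh)
  rw [mul_left_comm, ← prod_mul_distrib, prod_congr rfl fun i _ => fInv_mul_f (hxy i 0) (hh i 0),
    prod_const_one, mul_one, mul_sum] at key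
  rw [key]
  refine sum_congr rfl fun i _ => ?_
  rw [h_inv_eq c hc (hxy i 0) (hh i 0), Fin.prod_univ_succAbove _ i]
  ring

/-- Expanding each summand on the right in the variable `w` gives a double sum with weights `g(w,
y_j) g(x_i, w)`. These split over the common factor `g(x_i, y_j)`, the inner sums are again
recursions for `K/f`, and what remains is the partial fraction expansion of `f(x, w) f(w, y)`. -/
theorem izerginDivF_exchange_generic (c : ℂ) (hc : c ≠ 0) {n : ℕ} (x y : Fin (n + 1) → ℂ)
    (hx : Function.Injective x) (hy : Function.Injective y) (hxy : ∀ i j, x i ≠ y j)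
    (hh : ∀ i j, x i - y j + c ≠ 0) (w : ℂ) (hwx : ∀ i, x i ≠ w) (hwy : ∀ i, w ≠ y i)
    (hhw : ∀ i, x i - w + c ≠ 0) :
    izerginDivF c x y * (∏ j, f c w (y j) - ∏ i, fInv c (x i) w) =
      ∑ j : Fin (n + 1), g c w (y j) * (∏ l, f c (y j) (y (j.succAbove l))) *
        izerginDivF c x (Fin.cons w (y ∘ j.succAbove)) := by
  have h1 : ∀ j : Fin (n + 1), izerginDivF c x (Fin.cons w (y ∘ j.succAbove)) =
      (∏ i, fInv c (x i) w) * ∑ i : Fin (n + 1), g c (x i) w *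
        (∏ l : Fin n, f c (x (i.succAbove l)) (x i)) *
        izerginDivF c (x ∘ i.succAbove) (y ∘ j.succAbove) := by
    intro j
    rw [izerginDivF_recursion_generic c hc x _ hx, mul_sum]
    · refine sum_congr rfl fun i _ => ?_
      have e : (Fin.cons w (y ∘ j.succAbove) : Fin (n + 1) → ℂ) ∘ Fin.succ = y ∘ j.succAbove := by
        ext; simp
      rw [e, Fin.cons_zero, h_inv_eq c hc (hwx i) (hhw i), Fin.prod_univ_succAbove _ i]
      ring
    · refine Fin.cons_injective_iff.2 ⟨?_, hy.comp Fin.succAbove_right_injective⟩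
      rintro ⟨l, hl⟩
      exact hwy _ hl.symm
    · intro a b
      refine Fin.cases ?_ (fun b => ?_) b
      · simpa using hwx a
      · simpa using hxy _ _
    · intro a b
      refine Fin.cases ?_ (fun b => ?_) b
      · simpa using hhw a
      · simpa using hh _ _
  have hsplit : ∀ i j, g c w (y j) * g c (x i) w = g c (x i) (y j) * g c (x i) w +
      g c (x i) (y j) * g c w (y j) := by
    intro i j
    have e1 := sub_ne_zero.2 (hwx i)
    have e2 := sub_ne_zero.2 (hwy j)
    have e3 := sub_ne_zero.2 (hxy i j)
    unfold g
    field_simp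
    ring
  have hinv : (∏ i, fInv c (x i) w) * ∏ i, f c (x i) w = 1 := by
    rw [← prod_mul_distrib, prod_congr rfl fun i _ => fInv_mul_f (hwx i) (hhw i), prod_const_one]
  have hpf := partial_fractions_f c x y hx hy hxy w (fun i => (hwx i).symm) hwy
  have hsum : ∑ j : Fin (n + 1), g c w (y j) * (∏ l, f c (y j) (y (j.succAbove l))) *
        ∑ i : Fin (n + 1), g c (x i) w *
        (∏ l : Fin n, f c (x (i.succAbove l)) (x i)) *
        izerginDivF c (x ∘ i.succAbove) (y ∘ j.succAbove) =
      (∑ i, g c (x i) w * (∏ l, f c (x (i.succAbove l)) (x i)) *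
        (izerginDivF c x y * ∏ j, f c (x i) (y j))) +
      ∑ j, g c w (y j) * (∏ l, f c (y j) (y (j.succAbove l))) *
        (izerginDivF c x y * ∏ i, f c (x i) (y j)) := by
    simp only [izerginDivF_mul_f_left c hc x y hx hy hxy hh,
      izerginDivF_mul_f_right c hc x y hx hy hxy hh]
    simp only [mul_sum]
    rw [sum_comm (f := fun (i j : Fin (n + 1)) => g c (x i) w *
      (∏ l, f c (x (i.succAbove l)) (x i)) * (g c (x i) (y j) *
      (∏ l : Fin n, f c (y j) (y (j.succAbove l))) *
        izerginDivF c (x ∘ i.succAbove) (y ∘ j.succAbove))), ← sum_add_distrib]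
    refine sum_congr rfl fun j _ => ?_
    rw [← sum_add_distrib]
    refine sum_congr rfl fun i _ => ?_
    linear_combination ((∏ l, f c (y j) (y (j.succAbove l))) *
      (∏ l : Fin n, f c (x (i.succAbove l)) (x i)) *
        izerginDivF c (x ∘ i.succAbove) (y ∘ j.succAbove)) * hsplit i j
  simp only [h1]
  rw [sum_congr rfl fun j _ => mul_left_comm (g c w (y j) * ∏ l, f c (y j) (y (j.succAbove l)))
    (∏ i, fInv c (x i) w) _, ← mul_sum, hsum]
  simp only [mul_left_comm _ (izerginDivF c x y), ← mul_sum]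
  linear_combination izerginDivF c x y * (∏ i, fInv c (x i) w) * hpf -
    izerginDivF c x y * (∏ j, f c w (y j)) * hinv

/-! ### Removable singularities -/

theorem eq_of_eventuallyEq_punctured {F G : ℂ → ℂ} (hF : ContinuousAt F 0)
    (hG : ContinuousAt G 0) (hFG : ∀ᶠ e in nhdsWithin (0 : ℂ) {0}ᶜ, F e = G e) : F 0 = G 0 :=
  tendsto_nhds_unique ((hF.tendsto.mono_left nhdsWithin_le_nhds).congr' hFG)
    (hG.tendsto.mono_left nhdsWithin_le_nhds)

theorem eventually_add_ne_zero (a : ℂ) : ∀ᶠ e in nhdsWithin (0 : ℂ) {0}ᶜ, a + e ≠ 0 := by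
  by_cases ha : a = 0
  · subst ha
    filter_upwards [self_mem_nhdsWithin] with e he
    simpa using he
  · refine Filter.Eventually.filter_mono nhdsWithin_le_nhds ?_
    have : ContinuousAt (fun e : ℂ => a + e) 0 := by fun_prop
    exact this.eventually_ne (by simpa using ha)

theorem eventually_generic {ι κ : Type*} [Finite ι] [Finite κ] (c : ℂ) (x : ι → ℂ) (y : κ → ℂ) :
    ∀ᶠ e in nhdsWithin (0 : ℂ) {0}ᶜ, (∀ i j, x i + e ≠ y j) ∧
      ∀ i j, x i + e - y j + c ≠ 0 := by
  refine Filter.Eventually.and ?_ ?_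
  · refine Filter.eventually_all.2 fun i => Filter.eventually_all.2 fun j => ?_
    refine (eventually_add_ne_zero (x i - y j)).mono fun e he e' => he ?_
    rw [← e']; ring
  · refine Filter.eventually_all.2 fun i => Filter.eventually_all.2 fun j => ?_
    refine (eventually_add_ne_zero (x i - y j + c)).mono fun e he e' => he ?_
    rw [← e']; ring

theorem continuousAt_fInv_add {c x y : ℂ} (hh : x - y + c ≠ 0) :
    ContinuousAt (fun e : ℂ => fInv c (x + e) y) 0 := by
  unfold fInv
  refine ContinuousAt.div (by fun_prop) (by fun_prop) (by simpa using hh)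

theorem continuousAt_h_inv_add {c x y : ℂ} (hc : c ≠ 0) (hh : x - y + c ≠ 0) :
    ContinuousAt (fun e : ℂ => (h c (x + e) y)⁻¹) 0 := by
  unfold h
  refine ContinuousAt.inv₀ (by fun_prop) ?_
  simpa using ⟨hh, hc⟩

/-- Translating all `x i` by the same `e` leaves the prefactor unchanged and moves only the
differences `x_i - y_j`, so one parameter separates the two sets without disturbing either. -/
theorem continuousAt_izerginDivF_add {c : ℂ} (hc : c ≠ 0) {k : ℕ} (x y : Fin k → ℂ)
    (hh : ∀ i j, x i - y j + c ≠ 0) :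
    ContinuousAt (fun e : ℂ => izerginDivF c (fun i => x i + e) y) 0 := by
  have h1 : ∀ e : ℂ, izerginPrefactor c (fun i => x i + e) y = izerginPrefactor c x y := by
    intro e; simp [izerginPrefactor, g]
  simp only [izerginDivF, h1]
  refine continuousAt_const.mul ?_
  have h2 : ContinuousAt (fun e : ℂ => (Matrix.of fun i j =>
      (h c (x i + e) (y j))⁻¹ * ∏ l ∈ univ.erase j, (x i + e - y l) / c :
        Matrix (Fin k) (Fin k) ℂ)) 0 := by
    refine continuousAt_pi.2 fun i => continuousAt_pi.2 fun j => ?_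
    exact (continuousAt_h_inv_add hc (hh i j)).mul (by fun_prop)
  exact (continuous_id.matrix_det.continuousAt (x := _)).comp h2

theorem izerginDivF_recursion (c : ℂ) (hc : c ≠ 0) {n : ℕ} (x y : Fin (n + 1) → ℂ)
    (hx : Function.Injective x) (hy : Function.Injective y)
    (hh : ∀ i j, x i - y j + c ≠ 0) :
    izerginDivF c x y = ∑ i : Fin (n + 1), (h c (x i) (y 0))⁻¹ *
      (∏ l : Fin n, fInv c (x (i.succAbove l)) (y 0)) *
      (∏ l : Fin n, f c (x (i.succAbove l)) (x i)) *
        izerginDivF c (x ∘ i.succAbove) (y ∘ Fin.succ) := by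
  have key := eq_of_eventuallyEq_punctured (continuousAt_izerginDivF_add hc x y hh)
    (G := fun e => ∑ i : Fin (n + 1), (h c (x i + e) (y 0))⁻¹ *
      (∏ l : Fin n, fInv c (x (i.succAbove l) + e) (y 0)) *
      (∏ l : Fin n, f c (x (i.succAbove l)) (x i)) *
        izerginDivF c (fun l => (x ∘ i.succAbove) l + e) (y ∘ Fin.succ)) ?_ ?_
  · simpa [Function.comp_def] using key
  · refine tendsto_finsetSum _ fun i _ => ?_
    refine ContinuousAt.mul (ContinuousAt.mul (ContinuousAt.mul
      (continuousAt_h_inv_add hc (hh _ _)) ?_) continuousAt_const) ?_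
    · exact tendsto_finsetProd _ fun l _ => continuousAt_fInv_add (hh _ _)
    · exact continuousAt_izerginDivF_add hc _ _ fun a b => hh _ _
  · refine (eventually_generic c x y).mono fun e he => ?_
    rw [izerginDivF_recursion_generic c hc _ y
      (fun a b hab => hx (by simpa using hab)) hy he.1 he.2]
    refine sum_congr rfl fun i _ => ?_
    have : ∀ l, f c (x (i.succAbove l) + e) (x i + e) = f c (x (i.succAbove l)) (x i) := by
      intro l; simp [f]
    simp only [this]
    rfl

theorem izerginDivF_exchange (c : ℂ) (hc : c ≠ 0) {n : ℕ} (x y : Fin (n + 1) → ℂ)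
    (hx : Function.Injective x) (hy : Function.Injective y)
    (hh : ∀ i j, x i - y j + c ≠ 0) (w : ℂ) (hwy : ∀ i, w ≠ y i)
    (hhw : ∀ i, x i - w + c ≠ 0) :
    izerginDivF c x y * (∏ j, f c w (y j) - ∏ i, fInv c (x i) w) =
      ∑ j : Fin (n + 1), g c w (y j) * (∏ l, f c (y j) (y (j.succAbove l))) *
        izerginDivF c x (Fin.cons w (y ∘ j.succAbove)) := by
  have key := eq_of_eventuallyEq_punctured
    (F := fun e => izerginDivF c (fun i => x i + e) y *
      (∏ j, f c w (y j) - ∏ i, fInv c (x i + e) w))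
    (G := fun e => ∑ j : Fin (n + 1), g c w (y j) * (∏ l, f c (y j) (y (j.succAbove l))) *
        izerginDivF c (fun i => x i + e) (Fin.cons w (y ∘ j.succAbove))) ?_ ?_ ?_
  · simpa using key
  · refine (continuousAt_izerginDivF_add hc x y hh).mul (continuousAt_const.sub ?_)
    exact tendsto_finsetProd _ fun l _ => continuousAt_fInv_add (hhw _)
  · refine tendsto_finsetSum _ fun i _ => ?_
    refine ContinuousAt.mul continuousAt_const (continuousAt_izerginDivF_add hc _ _ fun a b => ?_)
    refine Fin.cases ?_ (fun b => ?_) b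
    · simpa using hhw a
    · simpa using hh _ _
  · filter_upwards [eventually_generic c x y, eventually_generic c x fun _ : Unit => w]
      with e he he'
    exact izerginDivF_exchange_generic c hc _ y (fun a b hab => hx (by simpa using hab)) hy he.1
      he.2 w (fun i => he'.1 i ()) hwy fun i => he'.2 i ()

/-! ### Enumerations of finite sets -/

theorem enum_eq_getElem {k : ℕ} {X : Finset ℂ} (hX : X.card = k) (i : Fin k) :
    enum k X i = X.toList[(i : ℕ)]'(by simp [hX]) := by
  simp [enum, List.getD_eq_getElem?_getD, hX]

theorem enum_injective {k : ℕ} {X : Finset ℂ} (hX : X.card = k) :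
    Function.Injective (enum k X) := by
  intro i j hij
  rw [enum_eq_getElem hX, enum_eq_getElem hX] at hij
  exact Fin.ext ((X.nodup_toList.getElem_inj_iff).1 hij)

theorem image_enum {k : ℕ} {X : Finset ℂ} (hX : X.card = k) : univ.image (enum k X) = X := by
  refine eq_of_subset_of_card_le ?_ ?_
  · intro a ha
    obtain ⟨i, _, rfl⟩ := mem_image.1 ha
    rw [enum_eq_getElem hX]
    exact mem_toList.1 (List.getElem_mem _)
  · rw [card_image_of_injective _ (enum_injective hX), hX, card_univ, Fintype.card_fin]

theorem exists_perm_of_image_eq {k : ℕ} {x y : Fin k → ℂ} (hx : Function.Injective x)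
    (hxy : univ.image x = univ.image y) :
    ∃ σ : Equiv.Perm (Fin k), x = y ∘ σ := by
  have h1 : ∀ i, ∃ j, y j = x i := by
    intro i
    have : x i ∈ univ.image y := hxy ▸ mem_image_of_mem x (mem_univ i)
    simpa using this
  choose s hs using h1
  have hinj : Function.Injective s := fun a b hab => hx (by rw [← hs a, ← hs b, hab])
  exact ⟨Equiv.ofBijective s (Finite.injective_iff_bijective.1 hinj),
    funext fun i => (hs i).symm⟩

theorem card_image_fin {k : ℕ} {x : Fin k → ℂ} (hx : Function.Injective x) :
    (univ.image x).card = k := by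
  rw [card_image_of_injective _ hx, card_univ, Fintype.card_fin]

theorem exists_perm_enum {k : ℕ} {x : Fin k → ℂ} (hx : Function.Injective x) :
    ∃ σ : Equiv.Perm (Fin k), enum k (univ.image x) = x ∘ σ :=
  exists_perm_of_image_eq (enum_injective (card_image_fin hx)) (image_enum (card_image_fin hx))

/-- Independence of the enumeration: any injective tuple may represent the set. -/
theorem izerginQuot_image (c : ℂ) {k : ℕ} {x y : Fin k → ℂ} (hx : Function.Injective x)
    (hy : Function.Injective y) :
    izerginQuot c k (univ.image x) (univ.image y) = izerginDivF c x y := by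
  obtain ⟨σ, hσ⟩ := exists_perm_enum hx
  obtain ⟨τ, hτ⟩ := exists_perm_enum hy
  rw [izerginQuot, hσ, hτ, izerginDivF_comp_left, izerginDivF_comp_right]

theorem izerginShift_image (c : ℂ) {k : ℕ} {x y : Fin k → ℂ} (hx : Function.Injective x)
    (hy : Function.Injective y) :
    izerginShift c k (univ.image x) (univ.image y) = izergin c x (fun j => y j + c) := by
  obtain ⟨σ, hσ⟩ := exists_perm_enum hx
  obtain ⟨τ, hτ⟩ := exists_perm_enum hy
  rw [izerginShift, hσ, hτ, izergin_comp_left]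
  exact izergin_comp_right c x (fun j => y j + c) τ

theorem izergin_add (c e : ℂ) {k : ℕ} (x y : Fin k → ℂ) :
    izergin c (fun i => x i + e) (fun i => y i + e) = izergin c x y := by
  simp [izergin, izerginPrefactor, g, h]

/-- Transposition turns the shift of one set by `-c` into a shift of the other by `c`, after a
common translation. -/
theorem izerginShift_neg (c : ℂ) (k : ℕ) (X Y : Finset ℂ) :
    izerginShift (-c) k Y X = izerginShift c k X Y := by
  unfold izerginShift
  rw [← izergin_neg c, ← izergin_add (-c) c (enum k Y)]
  simp

theorem erase_image_fin {n : ℕ} {x : Fin (n + 1) → ℂ} (hx : Function.Injective x)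
    (i : Fin (n + 1)) : (univ.image x).erase (x i) = univ.image (x ∘ i.succAbove) := by
  rw [← image_image, Fin.image_succAbove_univ, ← image_erase hx, compl_eq_univ_sdiff,
    sdiff_singleton_eq_erase]

theorem insert_image_fin {n : ℕ} (w : ℂ) (y : Fin n → ℂ) :
    insert w (univ.image y) = univ.image (Fin.cons w y : Fin (n + 1) → ℂ) := by
  ext a
  simp [Fin.exists_fin_succ, eq_comm]

theorem exists_image_fin {k : ℕ} {X : Finset ℂ} (hX : X.card = k) :
    ∃ x : Fin k → ℂ, Function.Injective x ∧ univ.image x = X :=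
  ⟨enum k X, enum_injective hX, image_enum hX⟩

theorem cons_injective_of_notMem {n : ℕ} {w : ℂ} {y : Fin n → ℂ} (hy : Function.Injective y)
    (hw : w ∉ univ.image y) : Function.Injective (Fin.cons w y : Fin (n + 1) → ℂ) := by
  refine Fin.cons_injective_iff.2 ⟨?_, hy⟩
  rintro ⟨l, hl⟩
  exact hw (hl ▸ mem_image_of_mem y (mem_univ l))

/-! ### Recursions for sets -/

/-- The quotient `K_k(X|Y) / f(X,Y)`, extended by zero to sets of different cardinality. -/
noncomputable def kQuot (c : ℂ) (X Y : Finset ℂ) : ℂ :=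
  if X.card = Y.card then izerginQuot c Y.card X Y else 0

theorem kQuot_image (c : ℂ) {k : ℕ} {x y : Fin k → ℂ} (hx : Function.Injective x)
    (hy : Function.Injective y) :
    kQuot c (univ.image x) (univ.image y) = izerginDivF c x y := by
  have h := izerginQuot_image c hx hy
  unfold kQuot
  rw [card_image_fin hx, card_image_fin hy, if_pos rfl, h]

theorem kQuot_empty (c : ℂ) : kQuot c ∅ ∅ = 1 := by
  have h0 : ∀ x y : Fin 0 → ℂ, izerginDivF c x y = 1 := by
    intro x y; simp [izerginDivF, izerginPrefactor]
  exact (if_pos rfl).trans (h0 _ _)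

theorem kQuot_insert (c : ℂ) (hc : c ≠ 0) (X Y : Finset ℂ) (w : ℂ) (hw : w ∉ Y)
    (hh : ∀ x ∈ X, ∀ y ∈ insert w Y, x - y + c ≠ 0) :
    kQuot c X (insert w Y) = ∑ x ∈ X, (h c x w)⁻¹ * (∏ z ∈ X.erase x, fInv c z w) *
      (∏ z ∈ X.erase x, f c z x) * kQuot c (X.erase x) Y := by
  by_cases hcard : X.card = Y.card + 1
  · generalize hn : Y.card = n at hcard
    obtain ⟨x, hx, rfl⟩ := exists_image_fin hcard
    obtain ⟨y, hy, rfl⟩ := exists_image_fin hn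
    rw [insert_image_fin] at hh ⊢
    have hcons := cons_injective_of_notMem hy hw
    rw [kQuot_image c hx hcons, izerginDivF_recursion c hc x _ hx hcons
      fun i j => hh _ (mem_image_of_mem x (mem_univ i)) _ (mem_image_of_mem _ (mem_univ j)),
      sum_image hx.injOn]
    refine sum_congr rfl fun i _ => ?_
    have hxi : Function.Injective (x ∘ i.succAbove) := hx.comp Fin.succAbove_right_injective
    have e : (Fin.cons w y : Fin (n + 1) → ℂ) ∘ Fin.succ = y := by ext; simp
    rw [erase_image_fin hx, prod_image hxi.injOn, prod_image hxi.injOn, kQuot_image c hxi hy, e,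
      Fin.cons_zero]
    rfl
  · rw [kQuot, if_neg (by rwa [card_insert_of_notMem hw])]
    refine (sum_eq_zero fun x hx => ?_).symm
    rw [kQuot, if_neg, mul_zero]
    rw [card_erase_of_mem hx]
    have := card_pos.2 ⟨x, hx⟩
    omega

/-- This accounts for the terms in which `T₁₃(w)`, carried through the `T₁₂`, exchanges its argument
with one of theirs. -/
theorem kQuot_exchange (c : ℂ) (hc : c ≠ 0) (X Y : Finset ℂ) (w : ℂ) (hw : w ∉ Y)
    (hh : ∀ x ∈ X, ∀ y ∈ insert w Y, x - y + c ≠ 0) :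
    kQuot c X Y * (∏ y ∈ Y, f c w y - ∏ x ∈ X, fInv c x w) =
      ∑ y ∈ Y, g c w y * (∏ z ∈ Y.erase y, f c y z) * kQuot c X (insert w (Y.erase y)) := by
  by_cases hcard : X.card = Y.card
  · rcases hn : Y.card with _ | n
    · rw [hn] at hcard
      rw [card_eq_zero.1 hn, card_eq_zero.1 hcard]
      simp
    · rw [hn] at hcard
      obtain ⟨x, hx, rfl⟩ := exists_image_fin hcard
      obtain ⟨y, hy, rfl⟩ := exists_image_fin hn
      have hh' : ∀ i j, x i - y j + c ≠ 0 := fun i j =>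
        hh _ (mem_image_of_mem x (mem_univ i)) _
          (mem_insert_of_mem (mem_image_of_mem _ (mem_univ j)))
      have hhw : ∀ i, x i - w + c ≠ 0 := fun i =>
        hh _ (mem_image_of_mem x (mem_univ i)) _ (mem_insert_self _ _)
      have hwy : ∀ j, w ≠ y j := fun j e => hw (e ▸ mem_image_of_mem y (mem_univ j))
      rw [kQuot_image c hx hy, sum_image hy.injOn, prod_image hx.injOn, prod_image hy.injOn,
        izerginDivF_exchange c hc x y hx hy hh' w hwy hhw]
      refine sum_congr rfl fun j _ => ?_
      have hyj : Function.Injective (y ∘ j.succAbove) := hy.comp Fin.succAbove_right_injective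
      have hwj : w ∉ univ.image (y ∘ j.succAbove) := by
        rw [← erase_image_fin hy]; exact fun e => hw (mem_of_mem_erase e)
      rw [erase_image_fin hy, prod_image hyj.injOn, insert_image_fin,
        kQuot_image c hx (cons_injective_of_notMem hyj hwj)]
      rfl
  · rw [kQuot, if_neg hcard, zero_mul]
    refine (sum_eq_zero fun y hy => ?_).symm
    rw [kQuot, if_neg, mul_zero]
    rw [card_insert_of_notMem fun e => hw (mem_of_mem_erase e), card_erase_of_mem hy]
    have := card_pos.2 ⟨y, hy⟩
    omega

/-- The recursion of `K` in the second set at shifted arguments, where `g(x, p + c) = -1/h(p, x)`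
and `f(x, y + c) = 1/f(y, x)`. No pole is left at `x = y`, so the sets may intersect. -/
theorem izerginShift_insert (c : ℂ) (hc : c ≠ 0) (n : ℕ) (X Y : Finset ℂ) (p : ℂ) (hp : p ∉ Y)
    (hX : X.card = n + 1) (hY : Y.card = n) (hh : ∀ x ∈ X, ∀ y ∈ insert p Y, y - x + c ≠ 0) :
    izerginShift c (n + 1) X (insert p Y) = ∑ x ∈ X, -(h c p x)⁻¹ * (∏ z ∈ X.erase x, f c z x) *
      (∏ y ∈ Y, fInv c y x) * izerginShift c n (X.erase x) Y := by
  obtain ⟨x, hx, rfl⟩ := exists_image_fin hX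
  obtain ⟨y, hy, rfl⟩ := exists_image_fin hY
  rw [insert_image_fin] at hh ⊢
  have hcons := cons_injective_of_notMem hy hp
  rw [izerginShift_image c hx hcons, izergin_recursion_right c hc x _ hx
    (fun a b hab => hcons (by simpa using hab)), sum_image hx.injOn]
  · refine sum_congr rfl fun i _ => ?_
    have hxi : Function.Injective (x ∘ i.succAbove) := hx.comp Fin.succAbove_right_injective
    have e : (fun j => (Fin.cons p y : Fin (n + 1) → ℂ) j + c) ∘ Fin.succ = fun j => y j + c := by
      ext; simp
    rw [erase_image_fin hx, prod_image hxi.injOn, prod_image hy.injOn,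
      izerginShift_image c hxi hy, e, Fin.cons_zero]
    have e1 : g c (x i) (p + c) = -(h c p (x i))⁻¹ := by
      unfold g h
      rw [inv_div, ← div_neg]
      congr 1; ring
    have e2 : ∀ l, f c (x i) ((Fin.cons p y : Fin (n + 1) → ℂ) l.succ + c) =
        fInv c (y l) (x i) := by
      intro l
      unfold f fInv
      rw [Fin.cons_succ, ← neg_div_neg_eq]
      congr 1 <;> ring
    rw [e1, prod_congr rfl fun l _ => e2 l]
    rfl
  · intro i j hij
    refine hh (x i) (mem_image_of_mem x (mem_univ i)) _ (mem_image_of_mem _ (mem_univ j)) ?_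
    rw [hij]; ring

/-! ### Products over pairs of sets -/

theorem prodOn_insert_right (φ : ℂ → ℂ → ℂ) (X Y : Finset ℂ) {a : ℂ} (ha : a ∉ Y) :
    prodOn φ X (insert a Y) = (∏ x ∈ X, φ x a) * prodOn φ X Y := by
  simp only [prodOn, prod_insert ha, prod_mul_distrib]

theorem prodOn_insert_left (φ : ℂ → ℂ → ℂ) (X Y : Finset ℂ) {a : ℂ} (ha : a ∉ X) :
    prodOn φ (insert a X) Y = (∏ y ∈ Y, φ a y) * prodOn φ X Y := by
  simp only [prodOn, prod_insert ha]

theorem prodOn_erase_right (φ : ℂ → ℂ → ℂ) (X Y : Finset ℂ) {a : ℂ} (ha : a ∈ Y) :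
    (∏ x ∈ X, φ x a) * prodOn φ X (Y.erase a) = prodOn φ X Y := by
  rw [← prodOn_insert_right φ X _ (notMem_erase a Y), insert_erase ha]

/-! ### Sums over a set with a marked element -/

theorem sum_powerset_erase {α M : Type*} [DecidableEq α] [AddCommMonoid M] (s : Finset α)
    (F : α → Finset α → M) :
    ∑ x ∈ s, ∑ C ∈ (s.erase x).powerset, F x C =
      ∑ C ∈ s.powerset, ∑ x ∈ C, F x (C.erase x) := by
  rw [sum_sigma', sum_sigma']
  refine sum_bij' (fun p _ => ⟨insert p.1 p.2, p.1⟩) (fun p _ => ⟨p.2, p.1.erase p.2⟩) ?_ ?_ ?_ ?_ ?_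
  · rintro ⟨x, C⟩ hp
    simp only [mem_sigma, mem_powerset] at hp ⊢
    exact ⟨insert_subset hp.1 (hp.2.trans (erase_subset _ _)), mem_insert_self _ _⟩
  · rintro ⟨C, x⟩ hp
    simp only [mem_sigma, mem_powerset] at hp ⊢
    exact ⟨hp.1 hp.2, erase_subset_erase _ hp.1⟩
  · rintro ⟨x, C⟩ hp
    simp only [mem_sigma, mem_powerset] at hp
    have hx : x ∉ C := fun e => notMem_erase x s (hp.2 e)
    simp [hx]
  · rintro ⟨C, x⟩ hp
    simp only [mem_sigma, mem_powerset] at hp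
    simp [insert_erase hp.2]
  · rintro ⟨x, C⟩ hp
    simp only [mem_sigma, mem_powerset] at hp
    have hx : x ∉ C := fun e => notMem_erase x s (hp.2 e)
    simp [hx]

theorem sum_powersetCard_erase {α M : Type*} [DecidableEq α] [AddCommMonoid M] (s : Finset α)
    (n : ℕ) (F : α → Finset α → M) :
    ∑ x ∈ s, ∑ C ∈ (s.erase x).powersetCard n, F x C =
      ∑ C ∈ s.powersetCard (n + 1), ∑ x ∈ C, F x (C.erase x) := by
  have h1 := sum_powerset_erase s fun x C => if C.card = n then F x C else 0
  have h2 : ∀ x ∈ s, ∑ C ∈ (s.erase x).powerset, (if C.card = n then F x C else 0) =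
      ∑ C ∈ (s.erase x).powersetCard n, F x C := by
    intro x _
    rw [← sum_filter, powersetCard_eq_filter]
  rw [sum_congr rfl h2] at h1
  rw [h1, powersetCard_eq_filter, sum_filter]
  refine sum_congr rfl fun C _ => ?_
  split_ifs with hC
  · exact sum_congr rfl fun x hx => if_pos (by rw [card_erase_of_mem hx, hC]; rfl)
  · refine sum_eq_zero fun x hx => if_neg ?_
    rw [card_erase_of_mem hx]
    have := card_pos.2 ⟨x, hx⟩
    omega

theorem sum_powerset_sdiff {α M : Type*} [DecidableEq α] [AddCommMonoid M] (s : Finset α)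
    (F : α → Finset α → M) :
    ∑ A ∈ s.powerset, ∑ p ∈ s \ A, F p A = ∑ A ∈ s.powerset, ∑ p ∈ A, F p (A.erase p) := by
  rw [← sum_powerset_erase]
  refine sum_comm' fun A p => ?_
  simp only [mem_powerset, mem_sdiff, subset_erase]
  tauto

/-! ### Products of commuting operators -/

section Operators

variable {V : Type*} [AddCommGroup V] [Module ℂ V]

/-- If `A(w) B(k) = f(k,w) B(k) A(w) + g(w,k) B(w) A(k)`, then `A(w)` is carried through a
product of operators `B`. -/
theorem exchange_prod {c : ℂ} {S : Finset ℂ} (A B : ℂ → Module.End ℂ V)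
    (hB : ∀ x y, Commute (B x) (B y))
    (hAB : ∀ w ∈ S, ∀ k ∈ S, w ≠ k →
      A w * B k = f c k w • (B k * A w) + g c w k • (B w * A k))
    (P : Finset ℂ → Module.End ℂ V) (hP0 : P ∅ = 1)
    (hP : ∀ X, ∀ x ∉ X, P (insert x X) = B x * P X)
    (U : Finset ℂ) (hU : U ⊆ S) (w : ℂ) (hw : w ∈ S) (hwU : w ∉ U) :
    A w * P U =
      (∏ u ∈ U, f c u w) • (P U * A w) +
      ∑ p ∈ U, (g c w p * ∏ q ∈ U.erase p, f c q p) •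
        (B w * P (U.erase p) * A p) := by
  induction U using Finset.induction_on generalizing w with
  | empty => simp [hP0]
  | insert k U hk ih =>
    have hkS : k ∈ S := hU (mem_insert_self _ _)
    have hUS : U ⊆ S := (subset_insert _ _).trans hU
    have hwk : w ≠ k := fun e => hwU (e ▸ mem_insert_self _ _)
    have hwU' : w ∉ U := fun e => hwU (mem_insert_of_mem e)
    have h1 := ih hUS w hw hwU'
    have h2 := ih hUS k hkS hk
    rw [hP U k hk, ← mul_assoc, hAB w hw k hkS hwk, add_mul,
      smul_mul_assoc, smul_mul_assoc, mul_assoc, mul_assoc, h1, h2, prod_insert hk,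
      sum_insert hk, erase_insert hk]
    have h3 : ∀ p ∈ U, (g c w p * ∏ q ∈ (insert k U).erase p, f c q p) •
        (B w * P ((insert k U).erase p) * A p) =
        f c k w • (B k * ((g c w p * ∏ q ∈ U.erase p, f c q p) •
          (B w * P (U.erase p) * A p))) +
        g c w k • (B w * ((g c k p * ∏ q ∈ U.erase p, f c q p) •
          (B k * P (U.erase p) * A p))) := by
      intro p hp
      have hkp : k ≠ p := fun e => hk (e ▸ hp)
      have hwp : w ≠ p := fun e => hwU' (e ▸ hp)
      have hke : k ∉ U.erase p := fun e => hk (mem_of_mem_erase e)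
      have hset : (insert k U).erase p = insert k (U.erase p) := erase_insert_of_ne hkp
      have e1 : P ((insert k U).erase p) = B k * P (U.erase p) := by
        rw [hset, hP _ k hke]
      -- The argument of `A` can reach `p` either past `k` directly or by way of `k`; the two
      -- contributions add up by this three-term identity.
      have e2 : g c w p * f c k p = f c k w * g c w p + g c w k * g c k p := by
        have d1 := sub_ne_zero.2 hkp
        have d2 := sub_ne_zero.2 hwp
        have d3 := sub_ne_zero.2 hwk
        have d4 := sub_ne_zero.2 hwk.symm
        unfold g f
        rw [← neg_sub k w] at *
        field_simp
        ring
      rw [e1, hset, prod_insert hke, mul_smul_comm, mul_smul_comm, smul_smul, smul_smul]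
      have e3 : B k * (B w * P (U.erase p) * A p) =
          B w * (B k * P (U.erase p) * A p) := by
        rw [mul_assoc, mul_assoc, ← mul_assoc (B k), (hB k w).eq, mul_assoc]
      rw [e3, ← add_smul, mul_assoc (B w)]
      congr 1
      linear_combination (∏ q ∈ U.erase p, f c q p) * e2
    rw [sum_congr rfl h3, sum_add_distrib, ← smul_sum, ← smul_sum, ← mul_sum, ← mul_sum, mul_add,
      mul_add, smul_add, smul_add, mul_smul_comm, mul_smul_comm, smul_smul, smul_smul,
      mul_assoc (B k), mul_assoc (B w)]
    abel

end Operators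

/-! ### Operators normalised by the weight `λ₂` -/

namespace HighestWeightRep

variable {c : ℂ} {V : Type*} [AddCommGroup V] [Module ℂ V] (M : HighestWeightRep c V)

/-- `T_ij(x) / λ₂(x)`. -/
noncomputable def nT (i j : Fin 3) (x : ℂ) : Module.End ℂ V := (M.weight 1 x)⁻¹ • M.T x i j

theorem nT_commute (i j : Fin 3) (x y : ℂ) : Commute (M.nT i j x) (M.nT i j y) :=
  ((M.commute i j x y).smul_left _).smul_right _

/-- `∏_{x ∈ X} T_ij(x) / λ₂(x)`. -/
noncomputable def nProd (i j : Fin 3) (X : Finset ℂ) : Module.End ℂ V :=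
  X.noncommProd (M.nT i j) fun x _ y _ _ => M.nT_commute i j x y

theorem nT_exchange {x y : ℂ} (hxy : x ≠ y) (hf : x - y + c ≠ 0) (i j k l : Fin 3) :
    M.nT i j x * M.nT k l y + g c x y • (M.nT k j x * M.nT i l y) =
      M.nT k l y * M.nT i j x + g c x y • (M.nT k j y * M.nT i l x) := by
  have h := congrArg (fun t => ((M.weight 1 x)⁻¹ * (M.weight 1 y)⁻¹) • t)
    (M.exchange x y (sub_ne_zero.2 hxy) hf i j k l)
  simp only [nT, smul_mul_assoc, mul_smul_comm, smul_add, smul_smul] at h ⊢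
  convert h using 3 <;> ring

theorem nT_row {x y : ℂ} (hxy : x ≠ y) (hf : y - x + c ≠ 0) (i j l : Fin 3) :
    M.nT i l x * M.nT i j y =
      f c y x • (M.nT i j y * M.nT i l x) + g c x y • (M.nT i j x * M.nT i l y) := by
  have h1 := M.nT_exchange hxy.symm hf i j i l
  have h2 : g c x y = -g c y x := by
    unfold g; rw [← div_neg, neg_sub]
  rw [f_eq c y x hxy.symm, add_smul, one_smul, h1, h2, neg_smul]
  abel

theorem nT_col {x y : ℂ} (hxy : x ≠ y) (hf : x - y + c ≠ 0) (i j k : Fin 3) :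
    M.nT i j x * M.nT k j y =
      f c x y • (M.nT k j y * M.nT i j x) - g c x y • (M.nT k j x * M.nT i j y) := by
  rw [f_eq c x y hxy, add_smul, one_smul, ← M.nT_exchange hxy hf i j k j]
  abel

theorem nProd_insert (i j : Fin 3) {X : Finset ℂ} {x : ℂ} (hx : x ∉ X) :
    M.nProd i j (insert x X) = M.nT i j x * M.nProd i j X :=
  noncommProd_insert_of_notMem _ _ _ _ hx

theorem nProd_empty (i j : Fin 3) : M.nProd i j ∅ = 1 := noncommProd_empty _ _

theorem prodT_empty (i j : Fin 3) : M.prodT i j ∅ = 1 := noncommProd_empty _ _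

theorem prodT_insert (i j : Fin 3) {X : Finset ℂ} {x : ℂ} (hx : x ∉ X) :
    M.prodT i j (insert x X) = M.T x i j * M.prodT i j X :=
  noncommProd_insert_of_notMem _ _ _ _ hx

theorem nProd_eq (i j : Fin 3) (X : Finset ℂ) :
    M.nProd i j X = (M.prodWeight 1 X)⁻¹ • M.prodT i j X := by
  induction X using Finset.induction_on with
  | empty => simp [nProd_empty, prodT_empty, prodWeight]
  | insert x X hx ih =>
    have : M.prodWeight 1 (insert x X) = M.weight 1 x * M.prodWeight 1 X := prod_insert hx
    rw [nProd_insert M i j hx, prodT_insert M i j hx, ih, this, nT, smul_mul_smul_comm, mul_inv]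

/-- The vector `T₁₂(X) T₁₃(Y) T₂₃(Z) |0⟩ / (λ₂(X) λ₂(Y) λ₂(Z))`. -/
noncomputable def word (X Y Z : Finset ℂ) : V :=
  (M.nProd 0 1 X * M.nProd 0 2 Y * M.nProd 1 2 Z) M.vac

/-- Since `kQuot` is zero on sets of different size, the two sums become independent. -/
theorem bethe_eq (u v : Finset ℂ) :
    M.bethe u v = ∑ A ∈ u.powerset, ∑ C ∈ v.powerset,
      (kQuot c C A * prodOn (f c) (v \ C) C * prodOn (f c) (u \ A) A *
        prodOn (fInv c) (v \ C) u) • M.word (u \ A) A (v \ C) := by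
  refine sum_congr rfl fun A hA => ?_
  rw [← sum_subset (filter_subset (fun C : Finset ℂ => C.card = A.card) v.powerset),
    ← powersetCard_eq_filter]
  · refine sum_congr rfl fun C hC => ?_
    rw [kQuot, if_pos (mem_powersetCard.1 hC).2, word, nProd_eq, nProd_eq, nProd_eq]
    simp only [smul_mul_assoc, mul_smul_comm, smul_smul, LinearMap.smul_apply]
    congr 1
    have : M.prodWeight 1 u = M.prodWeight 1 (u \ A) * M.prodWeight 1 A :=
      (prod_sdiff (mem_powerset.1 hA)).symm
    rw [this, div_eq_mul_inv, mul_inv, mul_inv]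
    ring
  · intro C hC hC'
    rw [kQuot, if_neg, zero_mul, zero_mul, zero_mul, zero_smul]
    exact fun e => hC' (mem_filter.2 ⟨hC, e⟩)

theorem nT_word (X Y Z : Finset ℂ) {w : ℂ} (hw : w ∉ X) :
    M.nT 0 1 w (M.word X Y Z) = M.word (insert w X) Y Z := by
  rw [word, word, nProd_insert M 0 1 hw]
  simp [Module.End.mul_apply]

theorem nT_word' {S : Finset ℂ} (hS : ∀ x ∈ S, ∀ y ∈ S, x - y + c ≠ 0)
    (X Y Z : Finset ℂ) {w : ℂ} (hX : X ⊆ S) (hXY : Disjoint X Y) (hwS : w ∈ S) (hwX : w ∉ X)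
    (hwY : w ∉ Y) :
    M.nT 0 2 w (M.word X Y Z) = (∏ x ∈ X, f c x w) • M.word X (insert w Y) Z +
      ∑ p ∈ X, (g c w p * ∏ q ∈ X.erase p, f c q p) •
        M.word (insert w (X.erase p)) (insert p Y) Z := by
  have key := exchange_prod (c := c) (S := S) (M.nT 0 2) (M.nT 0 1) (M.nT_commute 0 1)
    (fun w hw k hk hwk => M.nT_row hwk (hS k hk w hw) 0 1 2)
    (M.nProd 0 1) (M.nProd_empty 0 1) (fun _ _ hx => M.nProd_insert 0 1 hx) X hX w hwS hwX
  have key' := congrArg (fun t : Module.End ℂ V => t ((M.nProd 0 2 Y * M.nProd 1 2 Z) M.vac)) key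
  simp only [LinearMap.add_apply, LinearMap.sum_apply, LinearMap.smul_apply] at key'
  have e1 : M.nT 0 2 w (M.word X Y Z) = (M.nT 0 2 w * M.nProd 0 1 X)
      ((M.nProd 0 2 Y * M.nProd 1 2 Z) M.vac) := rfl
  rw [e1, key', word, nProd_insert M 0 2 hwY]
  congr 1
  refine sum_congr rfl fun p hp => ?_
  have hpY : p ∉ Y := disjoint_left.1 hXY hp
  have hwp : w ∉ X.erase p := fun e => hwX (mem_of_mem_erase e)
  rw [word, nProd_insert M 0 2 hpY, nProd_insert M 0 1 hwp]
  rfl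

/-- Recursion of the Bethe vectors in the first set. -/
theorem bethe_insert (hc : c ≠ 0) {S : Finset ℂ} (hS : ∀ x ∈ S, ∀ y ∈ S, x - y + c ≠ 0)
    (u v : Finset ℂ) (w : ℂ) (hu : u ⊆ S) (hv : v ⊆ S) (hw : w ∈ S) (hwu : w ∉ u) :
    M.bethe (insert w u) v = (∏ x ∈ v, fInv c x w) • M.nT 0 1 w (M.bethe u v) +
      ∑ x ∈ v, ((h c x w)⁻¹ * (∏ z ∈ v.erase x, fInv c z w) * ∏ z ∈ v.erase x, f c z x) •
        M.nT 0 2 w (M.bethe u (v.erase x)) := by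
  -- Subsets of `insert w u` are sorted by whether they contain `w`.
  have hL : M.bethe (insert w u) v = ∑ A ∈ u.powerset, ∑ C ∈ v.powerset,
      ((kQuot c C A * prodOn (f c) (v \ C) C * ((∏ y ∈ A, f c w y) * prodOn (f c) (u \ A) A) *
        prodOn (fInv c) (v \ C) (insert w u)) • M.word (insert w (u \ A)) A (v \ C) +
      (kQuot c C (insert w A) * prodOn (f c) (v \ C) C *
        ((∏ x ∈ u \ A, f c x w) * prodOn (f c) (u \ A) A) *
        prodOn (fInv c) (v \ C) (insert w u)) • M.word (u \ A) (insert w A) (v \ C)) := by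
    rw [bethe_eq, sum_powerset_insert hwu, ← sum_add_distrib]
    refine sum_congr rfl fun A hA => ?_
    rw [← sum_add_distrib]
    refine sum_congr rfl fun C _ => ?_
    have hwA : w ∉ A := fun e => hwu (mem_powerset.1 hA e)
    have e1 : insert w u \ A = insert w (u \ A) := insert_sdiff_of_notMem _ hwA
    have e2 : insert w u \ insert w A = u \ A := by
      rw [insert_sdiff_insert, sdiff_insert_of_notMem hwu]
    rw [e1, e2, prodOn_insert_left _ _ _ (fun e => hwu (mem_sdiff.1 e).1),
      prodOn_insert_right _ _ _ hwA]
  -- The removed point `x` joins the subset `C`; summation over `x ∈ C` is then the expansion of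
  -- `kQuot c C (insert w A)` in `w`.
  have hT2 : ∑ x ∈ v, ((h c x w)⁻¹ * (∏ z ∈ v.erase x, fInv c z w) * ∏ z ∈ v.erase x, f c z x) •
        M.nT 0 2 w (M.bethe u (v.erase x)) = ∑ A ∈ u.powerset, ∑ C ∈ v.powerset,
      (kQuot c C (insert w A) * prodOn (f c) (v \ C) C * prodOn (f c) (u \ A) A *
        prodOn (fInv c) (v \ C) (insert w u)) • M.nT 0 2 w (M.word (u \ A) A (v \ C)) := by
    simp only [bethe_eq, map_sum, map_smul, smul_sum, smul_smul]
    rw [sum_comm]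
    refine sum_congr rfl fun A hA => ?_
    rw [sum_powerset_erase v fun x C => (((h c x w)⁻¹ * (∏ z ∈ v.erase x, fInv c z w) *
      ∏ z ∈ v.erase x, f c z x) * (kQuot c C A * prodOn (f c) (v.erase x \ C) C *
        prodOn (f c) (u \ A) A * prodOn (fInv c) (v.erase x \ C) u)) •
        M.nT 0 2 w (M.word (u \ A) A (v.erase x \ C))]
    refine sum_congr rfl fun C hC => ?_
    have hCv := mem_powerset.1 hC
    have hwA : w ∉ A := fun e => hwu (mem_powerset.1 hA e)
    have hAS := (mem_powerset.1 hA).trans hu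
    rw [kQuot_insert c hc C A w hwA fun x hx y hy =>
      hS x (hv (hCv hx)) y (insert_subset hw hAS hy)]
    simp only [sum_mul, sum_smul]
    refine sum_congr rfl fun x hx => ?_
    have e1 : v.erase x \ C.erase x = v \ C := by
      ext a
      simp only [mem_sdiff, mem_erase]
      constructor
      · rintro ⟨⟨h1, h2⟩, h3⟩; exact ⟨h2, fun e => h3 ⟨h1, e⟩⟩
      · rintro ⟨h1, h2⟩; exact ⟨⟨fun e => h2 (e ▸ hx), h1⟩, fun e => h2 e.2⟩
    have e2 : v.erase x = (v \ C) ∪ C.erase x := by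
      ext a
      simp only [mem_union, mem_sdiff, mem_erase]
      constructor
      · rintro ⟨h1, h2⟩
        by_cases h3 : a ∈ C
        · exact Or.inr ⟨h1, h3⟩
        · exact Or.inl ⟨h2, h3⟩
      · rintro (⟨h1, h2⟩ | ⟨h1, h2⟩)
        · exact ⟨fun e => h2 (e ▸ hx), h1⟩
        · exact ⟨h1, hCv h2⟩
    have e3 : Disjoint (v \ C) (C.erase x) :=
      disjoint_of_subset_right (erase_subset _ _) sdiff_disjoint
    rw [e1, e2, prod_union e3, prod_union e3, prodOn_insert_right _ _ _ hwu,
      ← prodOn_erase_right (f c) (v \ C) C hx]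
    congr 1
    ring
  -- Carrying `T₁₃(w)` through the `T₁₂` gives the words with argument `w` in `T₁₃`, which match one
  -- half of `hL`, and exchange terms in which `w` sits in `T₁₂`.
  have hT2' : ∑ A ∈ u.powerset, ∑ C ∈ v.powerset,
      (kQuot c C (insert w A) * prodOn (f c) (v \ C) C * prodOn (f c) (u \ A) A *
        prodOn (fInv c) (v \ C) (insert w u)) • M.nT 0 2 w (M.word (u \ A) A (v \ C)) =
      ∑ A ∈ u.powerset, ∑ C ∈ v.powerset,
      ((kQuot c C (insert w A) * prodOn (f c) (v \ C) C *
        ((∏ x ∈ u \ A, f c x w) * prodOn (f c) (u \ A) A) *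
        prodOn (fInv c) (v \ C) (insert w u)) • M.word (u \ A) (insert w A) (v \ C) +
      ((∑ p ∈ A, g c w p * (∏ z ∈ A.erase p, f c p z) * kQuot c C (insert w (A.erase p))) *
        prodOn (f c) (v \ C) C * prodOn (f c) (u \ A) A *
        prodOn (fInv c) (v \ C) (insert w u)) • M.word (insert w (u \ A)) A (v \ C)) := by
    have step : ∀ A ∈ u.powerset, ∑ C ∈ v.powerset,
        (kQuot c C (insert w A) * prodOn (f c) (v \ C) C * prodOn (f c) (u \ A) A *
        prodOn (fInv c) (v \ C) (insert w u)) • M.nT 0 2 w (M.word (u \ A) A (v \ C)) =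
        (∑ C ∈ v.powerset, (kQuot c C (insert w A) * prodOn (f c) (v \ C) C *
        ((∏ x ∈ u \ A, f c x w) * prodOn (f c) (u \ A) A) *
        prodOn (fInv c) (v \ C) (insert w u)) • M.word (u \ A) (insert w A) (v \ C)) +
        ∑ p ∈ u \ A, ∑ C ∈ v.powerset, (kQuot c C (insert w A) * prodOn (f c) (v \ C) C *
          prodOn (f c) (u \ A) A * prodOn (fInv c) (v \ C) (insert w u) *
          (g c w p * ∏ q ∈ (u \ A).erase p, f c q p)) •
            M.word (insert w ((u \ A).erase p)) (insert p A) (v \ C) := by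
      intro A hA
      have hAu := mem_powerset.1 hA
      rw [sum_comm, ← sum_add_distrib]
      refine sum_congr rfl fun C _ => ?_
      rw [M.nT_word' hS _ _ _ (sdiff_subset.trans hu) sdiff_disjoint hw
        (fun e => hwu (mem_sdiff.1 e).1) (fun e => hwu (hAu e)), smul_add, smul_smul, smul_sum]
      simp only [smul_smul]
      congr 2
      ring
    rw [sum_congr rfl step, sum_add_distrib, sum_powerset_sdiff u fun p A =>
      ∑ C ∈ v.powerset, (kQuot c C (insert w A) * prodOn (f c) (v \ C) C *
          prodOn (f c) (u \ A) A * prodOn (fInv c) (v \ C) (insert w u) *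
          (g c w p * ∏ q ∈ (u \ A).erase p, f c q p)) •
            M.word (insert w ((u \ A).erase p)) (insert p A) (v \ C), ← sum_add_distrib]
    refine sum_congr rfl fun A hA => ?_
    rw [sum_comm, ← sum_add_distrib]
    refine sum_congr rfl fun C _ => ?_
    congr 1
    simp only [sum_mul, sum_smul]
    refine sum_congr rfl fun p hp => ?_
    have hAu := mem_powerset.1 hA
    have hpu : p ∉ u \ A := fun e => (mem_sdiff.1 e).2 hp
    have e1 : u \ A.erase p = insert p (u \ A) := sdiff_erase (hAu hp)
    rw [e1, erase_insert hpu, insert_erase hp, prodOn_insert_left _ _ _ hpu,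
      ← prodOn_erase_right (f c) (u \ A) A hp]
    congr 1
    ring
  rw [hL, hT2, hT2', bethe_eq, map_sum, smul_sum, ← sum_add_distrib]
  refine sum_congr rfl fun A hA => ?_
  rw [map_sum, smul_sum, ← sum_add_distrib]
  refine sum_congr rfl fun C hC => ?_
  have hAu := mem_powerset.1 hA
  have hCv := mem_powerset.1 hC
  have hwA : w ∉ A := fun e => hwu (hAu e)
  -- The exchange terms carry `f(w, A) - 1/f(C, w)`; the term with `T₁₂(w)` contributes the missing
  -- `1/f(C, w)`.
  rw [map_smul, smul_smul, M.nT_word _ _ _ fun e => hwu (mem_sdiff.1 e).1,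
    ← kQuot_exchange c hc C A w hwA fun x hx y hy =>
      hS x (hv (hCv hx)) y (insert_subset hw (hAu.trans hu) hy), add_comm (_ • M.word (u \ A) _ _),
      ← add_assoc, ← add_smul]
  congr 2
  rw [prodOn_insert_right _ _ _ hwu, ← prod_sdiff hCv]
  ring

end HighestWeightRep

/-! ### Rational identities -/

theorem h_inv (c x y : ℂ) : (h c x y)⁻¹ = c / (x - y + c) := by
  unfold h; rw [inv_div]

theorem add_exchange_one {c z w x : ℂ} (hzw : z ≠ w) (hzx : z - x + c ≠ 0)
    (hwx : w - x + c ≠ 0) :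
    f c w z * (fInv c w x * (h c z x)⁻¹) + g c z w * (fInv c z x * (h c w x)⁻¹) =
      (h c z x)⁻¹ := by
  have h1 : z - w ≠ 0 := sub_ne_zero.2 hzw
  have h2 : w - z ≠ 0 := sub_ne_zero.2 hzw.symm
  rw [h_inv, h_inv, ← g_neg c w z]
  unfold f g fInv
  field_simp
  ring

/-- The coefficient identity for removing two points from the second set, symmetrised in `x` and
`x'` because the order of removal is immaterial. -/
theorem add_exchange_two {c z w x x' y : ℂ} (hzw : z ≠ w) (hzx : z - x + c ≠ 0)
    (hwx : w - x + c ≠ 0) (hzx' : z - x' + c ≠ 0) (hwx' : w - x' + c ≠ 0)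
    (hxy : x - y + c ≠ 0) (hxy' : x' - y + c ≠ 0) (hxx : x - x' + c ≠ 0)
    (hxx' : x' - x + c ≠ 0) :
    (f c w z * (fInv c w x * fInv c x x' * fInv c x' y * ((h c z x)⁻¹ * (h c x y)⁻¹) *
        (h c w x')⁻¹) +
      g c z w * (fInv c z x * fInv c x x' * fInv c x' y * ((h c w x)⁻¹ * (h c x y)⁻¹) *
        (h c z x')⁻¹)) +
    (f c w z * (fInv c w x' * fInv c x' x * fInv c x y * ((h c z x')⁻¹ * (h c x' y)⁻¹) *
        (h c w x)⁻¹) +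
      g c z w * (fInv c z x' * fInv c x' x * fInv c x y * ((h c w x')⁻¹ * (h c x' y)⁻¹) *
        (h c z x)⁻¹)) =
    fInv c z x' * fInv c x' x * ((h c w x')⁻¹ * ((h c z x)⁻¹ * (h c x y)⁻¹)) +
    fInv c z x * fInv c x x' * ((h c w x)⁻¹ * ((h c z x')⁻¹ * (h c x' y)⁻¹)) := by
  have h1 : z - w ≠ 0 := sub_ne_zero.2 hzw
  simp only [h_inv]
  rw [show g c z w = -(c / (w - z)) by unfold g; rw [← div_neg, neg_sub]]
  have h2 : w - z ≠ 0 := sub_ne_zero.2 hzw.symm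
  unfold f fInv
  field_simp
  ring

theorem exchange_one_dual {c z w x y : ℂ} (hzw : z ≠ w) (hzx : z - x + c ≠ 0)
    (hwx : w - x + c ≠ 0) (hyz : y - z + c ≠ 0) (hyw : y - w + c ≠ 0) :
    fInv c w x * fInv c y w * ((h c z x)⁻¹ * (h c y z)⁻¹) +
      (g c z w * (fInv c y w * ((h c y z)⁻¹ * (h c w x)⁻¹)) -
        g c z w * (fInv c y z * ((h c y w)⁻¹ * (h c z x)⁻¹))) = (h c z x)⁻¹ * (h c y z)⁻¹ := by
  have h1 : z - w ≠ 0 := sub_ne_zero.2 hzw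
  simp only [h_inv]
  unfold g fInv
  field_simp
  ring

theorem exchange_two_dual {c z w x x' y : ℂ} (hzw : z ≠ w) (hzx : z - x + c ≠ 0)
    (hwx : w - x + c ≠ 0) (hzx' : z - x' + c ≠ 0) (hwx' : w - x' + c ≠ 0)
    (hyz : y - z + c ≠ 0) (hyw : y - w + c ≠ 0) (hxx : x - x' + c ≠ 0)
    (hxx' : x' - x + c ≠ 0) :
    (f c z w * (fInv c w x * fInv c y w * fInv c x x' * ((h c z x)⁻¹ * (h c y z)⁻¹) *
        (h c w x')⁻¹) -
      g c z w * (fInv c z x * fInv c y z * fInv c x x' * ((h c w x)⁻¹ * (h c y w)⁻¹) *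
        (h c z x')⁻¹)) +
    (f c z w * (fInv c w x' * fInv c y w * fInv c x' x * ((h c z x')⁻¹ * (h c y z)⁻¹) *
        (h c w x)⁻¹) -
      g c z w * (fInv c z x' * fInv c y z * fInv c x' x * ((h c w x')⁻¹ * (h c y w)⁻¹) *
        (h c z x)⁻¹)) =
    fInv c z x' * fInv c x' x * ((h c w x')⁻¹ * ((h c z x)⁻¹ * (h c y z)⁻¹)) +
    fInv c z x * fInv c x x' * ((h c w x)⁻¹ * ((h c z x')⁻¹ * (h c y z)⁻¹)) := by
  have h1 : z - w ≠ 0 := sub_ne_zero.2 hzw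
  simp only [h_inv]
  unfold f g fInv
  field_simp
  ring

theorem exchange_one_single {c z w y : ℂ} (hzw : z ≠ w) (hyz : y - z + c ≠ 0)
    (hyw : y - w + c ≠ 0) :
    f c z w * (fInv c y w * (h c y z)⁻¹) - g c z w * (fInv c y z * (h c y w)⁻¹) =
      (h c y z)⁻¹ := by
  have h1 : z - w ≠ 0 := sub_ne_zero.2 hzw
  simp only [h_inv]
  unfold f g fInv
  field_simp
  ring

theorem exchange_two_single {c z w x y : ℂ} (hzw : z ≠ w) (hzx : z - x + c ≠ 0)
    (hwx : w - x + c ≠ 0) (hyz : y - z + c ≠ 0) (hyw : y - w + c ≠ 0) :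
    fInv c y w * ((h c w x)⁻¹ * (h c y z)⁻¹) +
      (g c z w * (fInv c w x * fInv c y w * ((h c z x)⁻¹ * (h c y z)⁻¹)) -
        g c z w * (fInv c z x * fInv c y z * ((h c w x)⁻¹ * (h c y w)⁻¹))) =
      fInv c z x * ((h c w x)⁻¹ * (h c y z)⁻¹) := by
  have h1 : z - w ≠ 0 := sub_ne_zero.2 hzw
  simp only [h_inv]
  unfold g fInv
  field_simp
  ring

/-! ### Weights of a set with a marked element -/

/-- `f(X ∖ x, x)`. -/
noncomputable def om (c : ℂ) (X : Finset ℂ) (x : ℂ) : ℂ := ∏ y ∈ X.erase x, f c y x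

theorem fInv_self (c x : ℂ) : fInv c x x = 0 := by simp [fInv]

theorem om_erase {c : ℂ} {X : Finset ℂ} {p x : ℂ} (hp : p ∈ X) (hx : x ∈ X.erase p)
    (hpx : p - x + c ≠ 0) : om c (X.erase p) x = om c X x * fInv c p x := by
  have hne : p ≠ x := (ne_of_mem_erase hx).symm
  rw [om, om, erase_right_comm, ← mul_prod_erase (X.erase x) _ (mem_erase.2 ⟨hne, hp⟩)]
  linear_combination -(∏ y ∈ (X.erase x).erase p, f c y x) * fInv_mul_f hne hpx

section Sums

variable {V : Type*} [AddCommGroup V] [Module ℂ V]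

/-- The correction factor `1/f(w, x)` vanishes at `x = w`, so the sum over `X.erase w` is already a
sum over `X`. -/
theorem sum_erase_om {c : ℂ} {X : Finset ℂ} {w : ℂ} (hw : w ∈ X)
    (hX : ∀ x ∈ X, w - x + c ≠ 0) (F : ℂ → V) :
    ∑ x ∈ X.erase w, om c (X.erase w) x • F x = ∑ x ∈ X, (om c X x * fInv c w x) • F x := by
  rw [← sum_erase X (a := w) (by rw [fInv_self, mul_zero, zero_smul])]
  exact sum_congr rfl fun x hx => by rw [om_erase hw hx (hX x (mem_of_mem_erase hx))]

/-- The vectors depend on the unordered pair only, hence only symmetrised coefficients matter. -/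
theorem sum_smul_eq_of_symm {α : Type*} (X : Finset α) (a d : α → α → ℂ) (F : α → α → V)
    (hF : ∀ x x', F x x' = F x' x)
    (had : ∀ x ∈ X, ∀ x' ∈ X, a x x' + a x' x = d x x' + d x' x) :
    ∑ x ∈ X, ∑ x' ∈ X, a x x' • F x x' = ∑ x ∈ X, ∑ x' ∈ X, d x x' • F x x' := by
  have key : ∀ b : α → α → ℂ, (2 : ℂ) • ∑ x ∈ X, ∑ x' ∈ X, b x x' • F x x' =
      ∑ x ∈ X, ∑ x' ∈ X, (b x x' + b x' x) • F x x' := by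
    intro b
    rw [two_smul]
    nth_rewrite 2 [sum_comm]
    rw [← sum_add_distrib]
    refine sum_congr rfl fun x _ => ?_
    rw [← sum_add_distrib]
    refine sum_congr rfl fun x' _ => ?_
    rw [hF x' x, add_smul]
  refine smul_right_injective V (two_ne_zero (α := ℂ)) ?_
  simp only [key]
  exact sum_congr rfl fun x hx => sum_congr rfl fun x' hx' => by rw [had x hx x' hx']

end Sums

theorem prod_fInv_eq_zero {c w : ℂ} {Y : Finset ℂ} (hw : w ∈ Y) : ∏ p ∈ Y, fInv c p w = 0 :=
  prod_eq_zero hw (fInv_self c w)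

/-! ### One-point action of `T₁₁` type from exchange relations. -/

section Abstract

variable {V : Type*} [AddCommGroup V] [Module ℂ V]

/-- At `y = w` every term vanishes: either `x = w` and `1/f(w, x) = 0`, or `w` is among the `p` in
the product. -/
theorem sum_erase_om_om {c : ℂ} {S U X : Finset ℂ} (hS : ∀ x ∈ S, ∀ y ∈ S, x - y + c ≠ 0)
    (hU : U ⊆ S) (hX : X ⊆ S) {w : ℂ} (hwU : w ∈ U) (hwX : w ∈ X) (r : ℂ → ℂ) (a : ℂ → ℂ → ℂ)
    (F : ℂ → ℂ → V) :
    ∑ y ∈ U.erase w, ∑ x ∈ X.erase w, (r y * om c (U.erase w) y * om c (X.erase w) x *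
        (∏ p ∈ (X.erase w).erase x, fInv c p y) * a y x) • F y x =
      ∑ y ∈ U, ∑ x ∈ X, (r y * om c U y * om c X x * (∏ p ∈ X.erase x, fInv c p y) *
        (fInv c w x * a y x)) • F y x := by
  rw [← sum_erase U (a := w)]
  · refine sum_congr rfl fun y hy => ?_
    rw [← sum_erase X (a := w) (by rw [fInv_self]; simp)]
    refine sum_congr rfl fun x hx => ?_
    have hwx : w ∈ X.erase x := mem_erase.2 ⟨(ne_of_mem_erase hx).symm, hwX⟩
    rw [om_erase hwU hy (hS _ (hU hwU) _ (hU (mem_of_mem_erase hy))),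
      om_erase hwX hx (hS _ (hX hwX) _ (hX (mem_of_mem_erase hx))), erase_right_comm,
      ← mul_prod_erase (X.erase x) _ hwx]
    congr 1
    ring
  · refine sum_eq_zero fun x _ => ?_
    by_cases hxw : x = w
    · rw [hxw, fInv_self]; simp
    · rw [prod_fInv_eq_zero (mem_erase.2 ⟨fun e => hxw e.symm, hwX⟩)]; simp

/-- One-point action of an operator `A` with the exchange relations of `T₁₁` with `P = T₁₂` and
`Q = T₁₃`. -/
theorem action_diagonal {c : ℂ} (hc : c ≠ 0) {S : Finset ℂ}
    (hS : ∀ x ∈ S, ∀ y ∈ S, x - y + c ≠ 0)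
    (A P Q : ℂ → Module.End ℂ V) (r : ℂ → ℂ) (B : Finset ℂ → Finset ℂ → V)
    (hAP : ∀ z ∈ S, ∀ w ∈ S, z ≠ w → A z * P w = f c w z • (P w * A z) + g c z w • (P z * A w))
    (hAQ : ∀ z ∈ S, ∀ w ∈ S, z ≠ w → A z * Q w = f c w z • (Q w * A z) + g c z w • (Q z * A w))
    (hQ : ∀ U ⊆ S, ∀ X ⊆ S, ∀ z ∈ U, z ∈ X → Q z (B (U.erase z) (X.erase z)) = B U X)
    (hP : ∀ U ⊆ S, ∀ X ⊆ S, ∀ z ∈ U, z ∈ X → P z (B (U.erase z) (X.erase z)) =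
      ∑ x ∈ X, (om c X x * (h c z x)⁻¹) • B U (X.erase x))
    (hbase : ∀ X ⊆ S, ∀ z ∈ X, A z (B ∅ (X.erase z)) = r z • B ∅ (X.erase z))
    (U X : Finset ℂ) (hU : U ⊆ S) (hX : X ⊆ S) (z : ℂ) (hzU : z ∈ U) (hzX : z ∈ X) :
    A z (B (U.erase z) (X.erase z)) = ∑ y ∈ U, ∑ x ∈ X,
      (r y * om c U y * om c X x * (∏ p ∈ X.erase x, fInv c p y) *
        ((h c z x)⁻¹ * (h c x y)⁻¹)) • B (U.erase y) (X.erase x) := by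
  induction hn : U.card using Nat.strong_induction_on generalizing U X z with
  | _ n ih =>
  rcases (U.erase z).eq_empty_or_nonempty with hUe | ⟨w, hwUz⟩
  -- For `U = {z}` only `x = z` contributes: otherwise the product over `X.erase x` contains `1/f(z,
  -- z) = 0`.
  · have hUz : U = {z} := by rw [← insert_erase hzU, hUe]; rfl
    rw [hUe, hbase X hX z hzX, hUz, sum_singleton, sum_eq_single z]
    · have h1 : (h c z z)⁻¹ = 1 := by simp [h, hc]
      have h2 : om c {z} z = 1 := by simp [om]
      have h3 : om c X z * ∏ p ∈ X.erase z, fInv c p z = 1 := by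
        rw [om, ← prod_mul_distrib]
        refine prod_eq_one fun p hp => ?_
        rw [mul_comm]
        exact fInv_mul_f (ne_of_mem_erase hp) (hS _ (hX (mem_of_mem_erase hp)) _ (hX hzX))
      rw [h1, h2, erase_singleton, mul_assoc (r z * 1), h3]
      simp
    · intro x _ hxz
      rw [prod_fInv_eq_zero (mem_erase.2 ⟨fun e => hxz e.symm, hzX⟩)]
      simp
    · exact fun e => (e hzX).elim
  have hwU : w ∈ U := mem_of_mem_erase hwUz
  have hwz : w ≠ z := ne_of_mem_erase hwUz
  have hzw : z ≠ w := hwz.symm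
  have hUzS : U.erase z ⊆ S := (erase_subset _ _).trans hU
  have hcard : ∀ p ∈ U, (U.erase p).card < n := fun p hp => hn ▸ card_erase_lt_of_mem hp
  have hzS := hU hzU
  have hwS := hU hwU
  -- the case in which a further point belongs to both sets
  have stepA : ∀ Y ⊆ S, z ∈ Y → w ∈ Y → A z (B (U.erase z) (Y.erase z)) = ∑ y ∈ U, ∑ x ∈ Y,
      (r y * om c U y * om c Y x * (∏ p ∈ Y.erase x, fInv c p y) *
        ((h c z x)⁻¹ * (h c x y)⁻¹)) • B (U.erase y) (Y.erase x) := by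
    intro Y hY hzY hwY
    -- Stated for both orders of `z` and `w`, since the exchange relation produces `Q w * A z` and
    -- `Q z * A w`.
    have half : ∀ z w, z ∈ U → w ∈ U → z ≠ w → z ∈ Y → w ∈ Y →
        Q w (A z (B ((U.erase w).erase z) ((Y.erase w).erase z))) = ∑ y ∈ U, ∑ x ∈ Y,
          (r y * om c U y * om c Y x * (∏ p ∈ Y.erase x, fInv c p y) *
          (fInv c w x * ((h c z x)⁻¹ * (h c x y)⁻¹))) • B (U.erase y) (Y.erase x) := by
      intro z w hzU hwU hzw hzY hwY
      rw [ih _ (hcard w hwU) (U.erase w) (Y.erase w) ((erase_subset _ _).trans hU)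
        ((erase_subset _ _).trans hY) z (mem_erase.2 ⟨hzw, hzU⟩) (mem_erase.2 ⟨hzw, hzY⟩) rfl]
      simp only [map_sum, map_smul]
      rw [sum_erase_om_om hS hU hY hwU hwY r (fun y x => (h c z x)⁻¹ * (h c x y)⁻¹)
        fun y x => Q w (B ((U.erase w).erase y) ((Y.erase w).erase x))]
      refine sum_congr rfl fun y hy => ?_
      by_cases hyw : y = w
      · subst hyw
        rw [sum_eq_zero, sum_eq_zero]
        all_goals
          intro x _
          by_cases hxy : x = y
          · rw [hxy, fInv_self]; simp
          · rw [prod_fInv_eq_zero (mem_erase.2 ⟨fun e => hxy e.symm, hwY⟩)]; simp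
      refine sum_congr rfl fun x hx => ?_
      by_cases hxw : x = w
      · rw [hxw, fInv_self]; simp
      rw [erase_right_comm (a := w), erase_right_comm (s := Y) (a := w),
        hQ _ ((erase_subset _ _).trans hU) _ ((erase_subset _ _).trans hY) w
        (mem_erase.2 ⟨fun e => hyw e.symm, hwU⟩) (mem_erase.2 ⟨fun e => hxw e.symm, hwY⟩)]
    have hwYz : w ∈ Y.erase z := mem_erase.2 ⟨hwz, hwY⟩
    rw [← hQ (U.erase z) hUzS (Y.erase z) ((erase_subset _ _).trans hY) w hwUz hwYz,
      ← Module.End.mul_apply, hAQ z hzS w hwS hzw, LinearMap.add_apply, LinearMap.smul_apply,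
      LinearMap.smul_apply, Module.End.mul_apply, Module.End.mul_apply,
      half w z hwU hzU hwz hwY hzY, erase_right_comm (a := z), erase_right_comm (s := Y) (a := z),
      half z w hzU hwU hzw hzY hwY]
    simp only [smul_sum, smul_smul]
    rw [← sum_add_distrib]
    refine sum_congr rfl fun y _ => ?_
    rw [← sum_add_distrib]
    refine sum_congr rfl fun x hx => ?_
    rw [← add_smul]
    congr 1
    have hxS := hY hx
    linear_combination (r y * om c U y * om c Y x * (∏ p ∈ Y.erase x, fInv c p y) *
      (h c x y)⁻¹) * add_exchange_one hzw (hS z hzS x hxS) (hS w hwS x hxS)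
  by_cases hwX : w ∈ X
  · exact stepA X hX hzX hwX
  -- the case in which it belongs to the first set only
  set Y := insert w X with hYdef
  have hY : Y ⊆ S := insert_subset hwS hX
  have hwY : w ∈ Y := mem_insert_self _ _
  have hzY : z ∈ Y := mem_insert_of_mem hzX
  have hYw : Y.erase w = X := erase_insert hwX
  have hwYz : w ∈ Y.erase z := mem_erase.2 ⟨hwz, hwY⟩
  -- `T x'` is the value to be proved for `A z` on `B (U.erase z) ((Y.erase z).erase x')`; the one
  -- needed is `T w`.
  set T : ℂ → V := fun x' => ∑ y ∈ U, ∑ x ∈ Y.erase x', (r y * om c U y *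
    om c (Y.erase x') x * (∏ p ∈ (Y.erase x').erase x, fInv c p y) *
      ((h c z x)⁻¹ * (h c x y)⁻¹)) • B (U.erase y) ((Y.erase x').erase x) with hT
  have hPw := congrArg (A z) (hP (U.erase z) hUzS (Y.erase z) ((erase_subset _ _).trans hY) w
    hwUz hwYz)
  have half : ∀ z w, z ∈ U → w ∈ U → z ≠ w → z ∈ Y → w ∈ Y →
      P w (A z (B ((U.erase w).erase z) ((Y.erase w).erase z))) = ∑ y ∈ U, ∑ x ∈ Y, ∑ x' ∈ Y,
        (r y * om c U y * om c Y x * om c Y x' *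
          (∏ p ∈ (Y.erase x).erase x', fInv c p y) * (fInv c w x * fInv c x x' * fInv c x' y *
            ((h c z x)⁻¹ * (h c x y)⁻¹) * (h c w x')⁻¹)) •
          B (U.erase y) ((Y.erase x).erase x') := by
    intro z w hzU hwU hzw hzY hwY
    rw [ih _ (hcard w hwU) (U.erase w) (Y.erase w) ((erase_subset _ _).trans hU)
      ((erase_subset _ _).trans hY) z (mem_erase.2 ⟨hzw, hzU⟩) (mem_erase.2 ⟨hzw, hzY⟩) rfl]
    simp only [map_sum, map_smul]
    rw [sum_erase_om_om hS hU hY hwU hwY r (fun y x => (h c z x)⁻¹ * (h c x y)⁻¹)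
      fun y x => P w (B ((U.erase w).erase y) ((Y.erase w).erase x))]
    refine sum_congr rfl fun y hy => ?_
    by_cases hyw : y = w
    · subst hyw
      rw [sum_eq_zero, sum_eq_zero]
      · intro x _
        refine sum_eq_zero fun x' _ => ?_
        by_cases hxy : x = y
        · rw [hxy, fInv_self]; simp
        by_cases hxy' : x' = y
        · rw [hxy', fInv_self]; simp
        rw [prod_fInv_eq_zero (mem_erase.2 ⟨fun e => hxy' e.symm, mem_erase.2
          ⟨fun e => hxy e.symm, hwY⟩⟩)]; simp
      · intro x _
        by_cases hxy : x = y
        · rw [hxy, fInv_self]; simp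
        · rw [prod_fInv_eq_zero (mem_erase.2 ⟨fun e => hxy e.symm, hwY⟩)]; simp
    refine sum_congr rfl fun x hx => ?_
    by_cases hxw : x = w
    · rw [sum_eq_zero]
      · rw [hxw, fInv_self]; simp
      · intro x' _
        rw [hxw, fInv_self]; simp
    rw [erase_right_comm (a := w), erase_right_comm (s := Y) (a := w),
      hP _ ((erase_subset _ _).trans hU) _ ((erase_subset _ _).trans hY) w
      (mem_erase.2 ⟨fun e => hyw e.symm, hwU⟩) (mem_erase.2 ⟨fun e => hxw e.symm, hwY⟩)]
    simp only [mul_smul _ (h c w _)⁻¹]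
    rw [sum_erase_om hx (fun a ha => hS x (hY hx) a (hY ha)), smul_sum]
    refine sum_congr rfl fun x' hx' => ?_
    rw [smul_smul, smul_smul]
    by_cases hxx : x' = x
    · rw [hxx, fInv_self]; simp
    rw [← mul_prod_erase (Y.erase x) _ (mem_erase.2 ⟨hxx, hx'⟩)]
    congr 1
    ring
  -- The exchange relation evaluates `A z` on the whole sum over `x'`, with the result that the
  -- claimed values would give.
  have hsum : A z (P w (B ((U.erase z).erase w) ((Y.erase z).erase w))) =
      ∑ x' ∈ Y.erase z, (om c (Y.erase z) x' * (h c w x')⁻¹) • T x' := by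
    rw [← Module.End.mul_apply, hAP z hzS w hwS hzw, LinearMap.add_apply, LinearMap.smul_apply,
      LinearMap.smul_apply, Module.End.mul_apply, Module.End.mul_apply,
      half w z hwU hzU hwz hwY hzY, erase_right_comm (a := z), erase_right_comm (s := Y) (a := z),
      half z w hzU hwU hzw hzY hwY]
    simp only [mul_smul _ (h c w _)⁻¹]
    rw [sum_erase_om hzY (fun a ha => hS z (hY hzY) a (hY ha))]
    simp only [hT, smul_sum, smul_smul]
    have hr : ∀ x' ∈ Y, ∑ y ∈ U, ∑ x ∈ Y.erase x', (om c Y x' * fInv c z x' * ((h c w x')⁻¹ *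
        (r y * om c U y * om c (Y.erase x') x * (∏ p ∈ (Y.erase x').erase x, fInv c p y) *
        ((h c z x)⁻¹ * (h c x y)⁻¹)))) • B (U.erase y) ((Y.erase x').erase x) =
        ∑ y ∈ U, ∑ x ∈ Y, (r y * om c U y * om c Y x * om c Y x' *
          (∏ p ∈ (Y.erase x).erase x', fInv c p y) * (fInv c z x' * fInv c x' x *
            ((h c w x')⁻¹ * ((h c z x)⁻¹ * (h c x y)⁻¹)))) •
          B (U.erase y) ((Y.erase x).erase x') := by
      intro x' hx'
      refine sum_congr rfl fun y _ => ?_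
      rw [← sum_erase Y (a := x') (by rw [fInv_self]; simp)]
      refine sum_congr rfl fun x hx => ?_
      rw [om_erase hx' hx (hS _ (hY hx') _ (hY (mem_of_mem_erase hx))), erase_right_comm]
      congr 1
      ring
    rw [sum_congr rfl hr, sum_comm (s := Y) (t := U), ← sum_add_distrib]
    refine sum_congr rfl fun y hy => ?_
    conv_rhs => rw [sum_comm]
    rw [← sum_add_distrib]
    simp only [← sum_add_distrib, ← add_smul]
    refine sum_smul_eq_of_symm Y _ _ (fun x x' => B (U.erase y) ((Y.erase x).erase x'))
      (fun x x' => by rw [erase_right_comm]) fun x hx x' hx' => ?_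
    have hxS := hY hx
    have hxS' := hY hx'
    have hyS := hU hy
    rw [erase_right_comm (s := Y) (a := x')]
    linear_combination (r y * om c U y * om c Y x * om c Y x' *
      (∏ p ∈ (Y.erase x).erase x', fInv c p y)) *
        add_exchange_two hzw (hS z hzS x hxS) (hS w hwS x hxS) (hS z hzS x' hxS')
          (hS w hwS x' hxS') (hS x hxS y hyS) (hS x' hxS' y hyS) (hS x hxS x' hxS')
          (hS x' hxS' x hxS)
  rw [hsum] at hPw
  simp only [map_sum, map_smul] at hPw
  rw [← add_sum_erase _ _ hwYz, ← add_sum_erase _ _ hwYz] at hPw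
  -- For `x' ≠ w` the point `w` is still in both sets, so these values are known and can be
  -- cancelled.
  have hrest : ∀ x' ∈ (Y.erase z).erase w, (om c (Y.erase z) x' * (h c w x')⁻¹) • T x' =
      (om c (Y.erase z) x' * (h c w x')⁻¹) • A z (B (U.erase z) ((Y.erase z).erase x')) := by
    intro x' hx'
    have hx'w : x' ≠ w := ne_of_mem_erase hx'
    have hx'z : x' ≠ z := ne_of_mem_erase (mem_of_mem_erase hx')
    rw [erase_right_comm (s := Y) (a := z), stepA (Y.erase x') ((erase_subset _ _).trans hY)
      (mem_erase.2 ⟨hx'z.symm, hzY⟩) (mem_erase.2 ⟨hx'w.symm, hwY⟩)]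
  rw [sum_congr rfl hrest] at hPw
  have hne : om c (Y.erase z) w * (h c w w)⁻¹ ≠ 0 := by
    have h1 : (h c w w)⁻¹ = 1 := by simp [h, hc]
    rw [h1, mul_one]
    refine prod_ne_zero_iff.2 fun p hp => f_ne_zero (ne_of_mem_erase hp) (hS _ (hY ?_) _ hwS)
    exact mem_of_mem_erase (mem_of_mem_erase hp)
  have := smul_right_injective V hne (add_right_cancel hPw)
  rw [erase_right_comm, hYw] at this
  rw [← this, hT]
  simp only [hYw]

end Abstract

/-! ### Coupled one-point actions of `T₂₂` and `T₂₃` type. -/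

section Abstract

variable {V : Type*} [AddCommGroup V] [Module ℂ V]

theorem map_eq_of_sum_eq {α : Type*} [DecidableEq α] (O : Module.End ℂ V) (X : Finset α) {w : α}
    (hw : w ∈ X) (φ : α → ℂ) (b T : α → V) (hφ : φ w ≠ 0)
    (hsum : O (∑ x ∈ X, φ x • b x) = ∑ x ∈ X, φ x • T x)
    (hrest : ∀ x ∈ X.erase w, O (b x) = T x) : O (b w) = T w := by
  simp only [map_sum, map_smul] at hsum
  rw [← add_sum_erase _ _ hw, ← add_sum_erase _ _ hw,
    sum_congr rfl fun x hx => by rw [hrest x hx]] at hsum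
  exact smul_right_injective V hφ (add_right_cancel hsum)

theorem sum_erase_om_neg {c : ℂ} {X : Finset ℂ} {w : ℂ} (hw : w ∈ X)
    (hX : ∀ x ∈ X, x - w + c ≠ 0) (F : ℂ → V) :
    ∑ x ∈ X.erase w, om (-c) (X.erase w) x • F x =
      ∑ x ∈ X, (om (-c) X x * fInv c x w) • F x := by
  rw [sum_erase_om hw]
  · simp only [fInv_neg]
  · intro x hx e
    exact hX x hx (by linear_combination -e)

theorem om_mul_h_inv_ne_zero {c : ℂ} (hc : c ≠ 0) {S X : Finset ℂ}
    (hS : ∀ x ∈ S, ∀ y ∈ S, x - y + c ≠ 0) (hX : X ⊆ S) {w : ℂ} (hw : w ∈ X) :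
    om c X w * (h c w w)⁻¹ ≠ 0 := by
  have h1 : (h c w w)⁻¹ = 1 := by simp [h, hc]
  rw [h1, mul_one]
  exact prod_ne_zero_iff.2 fun p hp =>
    f_ne_zero (ne_of_mem_erase hp) (hS _ (hX (mem_of_mem_erase hp)) _ (hX hw))

/-- One-point actions of operators `A` and `C` with the exchange relations of `T₂₂` and `T₂₃`
with `P = T₁₂` and `Q = T₁₃`. -/
theorem action_middle {c : ℂ} (hc : c ≠ 0) {S : Finset ℂ}
    (hS : ∀ x ∈ S, ∀ y ∈ S, x - y + c ≠ 0)
    (A C P Q : ℂ → Module.End ℂ V) (B : Finset ℂ → Finset ℂ → V)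
    (hAP : ∀ z ∈ S, ∀ w ∈ S, z ≠ w → A z * P w = f c z w • (P w * A z) - g c z w • (P z * A w))
    (hAQ : ∀ z ∈ S, ∀ w ∈ S, z ≠ w →
      A z * Q w = Q w * A z + (g c z w • (P w * C z) - g c z w • (P z * C w)))
    (hCP : ∀ z ∈ S, ∀ w ∈ S, z ≠ w →
      C z * P w = P w * C z + (g c z w • (Q w * A z) - g c z w • (Q z * A w)))
    (hCQ : ∀ z ∈ S, ∀ w ∈ S, z ≠ w → C z * Q w = f c z w • (Q w * C z) - g c z w • (Q z * C w))
    (hQ : ∀ U ⊆ S, ∀ X ⊆ S, ∀ z ∈ U, z ∈ X → Q z (B (U.erase z) (X.erase z)) = B U X)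
    (hP : ∀ U ⊆ S, ∀ X ⊆ S, ∀ z ∈ U, z ∈ X → P z (B (U.erase z) (X.erase z)) =
      ∑ x ∈ X, (om c X x * (h c z x)⁻¹) • B U (X.erase x))
    (hbaseA : ∀ X ⊆ S, ∀ z ∈ X, A z (B ∅ (X.erase z)) =
      ∑ x ∈ X, (om c X x * (h c z x)⁻¹) • B ∅ (X.erase x))
    (hbaseC : ∀ X ⊆ S, ∀ z ∈ X, C z (B ∅ (X.erase z)) = B ∅ X)
    (U X : Finset ℂ) (hU : U ⊆ S) (hX : X ⊆ S) (z : ℂ) (hzU : z ∈ U) (hzX : z ∈ X) :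
    A z (B (U.erase z) (X.erase z)) = ∑ y ∈ U, ∑ x ∈ X,
      (om (-c) U y * om c X x * ((h c z x)⁻¹ * (h c y z)⁻¹)) • B (U.erase y) (X.erase x) ∧
    C z (B (U.erase z) (X.erase z)) = ∑ y ∈ U, (om (-c) U y * (h c y z)⁻¹) • B (U.erase y) X := by
  induction hn : U.card using Nat.strong_induction_on generalizing U X z with
  | _ n ih =>
  rcases (U.erase z).eq_empty_or_nonempty with hUe | ⟨w, hwUz⟩
  · have hUz : U = {z} := by rw [← insert_erase hzU, hUe]; rfl
    have h1 : (h c z z)⁻¹ = 1 := by simp [h, hc]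
    have h2 : om (-c) {z} z = 1 := by simp [om]
    rw [hUe, hbaseA X hX z hzX, hbaseC X hX z hzX, hUz, sum_singleton, sum_singleton, h1, h2,
      erase_singleton]
    simp
  have hwU : w ∈ U := mem_of_mem_erase hwUz
  have hwz : w ≠ z := ne_of_mem_erase hwUz
  have hzw : z ≠ w := hwz.symm
  have hUzS : U.erase z ⊆ S := (erase_subset _ _).trans hU
  have hcard : ∀ p ∈ U, (U.erase p).card < n := fun p hp => hn ▸ card_erase_lt_of_mem hp
  have hzS := hU hzU
  have hwS := hU hwU
  -- The actions on the smaller vectors, with the sums already extended over the point `w`. The next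
  -- six statements list what the four exchange relations need.
  have hC : ∀ Y ⊆ S, ∀ z w, z ∈ U → w ∈ U → z ≠ w → z ∈ Y → w ∈ Y →
      C z (B ((U.erase w).erase z) ((Y.erase w).erase z)) = ∑ y ∈ U,
        (om (-c) U y * fInv c y w) • (h c y z)⁻¹ • B ((U.erase w).erase y) (Y.erase w) := by
    intro Y hY z w hzU hwU hzw hzY hwY
    rw [(ih _ (hcard w hwU) (U.erase w) (Y.erase w) ((erase_subset _ _).trans hU)
      ((erase_subset _ _).trans hY) z (mem_erase.2 ⟨hzw, hzU⟩) (mem_erase.2 ⟨hzw, hzY⟩) rfl).2]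
    simp only [mul_smul _ (h c _ z)⁻¹]
    rw [sum_erase_om_neg hwU fun y hy => hS _ (hU hy) _ (hU hwU)]
  have hA : ∀ Y ⊆ S, ∀ z w, z ∈ U → w ∈ U → z ≠ w → z ∈ Y → w ∈ Y →
      A z (B ((U.erase w).erase z) ((Y.erase w).erase z)) = ∑ y ∈ U, (om (-c) U y * fInv c y w) •
        ∑ x ∈ Y, (om c Y x * fInv c w x) • ((h c z x)⁻¹ * (h c y z)⁻¹) •
          B ((U.erase w).erase y) ((Y.erase w).erase x) := by
    intro Y hY z w hzU hwU hzw hzY hwY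
    rw [(ih _ (hcard w hwU) (U.erase w) (Y.erase w) ((erase_subset _ _).trans hU)
      ((erase_subset _ _).trans hY) z (mem_erase.2 ⟨hzw, hzU⟩) (mem_erase.2 ⟨hzw, hzY⟩) rfl).1]
    simp only [mul_smul, ← smul_sum]
    simp only [sum_erase_om hwY fun x hx => hS _ (hY hwY) _ (hY hx)]
    rw [sum_erase_om_neg hwU fun y hy => hS _ (hU hy) _ (hU hwU)]
    simp only [mul_smul]
  have hQC : ∀ Y ⊆ S, ∀ z w, z ∈ U → w ∈ U → z ≠ w → z ∈ Y → w ∈ Y →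
      Q w (C z (B ((U.erase w).erase z) ((Y.erase w).erase z))) = ∑ y ∈ U,
        (om (-c) U y * (fInv c y w * (h c y z)⁻¹)) • B (U.erase y) Y := by
    intro Y hY z w hzU hwU hzw hzY hwY
    rw [hC Y hY z w hzU hwU hzw hzY hwY]
    simp only [map_sum, map_smul, smul_smul]
    refine sum_congr rfl fun y hy => ?_
    by_cases hyw : y = w
    · rw [hyw, fInv_self]; simp
    rw [erase_right_comm, hQ _ ((erase_subset _ _).trans hU) _ hY w
      (mem_erase.2 ⟨fun e => hyw e.symm, hwU⟩) hwY, mul_assoc]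
  have hQA : ∀ Y ⊆ S, ∀ z w, z ∈ U → w ∈ U → z ≠ w → z ∈ Y → w ∈ Y →
      Q w (A z (B ((U.erase w).erase z) ((Y.erase w).erase z))) = ∑ y ∈ U, ∑ x ∈ Y,
        (om (-c) U y * om c Y x * (fInv c w x * fInv c y w * ((h c z x)⁻¹ * (h c y z)⁻¹))) •
          B (U.erase y) (Y.erase x) := by
    intro Y hY z w hzU hwU hzw hzY hwY
    rw [hA Y hY z w hzU hwU hzw hzY hwY]
    simp only [map_sum, map_smul, smul_sum, smul_smul]
    refine sum_congr rfl fun y hy => sum_congr rfl fun x hx => ?_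
    by_cases hyw : y = w
    · rw [hyw, fInv_self]; simp
    by_cases hxw : x = w
    · rw [hxw, fInv_self]; simp
    rw [erase_right_comm, erase_right_comm (s := Y), hQ _ ((erase_subset _ _).trans hU) _
      ((erase_subset _ _).trans hY) w (mem_erase.2 ⟨fun e => hyw e.symm, hwU⟩)
      (mem_erase.2 ⟨fun e => hxw e.symm, hwY⟩)]
    congr 1
    ring
  have hPC : ∀ Y ⊆ S, ∀ z w, z ∈ U → w ∈ U → z ≠ w → z ∈ Y → w ∈ Y →
      P w (C z (B ((U.erase w).erase z) ((Y.erase w).erase z))) = ∑ y ∈ U, ∑ x ∈ Y,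
        (om (-c) U y * om c Y x * (fInv c y w * ((h c y z)⁻¹ * (h c w x)⁻¹))) •
          B (U.erase y) (Y.erase x) := by
    intro Y hY z w hzU hwU hzw hzY hwY
    rw [hC Y hY z w hzU hwU hzw hzY hwY]
    simp only [map_sum, map_smul, smul_smul]
    refine sum_congr rfl fun y hy => ?_
    by_cases hyw : y = w
    · rw [hyw, fInv_self]; simp
    rw [erase_right_comm, hP _ ((erase_subset _ _).trans hU) _ hY w
      (mem_erase.2 ⟨fun e => hyw e.symm, hwU⟩) hwY, smul_sum]
    refine sum_congr rfl fun x _ => ?_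
    rw [smul_smul]
    congr 1
    ring
  have hPA : ∀ Y ⊆ S, ∀ z w, z ∈ U → w ∈ U → z ≠ w → z ∈ Y → w ∈ Y →
      P w (A z (B ((U.erase w).erase z) ((Y.erase w).erase z))) = ∑ y ∈ U, ∑ x ∈ Y, ∑ x' ∈ Y,
        (om (-c) U y * om c Y x * om c Y x' * (fInv c w x * fInv c y w * fInv c x x' *
          ((h c z x)⁻¹ * (h c y z)⁻¹) * (h c w x')⁻¹)) •
          B (U.erase y) ((Y.erase x).erase x') := by
    intro Y hY z w hzU hwU hzw hzY hwY
    rw [hA Y hY z w hzU hwU hzw hzY hwY]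
    simp only [map_sum, map_smul, smul_sum, smul_smul]
    refine sum_congr rfl fun y hy => sum_congr rfl fun x hx => ?_
    by_cases hyw : y = w
    · rw [hyw, fInv_self]; simp
    by_cases hxw : x = w
    · rw [hxw, fInv_self]; simp
    rw [erase_right_comm, erase_right_comm (s := Y), hP _ ((erase_subset _ _).trans hU) _
      ((erase_subset _ _).trans hY) w (mem_erase.2 ⟨fun e => hyw e.symm, hwU⟩)
      (mem_erase.2 ⟨fun e => hxw e.symm, hwY⟩)]
    simp only [mul_smul _ (h c w _)⁻¹]
    rw [sum_erase_om hx (fun a ha => hS x (hY hx) a (hY ha)), smul_sum]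
    refine sum_congr rfl fun x' hx' => ?_
    rw [smul_smul, smul_smul]
    congr 1
    ring
  -- the case in which a further point belongs to both sets
  have stepA : ∀ Y ⊆ S, z ∈ Y → w ∈ Y → A z (B (U.erase z) (Y.erase z)) = ∑ y ∈ U, ∑ x ∈ Y,
      (om (-c) U y * om c Y x * ((h c z x)⁻¹ * (h c y z)⁻¹)) • B (U.erase y) (Y.erase x) := by
    intro Y hY hzY hwY
    rw [← hQ (U.erase z) hUzS (Y.erase z) ((erase_subset _ _).trans hY) w hwUz
      (mem_erase.2 ⟨hwz, hwY⟩), ← Module.End.mul_apply, hAQ z hzS w hwS hzw]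
    simp only [LinearMap.add_apply, LinearMap.sub_apply, LinearMap.smul_apply,
      Module.End.mul_apply]
    rw [hPC Y hY w z hwU hzU hwz hwY hzY, erase_right_comm (a := z),
      erase_right_comm (s := Y) (a := z), hPC Y hY z w hzU hwU hzw hzY hwY,
      hQA Y hY z w hzU hwU hzw hzY hwY]
    simp only [smul_sum, smul_smul, ← sum_add_distrib, ← sum_sub_distrib, ← add_smul, ← sub_smul]
    refine sum_congr rfl fun y hy => sum_congr rfl fun x hx => ?_
    congr 1
    linear_combination (om (-c) U y * om c Y x) * exchange_one_dual hzw (hS z hzS x (hY hx))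
      (hS w hwS x (hY hx)) (hS y (hU hy) z hzS) (hS y (hU hy) w hwS)
  have stepC : ∀ Y ⊆ S, z ∈ Y → w ∈ Y → C z (B (U.erase z) (Y.erase z)) = ∑ y ∈ U,
      (om (-c) U y * (h c y z)⁻¹) • B (U.erase y) Y := by
    intro Y hY hzY hwY
    rw [← hQ (U.erase z) hUzS (Y.erase z) ((erase_subset _ _).trans hY) w hwUz
      (mem_erase.2 ⟨hwz, hwY⟩), ← Module.End.mul_apply, hCQ z hzS w hwS hzw]
    simp only [LinearMap.sub_apply, LinearMap.smul_apply, Module.End.mul_apply]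
    rw [hQC Y hY w z hwU hzU hwz hwY hzY, erase_right_comm (a := z),
      erase_right_comm (s := Y) (a := z), hQC Y hY z w hzU hwU hzw hzY hwY]
    simp only [smul_sum, smul_smul, ← sum_sub_distrib, ← sub_smul]
    refine sum_congr rfl fun y hy => ?_
    congr 1
    linear_combination om (-c) U y * exchange_one_single hzw (hS y (hU hy) z hzS)
      (hS y (hU hy) w hwS)
  by_cases hwX : w ∈ X
  · exact ⟨stepA X hX hzX hwX, stepC X hX hzX hwX⟩
  -- the case in which it belongs to the first set only
  set Y := insert w X with hYdef
  have hY : Y ⊆ S := insert_subset hwS hX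
  have hwY : w ∈ Y := mem_insert_self _ _
  have hzY : z ∈ Y := mem_insert_of_mem hzX
  have hYw : Y.erase w = X := erase_insert hwX
  have hwYz : w ∈ Y.erase z := mem_erase.2 ⟨hwz, hwY⟩
  have hYzS : Y.erase z ⊆ S := (erase_subset _ _).trans hY
  -- The vector sought is the term `x' = w` of this sum. Its coefficient is nonzero, and in all
  -- other terms `w` belongs to both sets, where `stepA` and `stepC` apply.
  have hPw := hP (U.erase z) hUzS (Y.erase z) hYzS w hwUz hwYz
  have hφ := om_mul_h_inv_ne_zero hc hS hYzS hwYz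
  have hmem : ∀ x' ∈ (Y.erase z).erase w, z ∈ Y.erase x' ∧ w ∈ Y.erase x' := fun x' hx' =>
    ⟨mem_erase.2 ⟨(ne_of_mem_erase (mem_of_mem_erase hx')).symm, hzY⟩,
      mem_erase.2 ⟨(ne_of_mem_erase hx').symm, hwY⟩⟩
  constructor
  · have := map_eq_of_sum_eq (A z) (Y.erase z) hwYz (fun x' => om c (Y.erase z) x' * (h c w x')⁻¹)
      (fun x' => B (U.erase z) ((Y.erase z).erase x'))
      (fun x' => ∑ y ∈ U, ∑ x ∈ Y.erase x', (om (-c) U y * om c (Y.erase x') x *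
        ((h c z x)⁻¹ * (h c y z)⁻¹)) • B (U.erase y) ((Y.erase x').erase x)) hφ ?_ ?_
    · rwa [erase_right_comm, hYw] at this
    · rw [← hPw, ← Module.End.mul_apply, hAP z hzS w hwS hzw]
      simp only [LinearMap.sub_apply, LinearMap.smul_apply, Module.End.mul_apply]
      rw [hPA Y hY w z hwU hzU hwz hwY hzY, erase_right_comm (a := z),
        erase_right_comm (s := Y) (a := z), hPA Y hY z w hzU hwU hzw hzY hwY]
      simp only [mul_smul _ (h c w _)⁻¹]
      rw [sum_erase_om hzY (fun a ha => hS z (hY hzY) a (hY ha))]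
      simp only [smul_sum, smul_smul]
      have hr : ∀ x' ∈ Y, ∑ y ∈ U, ∑ x ∈ Y.erase x', (om c Y x' * fInv c z x' * ((h c w x')⁻¹ *
          (om (-c) U y * om c (Y.erase x') x * ((h c z x)⁻¹ * (h c y z)⁻¹)))) •
            B (U.erase y) ((Y.erase x').erase x) =
          ∑ y ∈ U, ∑ x ∈ Y, (om (-c) U y * om c Y x * om c Y x' * (fInv c z x' * fInv c x' x *
            ((h c w x')⁻¹ * ((h c z x)⁻¹ * (h c y z)⁻¹)))) •
          B (U.erase y) ((Y.erase x).erase x') := by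
        intro x' hx'
        refine sum_congr rfl fun y _ => ?_
        rw [← sum_erase Y (a := x') (by rw [fInv_self]; simp)]
        refine sum_congr rfl fun x hx => ?_
        rw [om_erase hx' hx (hS _ (hY hx') _ (hY (mem_of_mem_erase hx))), erase_right_comm]
        congr 1
        ring
      rw [sum_congr rfl hr, sum_comm (s := Y) (t := U), ← sum_sub_distrib]
      refine sum_congr rfl fun y hy => ?_
      conv_rhs => rw [sum_comm]
      simp only [← sum_sub_distrib, ← sub_smul]
      refine sum_smul_eq_of_symm Y _ _ (fun x x' => B (U.erase y) ((Y.erase x).erase x'))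
        (fun x x' => by rw [erase_right_comm]) fun x hx x' hx' => ?_
      have hxS := hY hx
      have hxS' := hY hx'
      have hyS := hU hy
      linear_combination (om (-c) U y * om c Y x * om c Y x') *
        exchange_two_dual hzw (hS z hzS x hxS) (hS w hwS x hxS) (hS z hzS x' hxS')
          (hS w hwS x' hxS') (hS y hyS z hzS) (hS y hyS w hwS) (hS x hxS x' hxS')
          (hS x' hxS' x hxS)
    · intro x' hx'
      rw [erase_right_comm (s := Y) (a := z), stepA (Y.erase x') ((erase_subset _ _).trans hY)
        (hmem x' hx').1 (hmem x' hx').2]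
  · have := map_eq_of_sum_eq (C z) (Y.erase z) hwYz (fun x' => om c (Y.erase z) x' * (h c w x')⁻¹)
      (fun x' => B (U.erase z) ((Y.erase z).erase x'))
      (fun x' => ∑ y ∈ U, (om (-c) U y * (h c y z)⁻¹) • B (U.erase y) (Y.erase x')) hφ ?_ ?_
    · rwa [erase_right_comm, hYw] at this
    · rw [← hPw, ← Module.End.mul_apply, hCP z hzS w hwS hzw]
      simp only [LinearMap.sub_apply, LinearMap.add_apply, LinearMap.smul_apply,
        Module.End.mul_apply]
      rw [hQA Y hY w z hwU hzU hwz hwY hzY, erase_right_comm (a := z),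
        erase_right_comm (s := Y) (a := z), hQA Y hY z w hzU hwU hzw hzY hwY,
        hPC Y hY z w hzU hwU hzw hzY hwY]
      simp only [mul_smul _ (h c w _)⁻¹]
      rw [sum_erase_om hzY (fun a ha => hS z (hY hzY) a (hY ha))]
      simp only [smul_sum, smul_smul]
      rw [sum_comm (s := Y) (t := U)]
      simp only [← sum_add_distrib, ← sum_sub_distrib, ← add_smul, ← sub_smul]
      refine sum_congr rfl fun y hy => sum_congr rfl fun x hx => ?_
      congr 1
      linear_combination (om (-c) U y * om c Y x) * exchange_two_single hzw
        (hS z hzS x (hY hx)) (hS w hwS x (hY hx)) (hS y (hU hy) z hzS) (hS y (hU hy) w hwS)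
    · intro x' hx'
      rw [erase_right_comm (s := Y) (a := z), stepC (Y.erase x') ((erase_subset _ _).trans hY)
        (hmem x' hx').1 (hmem x' hx').2]

end Abstract

namespace HighestWeightRep

variable {c : ℂ} {V : Type*} [AddCommGroup V] [Module ℂ V] (M : HighestWeightRep c V)

/-! ### Action of `T₁₃` and `T₁₂` on Bethe vectors -/

/-- The recursion in the first set, with `z` also in the second: `1/f(z, z) = 0` kills the `T₁₂`
term and all of the sum but `x = z`, whose coefficient is one. -/
theorem nT_bethe_13 (hc : c ≠ 0) {S : Finset ℂ} (hS : ∀ x ∈ S, ∀ y ∈ S, x - y + c ≠ 0)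
    (U : Finset ℂ) (hU : U ⊆ S) (X : Finset ℂ) (hX : X ⊆ S) (z : ℂ) (hzU : z ∈ U) (hzX : z ∈ X) :
    M.nT 0 2 z (M.bethe (U.erase z) (X.erase z)) = M.bethe U X := by
  have key := M.bethe_insert hc hS (U.erase z) X z ((erase_subset _ _).trans hU) hX (hU hzU)
    (notMem_erase z U)
  rw [insert_erase hzU, prod_fInv_eq_zero hzX, zero_smul, zero_add, sum_eq_single z] at key
  · have h1 : (h c z z)⁻¹ = 1 := by simp [h, hc]
    rw [key, h1, one_mul, ← prod_mul_distrib, prod_eq_one, one_smul]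
    exact fun p hp => fInv_mul_f (ne_of_mem_erase hp) (hS _ (hX (mem_of_mem_erase hp)) _ (hX hzX))
  · intro x _ hxz
    rw [prod_fInv_eq_zero (mem_erase.2 ⟨hxz.symm, hzX⟩)]; simp
  · exact fun e => (e hzX).elim

theorem f_mul_h_inv {x y : ℂ} (hc : c ≠ 0) (hxy : x ≠ y) (hh : x - y + c ≠ 0) :
    f c x y * (h c x y)⁻¹ = g c x y := by
  rw [h_inv_eq c hc hxy hh, ← mul_assoc, mul_comm (f c x y), fInv_mul_f hxy hh, one_mul]

theorem om_mul_h_inv {X : Finset ℂ} {z x : ℂ} (hc : c ≠ 0) (hz : z ∈ X) (hzx : z ≠ x)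
    (hh : z - x + c ≠ 0) :
    om c X x * (h c z x)⁻¹ = g c z x * ∏ p ∈ (X.erase z).erase x, f c p x := by
  rw [om, ← mul_prod_erase (X.erase x) _ (mem_erase.2 ⟨hzx, hz⟩), erase_right_comm,
    ← f_mul_h_inv hc hzx hh]
  ring

/-- Here the recursion is applied with `z` absent from the second set and solved for its `T₁₂` term;
the `T₁₃` terms are Bethe vectors by `nT_bethe_13`. -/
theorem nT_bethe_12 (hc : c ≠ 0) {S : Finset ℂ} (hS : ∀ x ∈ S, ∀ y ∈ S, x - y + c ≠ 0)
    (U : Finset ℂ) (hU : U ⊆ S) (X : Finset ℂ) (hX : X ⊆ S) (z : ℂ) (hzU : z ∈ U) (hzX : z ∈ X) :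
    M.nT 0 1 z (M.bethe (U.erase z) (X.erase z)) =
      ∑ x ∈ X, (om c X x * (h c z x)⁻¹) • M.bethe U (X.erase x) := by
  have hUz : U.erase z ⊆ S := (erase_subset _ _).trans hU
  have hXz : X.erase z ⊆ S := (erase_subset _ _).trans hX
  have key := M.bethe_insert hc hS (U.erase z) (X.erase z) z hUz hXz (hU hzU) (notMem_erase z U)
  have h1 : (h c z z)⁻¹ = 1 := by simp [h, hc]
  have h2 : (∏ p ∈ X.erase z, f c p z) * ∏ p ∈ X.erase z, fInv c p z = 1 := by
    rw [← prod_mul_distrib]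
    refine prod_eq_one fun p hp => ?_
    rw [mul_comm]
    exact fInv_mul_f (ne_of_mem_erase hp) (hS _ (hXz hp) _ (hX hzX))
  rw [insert_erase hzU] at key
  rw [← add_sum_erase X _ hzX, h1, mul_one, om, key, smul_add, smul_smul, h2, one_smul, add_assoc,
    left_eq_add, smul_sum, ← sum_add_distrib]
  refine sum_eq_zero fun x hx => ?_
  have hxX := mem_of_mem_erase hx
  have hxz := ne_of_mem_erase hx
  have hh := hS _ (hX hxX) _ (hX hzX)
  rw [erase_right_comm, M.nT_bethe_13 hc hS U hU (X.erase x) ((erase_subset _ _).trans hX) z hzU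
    (mem_erase.2 ⟨hxz.symm, hzX⟩), smul_smul, ← add_smul,
    om_mul_h_inv hc hzX hxz.symm (hS _ (hX hzX) _ (hX hxX)), ← mul_prod_erase (X.erase z) _ hx,
    erase_right_comm (a := x)]
  have h3 : (∏ p ∈ (X.erase z).erase x, f c p z) * ∏ p ∈ (X.erase z).erase x, fInv c p z = 1 := by
    rw [← prod_mul_distrib]
    refine prod_eq_one fun p hp => ?_
    rw [mul_comm]
    have hp' := mem_of_mem_erase hp
    exact fInv_mul_f (ne_of_mem_erase hp') (hS _ (hXz hp') _ (hX hzX))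
  have h4 : f c x z * (h c x z)⁻¹ = -g c z x := by
    rw [f_mul_h_inv hc hxz hh]
    unfold g; rw [← div_neg, neg_sub]
  rw [show f c x z * (∏ p ∈ (X.erase z).erase x, f c p z) * ((h c x z)⁻¹ *
    (∏ p ∈ (X.erase z).erase x, fInv c p z) * ∏ p ∈ (X.erase z).erase x, f c p x) +
    g c z x * ∏ p ∈ (X.erase z).erase x, f c p x = 0 by
      linear_combination (f c x z * (h c x z)⁻¹ * ∏ p ∈ (X.erase z).erase x, f c p x) * h3 +
        (∏ p ∈ (X.erase z).erase x, f c p x) * h4, zero_smul]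

/-! ### Bethe vectors with one empty set -/

theorem bethe_empty_left (v : Finset ℂ) : M.bethe ∅ v = M.word ∅ ∅ v := by
  rw [bethe_eq, powerset_empty, sum_singleton, sum_eq_single ∅]
  · rw [kQuot_empty]; simp [prodOn]
  · intro C _ hC
    rw [kQuot, if_neg]
    · simp
    · simpa using hC
  · simp

theorem bethe_empty_right (u : Finset ℂ) : M.bethe u ∅ = M.word u ∅ ∅ := by
  rw [bethe_eq, sum_eq_single ∅]
  · rw [powerset_empty, sum_singleton, kQuot_empty]; simp [prodOn]
  · intro A _ hA
    rw [powerset_empty, sum_singleton, kQuot, if_neg]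
    · simp
    · simpa [eq_comm] using hA
  · simp

theorem word_right (X : Finset ℂ) : M.word ∅ ∅ X = M.nProd 1 2 X M.vac := by
  simp [word, nProd_empty]

theorem word_left (X : Finset ℂ) : M.word X ∅ ∅ = M.nProd 0 1 X M.vac := by
  simp [word, nProd_empty]

theorem nT_lower_vac (x : ℂ) {i j : Fin 3} (hij : j < i) : M.nT i j x M.vac = 0 := by
  rw [nT, LinearMap.smul_apply, M.lower x i j hij, smul_zero]

theorem nT_diag_vac (x : ℂ) (i : Fin 3) :
    M.nT i i x M.vac = (M.weight i x / M.weight 1 x) • M.vac := by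
  rw [nT, LinearMap.smul_apply, M.diag, smul_smul, div_eq_inv_mul]

theorem nT_23_right {X : Finset ℂ} {z : ℂ} (hz : z ∈ X) :
    M.nT 1 2 z (M.bethe ∅ (X.erase z)) = M.bethe ∅ X := by
  rw [bethe_empty_left, bethe_empty_left, word_right, word_right, ← Module.End.mul_apply,
    ← M.nProd_insert 1 2 (notMem_erase z X), insert_erase hz]

theorem nT_22_right (hc : c ≠ 0) {S : Finset ℂ} (hS : ∀ x ∈ S, ∀ y ∈ S, x - y + c ≠ 0)
    (hw : ∀ x ∈ S, M.weight 1 x ≠ 0) (X : Finset ℂ) (hX : X ⊆ S) (z : ℂ) (hz : z ∈ X) :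
    M.nT 1 1 z (M.bethe ∅ (X.erase z)) =
      ∑ x ∈ X, (om c X x * (h c z x)⁻¹) • M.bethe ∅ (X.erase x) := by
  have key := exchange_prod (c := c) (S := S) (M.nT 1 1) (M.nT 1 2) (M.nT_commute 1 2)
    (fun w hw k hk hwk => M.nT_row hwk (hS k hk w hw) 1 2 1) (M.nProd 1 2) (M.nProd_empty 1 2)
    (fun _ _ hx => M.nProd_insert 1 2 hx) (X.erase z) ((erase_subset _ _).trans hX) z (hX hz)
    (notMem_erase z X)
  have key' := congrArg (fun t : Module.End ℂ V => t M.vac) key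
  have hvac : ∀ x ∈ S, M.nT 1 1 x M.vac = M.vac := fun x hx => by
    rw [nT_diag_vac, div_self (hw x hx), one_smul]
  simp only [LinearMap.add_apply, LinearMap.sum_apply, LinearMap.smul_apply,
    Module.End.mul_apply] at key'
  have h1 : (h c z z)⁻¹ = 1 := by simp [h, hc]
  rw [bethe_empty_left, word_right, key', hvac z (hX hz), ← add_sum_erase X _ hz, h1, mul_one,
    bethe_empty_left, word_right, om]
  congr 1
  refine sum_congr rfl fun x hx => ?_
  have hxz := ne_of_mem_erase hx
  have hxX := mem_of_mem_erase hx
  have hzx : z ∉ (X.erase z).erase x := fun e => notMem_erase z X (mem_of_mem_erase e)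
  rw [hvac x (hX hxX), om_mul_h_inv hc hz hxz.symm (hS _ (hX hz) _ (hX hxX)), bethe_empty_left,
    word_right, ← Module.End.mul_apply, ← M.nProd_insert 1 2 hzx, erase_right_comm,
    insert_erase (mem_erase.2 ⟨hxz.symm, hz⟩)]

/-- Exchanging `T₁₁` with `T₂₃` produces correction terms ending in `T₂₁`, which annihilates every
product of `T₂₃` on the vacuum because it lies in the same row and can be carried through. -/
theorem nT_11_right {S : Finset ℂ} (hS : ∀ x ∈ S, ∀ y ∈ S, x - y + c ≠ 0)
    (Y : Finset ℂ) (hY : Y ⊆ S) (z : ℂ) (hz : z ∈ S) (hzY : z ∉ Y) :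
    M.nT 0 0 z (M.bethe ∅ Y) = (M.weight 0 z / M.weight 1 z) • M.bethe ∅ Y := by
  have lower : ∀ Y ⊆ S, ∀ z ∈ S, z ∉ Y → M.nT 1 0 z (M.nProd 1 2 Y M.vac) = 0 := by
    intro Y hY z hz hzY
    have key := exchange_prod (c := c) (S := S) (M.nT 1 0) (M.nT 1 2) (M.nT_commute 1 2)
      (fun w hw k hk hwk => M.nT_row hwk (hS k hk w hw) 1 2 0) (M.nProd 1 2) (M.nProd_empty 1 2)
      (fun _ _ hx => M.nProd_insert 1 2 hx) Y hY z hz hzY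
    have key' := congrArg (fun t : Module.End ℂ V => t M.vac) key
    have hvac : ∀ x, M.nT 1 0 x M.vac = 0 := fun x => M.nT_lower_vac x (by decide)
    simpa only [LinearMap.add_apply, LinearMap.sum_apply, LinearMap.smul_apply,
      Module.End.mul_apply, hvac, map_zero, smul_zero, sum_const_zero, add_zero] using key'
  rw [bethe_empty_left, word_right]
  induction Y using Finset.induction_on with
  | empty => rw [nProd_empty, Module.End.one_apply, nT_diag_vac]
  | insert x Y hx ih =>
    have hYS : Y ⊆ S := (subset_insert _ _).trans hY
    have hxS : x ∈ S := hY (mem_insert_self _ _)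
    have hxz : x ≠ z := fun e => hzY (e ▸ mem_insert_self _ _)
    have hzY' : z ∉ Y := fun e => hzY (mem_insert_of_mem e)
    have key := congrArg (fun t : Module.End ℂ V => t (M.nProd 1 2 Y M.vac))
      (M.nT_exchange hxz (hS x hxS z hz) 1 2 0 0)
    simp only [LinearMap.add_apply, LinearMap.smul_apply, Module.End.mul_apply,
      lower Y hYS z hz hzY', lower Y hYS x hxS hx, map_zero, smul_zero, add_zero] at key
    rw [nProd_insert M 1 2 hx, Module.End.mul_apply, ← key, ih hYS hzY', map_smul]

/-- The corrections now end in `T₃₂`, which lies in the same column as `T₁₂`. The column relation is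
the row relation with `-c` for `c`, so `exchange_prod` serves again. -/
theorem nT_33_left {S : Finset ℂ} (hS : ∀ x ∈ S, ∀ y ∈ S, x - y + c ≠ 0)
    (Y : Finset ℂ) (hY : Y ⊆ S) (z : ℂ) (hz : z ∈ S) (hzY : z ∉ Y) :
    M.nT 2 2 z (M.bethe Y ∅) = (M.weight 2 z / M.weight 1 z) • M.bethe Y ∅ := by
  have lower : ∀ Y ⊆ S, ∀ z ∈ S, z ∉ Y → M.nT 2 1 z (M.nProd 0 1 Y M.vac) = 0 := by
    intro Y hY z hz hzY
    have key := exchange_prod (c := -c) (S := S) (M.nT 2 1) (M.nT 0 1) (M.nT_commute 0 1)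
      (fun w hw k hk hwk => by
        rw [M.nT_col hwk (hS w hw k hk) 2 1 0, f_neg, g_neg, sub_eq_add_neg, ← neg_smul]
        congr 2
        unfold g; rw [← div_neg, neg_sub]) (M.nProd 0 1) (M.nProd_empty 0 1)
      (fun _ _ hx => M.nProd_insert 0 1 hx) Y hY z hz hzY
    have key' := congrArg (fun t : Module.End ℂ V => t M.vac) key
    have hvac : ∀ x, M.nT 2 1 x M.vac = 0 := fun x => M.nT_lower_vac x (by decide)
    simpa only [LinearMap.add_apply, LinearMap.sum_apply, LinearMap.smul_apply,
      Module.End.mul_apply, hvac, map_zero, smul_zero, sum_const_zero, add_zero] using key'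
  rw [bethe_empty_right, word_left]
  induction Y using Finset.induction_on with
  | empty => rw [nProd_empty, Module.End.one_apply, nT_diag_vac]
  | insert x Y hx ih =>
    have hYS : Y ⊆ S := (subset_insert _ _).trans hY
    have hxS : x ∈ S := hY (mem_insert_self _ _)
    have hzx : z ≠ x := fun e => hzY (e ▸ mem_insert_self _ _)
    have hzY' : z ∉ Y := fun e => hzY (mem_insert_of_mem e)
    have key := congrArg (fun t : Module.End ℂ V => t (M.nProd 0 1 Y M.vac))
      (M.nT_exchange hzx (hS z hz x hxS) 2 2 0 1)
    simp only [LinearMap.add_apply, LinearMap.smul_apply, Module.End.mul_apply,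
      lower Y hYS z hz hzY', lower Y hYS x hxS hx, map_zero, smul_zero, add_zero] at key
    rw [nProd_insert M 0 1 hx, Module.End.mul_apply, key, ih hYS hzY', map_smul]

/-! ### One-point actions on Bethe vectors -/

theorem nT_bethe_22_23 (hc : c ≠ 0) {S : Finset ℂ} (hS : ∀ x ∈ S, ∀ y ∈ S, x - y + c ≠ 0)
    (hw : ∀ x ∈ S, M.weight 1 x ≠ 0)
    (U X : Finset ℂ) (hU : U ⊆ S) (hX : X ⊆ S) (z : ℂ) (hzU : z ∈ U) (hzX : z ∈ X) :
    M.nT 1 1 z (M.bethe (U.erase z) (X.erase z)) = ∑ y ∈ U, ∑ x ∈ X,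
      (om (-c) U y * om c X x * ((h c z x)⁻¹ * (h c y z)⁻¹)) •
        M.bethe (U.erase y) (X.erase x) ∧
    M.nT 1 2 z (M.bethe (U.erase z) (X.erase z)) =
      ∑ y ∈ U, (om (-c) U y * (h c y z)⁻¹) • M.bethe (U.erase y) X := by
  refine action_middle hc hS (M.nT 1 1) (M.nT 1 2) (M.nT 0 1) (M.nT 0 2) M.bethe ?_ ?_ ?_ ?_
    (M.nT_bethe_13 hc hS) (M.nT_bethe_12 hc hS) (M.nT_22_right hc hS hw) ?_ U X hU hX z hzU hzX
  · exact fun z hz w hw hzw => M.nT_col hzw (hS z hz w hw) 1 1 0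
  · intro z hz w hw hzw
    rw [add_sub, ← M.nT_exchange hzw (hS z hz w hw) 1 1 0 2]
    abel
  · intro z hz w hw hzw
    rw [add_sub, ← M.nT_exchange hzw (hS z hz w hw) 1 2 0 1]
    abel
  · exact fun z hz w hw hzw => M.nT_col hzw (hS z hz w hw) 1 2 0
  · exact fun X _ z hz => M.nT_23_right hz

theorem nT_bethe_11 (hc : c ≠ 0) {S : Finset ℂ} (hS : ∀ x ∈ S, ∀ y ∈ S, x - y + c ≠ 0)
    (U X : Finset ℂ) (hU : U ⊆ S) (hX : X ⊆ S) (z : ℂ) (hzU : z ∈ U) (hzX : z ∈ X) :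
    M.nT 0 0 z (M.bethe (U.erase z) (X.erase z)) = ∑ y ∈ U, ∑ x ∈ X,
      (M.weight 0 y / M.weight 1 y * om c U y * om c X x * (∏ p ∈ X.erase x, fInv c p y) *
        ((h c z x)⁻¹ * (h c x y)⁻¹)) • M.bethe (U.erase y) (X.erase x) := by
  refine action_diagonal hc hS (M.nT 0 0) (M.nT 0 1) (M.nT 0 2)
    (fun y => M.weight 0 y / M.weight 1 y) M.bethe ?_ ?_ (M.nT_bethe_13 hc hS)
    (M.nT_bethe_12 hc hS) ?_ U X hU hX z hzU hzX
  · exact fun z hz w hw hzw => M.nT_row hzw (hS w hw z hz) 0 1 0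
  · exact fun z hz w hw hzw => M.nT_row hzw (hS w hw z hz) 0 2 0
  · exact fun X hX z hz => M.nT_11_right hS _ ((erase_subset _ _).trans hX) z (hX hz)
      (notMem_erase z X)

/-- The abstract action with `-c` and the two sets interchanged. The role of `T₁₂` falls to `T₂₃`,
whose action is of the required form. -/
theorem nT_bethe_33 (hc : c ≠ 0) {S : Finset ℂ} (hS : ∀ x ∈ S, ∀ y ∈ S, x - y + c ≠ 0)
    (hw : ∀ x ∈ S, M.weight 1 x ≠ 0)
    (X U : Finset ℂ) (hX : X ⊆ S) (hU : U ⊆ S) (z : ℂ) (hzX : z ∈ X) (hzU : z ∈ U) :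
    M.nT 2 2 z (M.bethe (U.erase z) (X.erase z)) = ∑ x ∈ X, ∑ y ∈ U,
      (M.weight 2 x / M.weight 1 x * om (-c) X x * om (-c) U y *
        (∏ p ∈ U.erase y, fInv (-c) p x) * ((h (-c) z y)⁻¹ * (h (-c) y x)⁻¹)) •
          M.bethe (U.erase y) (X.erase x) := by
  have hS' : ∀ x ∈ S, ∀ y ∈ S, x - y + -c ≠ 0 := fun x hx y hy e =>
    hS y hy x hx (by linear_combination -e)
  have hcol : ∀ k : Fin 3, ∀ z ∈ S, ∀ w ∈ S, z ≠ w → M.nT 2 2 z * M.nT k 2 w =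
      f (-c) w z • (M.nT k 2 w * M.nT 2 2 z) + g (-c) z w • (M.nT k 2 z * M.nT 2 2 w) := by
    intro k z hz w hw hzw
    rw [M.nT_col hzw (hS z hz w hw) 2 2 k, f_neg, g_neg, sub_eq_add_neg, ← neg_smul]
    congr 2
    unfold g; rw [← div_neg, neg_sub]
  refine action_diagonal (neg_ne_zero.2 hc) hS' (M.nT 2 2) (M.nT 1 2) (M.nT 0 2)
    (fun y => M.weight 2 y / M.weight 1 y) (fun X U => M.bethe U X) (hcol 1) (hcol 0) ?_ ?_ ?_
    X U hX hU z hzX hzU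
  · exact fun X hX U hU z hzX hzU => M.nT_bethe_13 hc hS U hU X hX z hzU hzX
  · intro X hX U hU z hzX hzU
    rw [(M.nT_bethe_22_23 hc hS hw U X hU hX z hzU hzX).2]
    simp only [h_neg]
  · exact fun U hU z hz => M.nT_33_left hS _ ((erase_subset _ _).trans hU) z (hU hz)
      (notMem_erase z U)

end HighestWeightRep

/-! ### Iteration of the one-point actions -/

/-- The right side vanishes at points of `w`, which allows sums over `X` to be read as sums over `X
∪ w`. -/
theorem om_eq_om_union {c : ℂ} {S X w : Finset ℂ} (hS : ∀ x ∈ S, ∀ y ∈ S, x - y + c ≠ 0)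
    (hX : X ⊆ S) (hw : w ⊆ S) (hXw : Disjoint X w) {x : ℂ} (hx : x ∈ X) :
    om c X x = om c (X ∪ w) x * ∏ q ∈ w, fInv c q x := by
  have hxw : x ∉ w := disjoint_left.1 hXw hx
  rw [om, om, erase_union_distrib, erase_eq_of_notMem hxw,
    prod_union (hXw.mono_left (erase_subset _ _)), mul_assoc, ← prod_mul_distrib,
    prod_eq_one (s := w), mul_one]
  intro q hq
  rw [mul_comm]
  exact fInv_mul_f (fun e => hxw (e ▸ hq)) (hS _ (hw hq) _ (hX hx))

theorem prod_erase_eq_mul_sdiff {M : Type*} [CommMonoid M] {Ξ D : Finset ℂ} (hD : D ⊆ Ξ) {x : ℂ}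
    (hx : x ∈ D) (F : ℂ → M) :
    ∏ q ∈ Ξ.erase x, F q = (∏ q ∈ Ξ \ D, F q) * ∏ q ∈ D.erase x, F q := by
  rw [← prod_union (disjoint_sdiff_self_left.mono_right (erase_subset _ _))]
  congr 1
  ext q
  simp only [mem_erase, mem_union, mem_sdiff]
  constructor
  · rintro ⟨h1, h2⟩
    by_cases hq : q ∈ D
    · exact Or.inr ⟨h1, hq⟩
    · exact Or.inl ⟨h2, hq⟩
  · rintro (⟨h1, h2⟩ | ⟨h1, h2⟩)
    · exact ⟨fun e => h2 (e ▸ hx), h1⟩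
    · exact ⟨h1, hD h2⟩

theorem erase_sdiff_erase_of_mem {Ξ D : Finset ℂ} {x : ℂ} (hx : x ∈ D) :
    Ξ.erase x \ D.erase x = Ξ \ D := by
  ext q
  simp only [mem_erase, mem_sdiff]
  constructor
  · rintro ⟨⟨h1, h2⟩, h3⟩
    exact ⟨h2, fun h => h3 ⟨h1, h⟩⟩
  · rintro ⟨h1, h2⟩
    exact ⟨⟨fun e => h2 (e ▸ hx), h1⟩, fun h => h2 h.2⟩

theorem om_mul_prodOn {c : ℂ} {Ξ D : Finset ℂ} (hD : D ⊆ Ξ) {x : ℂ} (hx : x ∈ D) :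
    om c Ξ x * prodOn (f c) (Ξ \ D) (D.erase x) =
      prodOn (f c) (Ξ \ D) D * ∏ z ∈ D.erase x, f c z x := by
  rw [om, prod_erase_eq_mul_sdiff hD hx, ← prodOn_erase_right (f c) (Ξ \ D) D hx]
  ring

theorem izerginShift_zero (c : ℂ) (X Y : Finset ℂ) : izerginShift c 0 X Y = 1 := by
  simp [izerginShift, izergin, izerginPrefactor]

section Iterate

variable {V : Type*} [AddCommGroup V] [Module ℂ V]

/-- One step of the recursion for sums over partitions weighted by
`f(Ξ_II, Ξ_I) K_n(Ξ_I | w + c)`. -/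
theorem sum_om_smul_sum {c : ℂ} (hc : c ≠ 0) {S X w : Finset ℂ}
    (hS : ∀ x ∈ S, ∀ y ∈ S, x - y + c ≠ 0) (hX : X ⊆ S) (hw : w ⊆ S) (hXw : Disjoint X w) {p : ℂ}
    (hp : p ∈ X) (G : Finset ℂ → V) :
    ∑ x ∈ X, (om c X x * (h c p x)⁻¹) • ∑ D ∈ (X.erase x ∪ w).powersetCard w.card,
        (prodOn (f c) ((X.erase x ∪ w) \ D) D * izerginShift c w.card D w) •
          G ((X.erase x ∪ w) \ D) =
      -∑ D ∈ (X ∪ w).powersetCard (w.card + 1),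
        (prodOn (f c) ((X ∪ w) \ D) D * izerginShift c (w.card + 1) D (insert p w)) •
          G ((X ∪ w) \ D) := by
  have hΞ : X ∪ w ⊆ S := union_subset hX hw
  have hpw : p ∉ w := disjoint_left.1 hXw hp
  calc _ = ∑ x ∈ X ∪ w, ∑ D ∈ ((X ∪ w).erase x).powersetCard w.card,
          (om c (X ∪ w) x * (∏ q ∈ w, fInv c q x) * (h c p x)⁻¹ *
            (prodOn (f c) ((X ∪ w).erase x \ D) D * izerginShift c w.card D w)) •
              G ((X ∪ w).erase x \ D) := by
        rw [sum_union hXw, sum_eq_zero (s := w), add_zero]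
        · refine sum_congr rfl fun x hx => ?_
          rw [om_eq_om_union hS hX hw hXw hx, erase_union_distrib,
            erase_eq_of_notMem (disjoint_left.1 hXw hx), smul_sum]
          simp only [smul_smul]
        · intro x hx
          refine sum_eq_zero fun D _ => ?_
          rw [prod_fInv_eq_zero hx]; simp
    _ = _ := by
        -- The removed point is added to `D`, and the sum over it is the recursion of `izerginShift`
        -- at `p`. The overall sign is that of `-(h c p x)⁻¹` there.
        rw [sum_powersetCard_erase (X ∪ w) w.card fun x D => (om c (X ∪ w) x *
          (∏ q ∈ w, fInv c q x) * (h c p x)⁻¹ *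
            (prodOn (f c) ((X ∪ w).erase x \ D) D * izerginShift c w.card D w)) •
              G ((X ∪ w).erase x \ D), ← sum_neg_distrib]
        refine sum_congr rfl fun D hD => ?_
        obtain ⟨hD, hcard⟩ := mem_powersetCard.1 hD
        rw [izerginShift_insert c hc w.card D w p hpw hcard rfl, mul_sum, ← neg_smul,
          ← sum_neg_distrib, sum_smul]
        · refine sum_congr rfl fun x hx => ?_
          rw [erase_sdiff_erase_of_mem hx]
          congr 1
          linear_combination ((∏ q ∈ w, fInv c q x) * (h c p x)⁻¹ *
            izerginShift c w.card (D.erase x) w) * om_mul_prodOn (c := c) hD hx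
        · intro x hx y hy
          refine hS _ ?_ _ (hΞ (hD hx))
          rcases mem_insert.1 hy with rfl | hy
          exacts [hX hp, hw hy]

/-- The action of a product of operators, given the action of one of them in the form
satisfied by `T₁₁`. -/
theorem iterate_action_diagonal {c : ℂ} (hc : c ≠ 0) {S : Finset ℂ}
    (hS : ∀ x ∈ S, ∀ y ∈ S, x - y + c ≠ 0) (A : ℂ → Module.End ℂ V)
    (P : Finset ℂ → Module.End ℂ V) (hP0 : P ∅ = 1)
    (hP : ∀ (w : Finset ℂ) (p : ℂ), p ∉ w → P (insert p w) = P w * A p)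
    (B : Finset ℂ → Finset ℂ → V) (r : ℂ → ℂ)
    (hA : ∀ U ⊆ S, ∀ X ⊆ S, ∀ z ∈ U, z ∈ X → A z (B (U.erase z) (X.erase z)) =
      ∑ y ∈ U, ∑ x ∈ X, (r y * om c U y * om c X x * (∏ p ∈ X.erase x, fInv c p y) *
        ((h c z x)⁻¹ * (h c x y)⁻¹)) • B (U.erase y) (X.erase x))
    (w : Finset ℂ) (hw : w ⊆ S) : ∀ u ⊆ S, ∀ v ⊆ S, Disjoint u w → Disjoint v w →
    P w (B u v) = ∑ E ∈ (u ∪ w).powersetCard w.card, ∑ D ∈ (v ∪ w).powersetCard w.card,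
      ((∏ y ∈ E, r y) * prodOn (f c) ((v ∪ w) \ D) D * prodOn (f c) ((u ∪ w) \ E) E *
        prodOn (fInv c) ((v ∪ w) \ D) E * izerginShift c w.card D w *
          izerginShift c w.card E D) • B ((u ∪ w) \ E) ((v ∪ w) \ D) := by
  induction w using Finset.induction_on with
  | empty =>
    intro u _ v _ _ _
    simp [hP0, izerginShift_zero, prodOn]
  | insert p w hpw ih =>
    intro u hu v hv huw hvw
    have hpS : p ∈ S := hw (mem_insert_self _ _)
    have hwS : w ⊆ S := (subset_insert _ _).trans hw
    rw [disjoint_insert_right] at huw hvw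
    obtain ⟨hpu, huw⟩ := huw
    obtain ⟨hpv, hvw⟩ := hvw
    have hUw : Disjoint (insert p u) w := disjoint_insert_left.2 ⟨hpw, huw⟩
    have hXw : Disjoint (insert p v) w := disjoint_insert_left.2 ⟨hpw, hvw⟩
    have hUS : insert p u ⊆ S := insert_subset hpS hu
    have hXS : insert p v ⊆ S := insert_subset hpS hv
    have hU : u ∪ insert p w = insert p u ∪ w := by rw [union_insert, insert_union]
    have hX : v ∪ insert p w = insert p v ∪ w := by rw [union_insert, insert_union]
    have hstep := hA _ hUS _ hXS p (mem_insert_self _ _) (mem_insert_self _ _)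
    rw [erase_insert hpu, erase_insert hpv] at hstep
    rw [hU, hX, hP w p hpw, Module.End.mul_apply, hstep, card_insert_of_notMem hpw]
    have hpU : p ∈ insert p u := mem_insert_self _ _
    clear hstep hU hX hu hv huw hvw hpu hpv
    generalize insert p u = U at *
    generalize insert p v = X at *
    have hH : U ∪ w ⊆ S := union_subset hUS hwS
    have hΞ : X ∪ w ⊆ S := union_subset hXS hwS
    simp only [map_sum, map_smul]
    -- The summand after one more step: `y`, `x` are the points removed by the new operator, `E`,
    -- `D` those removed by the others. It is written on all of `U ∪ w` and `X ∪ w`, being zero at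
    -- the added points.
    set K : ℂ → ℂ → Finset ℂ → Finset ℂ → V := fun y x E D =>
      (r y * om c (U ∪ w) y * (om c (X ∪ w) x * ∏ q ∈ w, fInv c q x) *
        (∏ q ∈ (X ∪ w).erase x, fInv c q y) * ((h c p x)⁻¹ * (h c x y)⁻¹) *
        ((∏ y ∈ E, r y) * prodOn (f c) ((X ∪ w).erase x \ D) D *
          prodOn (f c) ((U ∪ w).erase y \ E) E * prodOn (fInv c) ((X ∪ w).erase x \ D) E *
            izerginShift c w.card D w * izerginShift c w.card E D)) •
        B ((U ∪ w).erase y \ E) ((X ∪ w).erase x \ D) with hK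
    calc _ = ∑ y ∈ U ∪ w, ∑ x ∈ X ∪ w, ∑ E ∈ ((U ∪ w).erase y).powersetCard w.card,
          ∑ D ∈ ((X ∪ w).erase x).powersetCard w.card, K y x E D := by
          have hKx : ∀ y, ∀ x ∈ w, ∀ E D, K y x E D = 0 := by
            intro y x hx E D
            simp only [hK, prod_fInv_eq_zero hx, mul_zero, zero_mul, zero_smul]
          rw [sum_union hUw, sum_eq_zero (s := w), add_zero]
          · refine sum_congr rfl fun y hy => ?_
            rw [sum_union hXw, sum_eq_zero (s := w), add_zero]
            · refine sum_congr rfl fun x hx => ?_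
              have hxw := disjoint_left.1 hXw hx
              have hyw := disjoint_left.1 hUw hy
              rw [ih hwS (U.erase y) ((erase_subset _ _).trans hUS) (X.erase x)
                ((erase_subset _ _).trans hXS) (hUw.mono_left (erase_subset _ _))
                (hXw.mono_left (erase_subset _ _)), om_eq_om_union hS hXS hwS hXw hx,
                om_eq_om_union hS hUS hwS hUw hy, smul_sum]
              simp only [smul_sum, smul_smul, hK]
              rw [erase_union_distrib, erase_union_distrib, erase_eq_of_notMem hxw,
                erase_eq_of_notMem hyw, prod_union (hXw.mono_left (erase_subset _ _))]
              refine sum_congr rfl fun E _ => sum_congr rfl fun D _ => ?_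
              congr 1
              ring
            · intro x hx
              exact sum_eq_zero fun E _ => sum_eq_zero fun D _ => hKx y x hx E D
          · intro y hy
            refine sum_eq_zero fun x _ => sum_eq_zero fun E _ => sum_eq_zero fun D _ => ?_
            by_cases hxy : x = y
            · exact hKx y x (hxy ▸ hy) E D
            · simp only [hK]
              rw [prod_fInv_eq_zero (mem_erase.2 ⟨Ne.symm hxy, mem_union_right _ hy⟩)]
              simp only [mul_zero, zero_mul, zero_smul]
      _ = ∑ E ∈ (U ∪ w).powersetCard (w.card + 1), ∑ D ∈ (X ∪ w).powersetCard (w.card + 1),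
          ∑ x ∈ D, ∑ y ∈ E, K y x (E.erase y) (D.erase x) := by
          have h1 : ∀ y ∈ U ∪ w, ∑ x ∈ X ∪ w, ∑ E ∈ ((U ∪ w).erase y).powersetCard w.card,
              ∑ D ∈ ((X ∪ w).erase x).powersetCard w.card, K y x E D =
              ∑ E ∈ ((U ∪ w).erase y).powersetCard w.card,
                ∑ D ∈ (X ∪ w).powersetCard (w.card + 1), ∑ x ∈ D, K y x E (D.erase x) := by
            intro y _
            rw [sum_comm]
            exact sum_congr rfl fun E _ =>
              sum_powersetCard_erase (X ∪ w) w.card fun x D => K y x E D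
          rw [sum_congr rfl h1, sum_powersetCard_erase (U ∪ w) w.card fun y E =>
            ∑ D ∈ (X ∪ w).powersetCard (w.card + 1), ∑ x ∈ D, K y x E (D.erase x)]
          refine sum_congr rfl fun E _ => ?_
          rw [sum_comm]
          exact sum_congr rfl fun D _ => sum_comm
      _ = _ := by
          refine sum_congr rfl fun E hE => sum_congr rfl fun D hD => ?_
          obtain ⟨hE, hEc⟩ := mem_powersetCard.1 hE
          obtain ⟨hD, hDc⟩ := mem_powersetCard.1 hD
          -- Two linked expansions: `K(D | w ∪ p + c)` in `p` selects `x ∈ D`, and `K(E | D + c)` in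
          -- this `x` selects `y ∈ E`. Their two minus signs cancel.
          rw [izerginShift_insert c hc w.card D w p hpw hDc rfl, mul_sum, sum_mul, sum_smul]
          · refine sum_congr rfl fun x hx => ?_
            have hrec := izerginShift_insert c hc w.card E (D.erase x) x (notMem_erase x D) hEc
              (by rw [card_erase_of_mem hx, hDc, Nat.add_sub_cancel]) (by
                rw [insert_erase hx]
                exact fun y hy q hq => hS _ (hΞ (hD hq)) _ (hH (hE hy)))
            rw [insert_erase hx] at hrec
            rw [hrec, mul_sum, sum_smul]
            refine sum_congr rfl fun y hy => ?_
            simp only [hK]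
            rw [erase_sdiff_erase_of_mem hx, erase_sdiff_erase_of_mem hy,
              ← mul_prod_erase E r hy, prod_erase_eq_mul_sdiff hD hx]
            congr 1
            have e1 := om_mul_prodOn (c := c) hD hx
            have e2 := om_mul_prodOn (c := c) hE hy
            have e3 := prodOn_erase_right (fInv c) ((X ∪ w) \ D) E hy
            calc _ = (om c (X ∪ w) x * prodOn (f c) ((X ∪ w) \ D) (D.erase x)) *
                (om c (U ∪ w) y * prodOn (f c) ((U ∪ w) \ E) (E.erase y)) *
                ((∏ q ∈ (X ∪ w) \ D, fInv c q y) *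
                  prodOn (fInv c) ((X ∪ w) \ D) (E.erase y)) *
                (r y * (∏ y ∈ E.erase y, r y) * (∏ q ∈ w, fInv c q x) *
                  (∏ q ∈ D.erase x, fInv c q y) * ((h c p x)⁻¹ * (h c x y)⁻¹) *
                  izerginShift c w.card (D.erase x) w *
                    izerginShift c w.card (E.erase y) (D.erase x)) := by ring
              _ = _ := by rw [e1, e2, e3]; ring
          · intro x hx y hy
            refine hS _ ?_ _ (hΞ (hD hx))
            rcases mem_insert.1 hy with rfl | hy
            exacts [hUS hpU, hwS hy]

end Iterate

theorem prodOn_neg {φ : ℂ → ℂ → ℂ → ℂ} (hφ : ∀ c x y, φ (-c) x y = φ c y x) (c : ℂ)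
    (X Y : Finset ℂ) : prodOn (φ (-c)) X Y = prodOn (φ c) Y X := by
  unfold prodOn
  rw [prod_comm]
  exact prod_congr rfl fun _ _ => prod_congr rfl fun _ _ => hφ _ _ _

namespace HighestWeightRep

variable {c : ℂ} {V : Type*} [AddCommGroup V] [Module ℂ V] (M : HighestWeightRep c V)

theorem nProd_insert' (i j : Fin 3) (X : Finset ℂ) (x : ℂ) (hx : x ∉ X) :
    M.nProd i j (insert x X) = M.nProd i j X * M.nT i j x :=
  noncommProd_insert_of_notMem' _ _ _ _ hx

theorem prodT_eq_smul_nProd (i j : Fin 3) {X : Finset ℂ} (hX : ∀ x ∈ X, M.weight 1 x ≠ 0) :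
    M.prodT i j X = M.prodWeight 1 X • M.nProd i j X := by
  have hne : M.prodWeight 1 X ≠ 0 := prod_ne_zero_iff.2 hX
  rw [nProd_eq, smul_smul, mul_inv_cancel₀ hne, one_smul]

/-- The coefficient of the one-point action of `T₂₂` is a product of a function of `y` and one of
`x`, so the iteration separates into two independent expansions, with parameter `-c` in the first
set and `c` in the second. -/
theorem nProd_bethe_22 (hc : c ≠ 0) {S : Finset ℂ} (hS : ∀ x ∈ S, ∀ y ∈ S, x - y + c ≠ 0)
    (hwt : ∀ x ∈ S, M.weight 1 x ≠ 0) (w : Finset ℂ) (hw : w ⊆ S) :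
    ∀ u ⊆ S, ∀ v ⊆ S, Disjoint u w → Disjoint v w →
    M.nProd 1 1 w (M.bethe u v) =
      ∑ E ∈ (u ∪ w).powersetCard w.card,
        (prodOn (f (-c)) ((u ∪ w) \ E) E * izerginShift (-c) w.card E w) •
        ∑ D ∈ (v ∪ w).powersetCard w.card,
          (prodOn (f c) ((v ∪ w) \ D) D * izerginShift c w.card D w) •
            M.bethe ((u ∪ w) \ E) ((v ∪ w) \ D) := by
  induction w using Finset.induction_on with
  | empty =>
    intro u _ v _ _ _
    simp [nProd_empty, izerginShift_zero, prodOn]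
  | insert p w hpw ih =>
    intro u hu v hv huw hvw
    have hpS : p ∈ S := hw (mem_insert_self _ _)
    have hwS : w ⊆ S := (subset_insert _ _).trans hw
    rw [disjoint_insert_right] at huw hvw
    obtain ⟨hpu, huw⟩ := huw
    obtain ⟨hpv, hvw⟩ := hvw
    have hUw : Disjoint (insert p u) w := disjoint_insert_left.2 ⟨hpw, huw⟩
    have hXw : Disjoint (insert p v) w := disjoint_insert_left.2 ⟨hpw, hvw⟩
    have hUS : insert p u ⊆ S := insert_subset hpS hu
    have hXS : insert p v ⊆ S := insert_subset hpS hv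
    have hU : u ∪ insert p w = insert p u ∪ w := by rw [union_insert, insert_union]
    have hX : v ∪ insert p w = insert p v ∪ w := by rw [union_insert, insert_union]
    have hpU : p ∈ insert p u := mem_insert_self _ _
    have hpX : p ∈ insert p v := mem_insert_self _ _
    have hstep := (M.nT_bethe_22_23 hc hS hwt _ _ hUS hXS p hpU hpX).1
    rw [erase_insert hpu, erase_insert hpv] at hstep
    rw [hU, hX, M.nProd_insert' 1 1 w p hpw, Module.End.mul_apply, hstep,
      card_insert_of_notMem hpw]
    clear hstep hU hX hu hv huw hvw hpu hpv
    generalize insert p u = U at *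
    generalize insert p v = X at *
    have hS' : ∀ x ∈ S, ∀ y ∈ S, x - y + -c ≠ 0 := fun x hx y hy e =>
      hS y hy x hx (by linear_combination -e)
    -- Each of the two uses of `sum_om_smul_sum` brings a minus sign; the double negation provides
    -- the first.
    rw [← neg_neg (∑ E ∈ (U ∪ w).powersetCard (w.card + 1), _),
      ← sum_om_smul_sum (neg_ne_zero.2 hc) hS' hUS hwS hUw hpU fun H =>
        ∑ D ∈ (X ∪ w).powersetCard (w.card + 1),
          (prodOn (f c) ((X ∪ w) \ D) D * izerginShift c (w.card + 1) D (insert p w)) •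
            M.bethe H ((X ∪ w) \ D), map_sum, ← sum_neg_distrib]
    refine sum_congr rfl fun y hy => ?_
    rw [← smul_neg, ← sum_neg_distrib, map_sum]
    simp only [← smul_neg]
    calc _ = ∑ x ∈ X, (om (-c) U y * (h (-c) p y)⁻¹) •
          ∑ E ∈ (U.erase y ∪ w).powersetCard w.card,
            (prodOn (f (-c)) ((U.erase y ∪ w) \ E) E * izerginShift (-c) w.card E w) •
              ((om c X x * (h c p x)⁻¹) • ∑ D ∈ (X.erase x ∪ w).powersetCard w.card,
                (prodOn (f c) ((X.erase x ∪ w) \ D) D * izerginShift c w.card D w) •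
                  M.bethe ((U.erase y ∪ w) \ E) ((X.erase x ∪ w) \ D)) := by
          refine sum_congr rfl fun x hx => ?_
          rw [map_smul, ih hwS (U.erase y) ((erase_subset _ _).trans hUS) (X.erase x)
            ((erase_subset _ _).trans hXS) (hUw.mono_left (erase_subset _ _))
            (hXw.mono_left (erase_subset _ _)), h_neg, smul_sum, smul_sum]
          refine sum_congr rfl fun E _ => ?_
          rw [smul_smul, smul_smul, smul_smul]
          congr 1
          ring
      _ = _ := by
          rw [← smul_sum, sum_comm]
          refine congrArg _ (sum_congr rfl fun E _ => ?_)
          rw [← smul_sum, sum_om_smul_sum hc hS hXS hwS hXw hpX fun C =>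
            M.bethe ((U.erase y ∪ w) \ E) C]

end HighestWeightRep

end GL3

/-! ### The multiple actions of `T₂₂`, `T₁₁` and `T₃₃`. -/

theorem mainTheorem2 {V : Type*} [AddCommGroup V] [Module ℂ V] (c : ℂ) (hc : c ≠ 0)
    (M : GL3.HighestWeightRep c V) (u v w : Finset ℂ)
    (huw : Disjoint u w) (hvw : Disjoint v w)
    (hgen : ∀ x ∈ u ∪ v ∪ w, ∀ y ∈ u ∪ v ∪ w, x - y ≠ c)
    (hweight : ∀ x ∈ u ∪ v ∪ w, M.weight 1 x ≠ 0) :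
    (M.prodT 1 1 w (M.bethe u v) =
      M.prodWeight 1 w •
        ∑ ηI ∈ (u ∪ w).powersetCard w.card, ∑ ξI ∈ (v ∪ w).powersetCard w.card,
          (GL3.prodOn (GL3.f c) ((v ∪ w) \ ξI) ξI * GL3.prodOn (GL3.f c) ηI ((u ∪ w) \ ηI) *
              GL3.izerginShift c w.card ξI w * GL3.izerginShift c w.card w ηI) •
            M.bethe ((u ∪ w) \ ηI) ((v ∪ w) \ ξI)) ∧
    (M.prodT 0 0 w (M.bethe u v) =
      M.prodWeight 1 w •
        ∑ ηI ∈ (u ∪ w).powersetCard w.card, ∑ ξI ∈ (v ∪ w).powersetCard w.card,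
          (M.r1 ηI * GL3.prodOn (GL3.f c) ((v ∪ w) \ ξI) ξI *
              GL3.prodOn (GL3.f c) ((u ∪ w) \ ηI) ηI *
              GL3.prodOn (GL3.fInv c) ((v ∪ w) \ ξI) ηI *
              GL3.izerginShift c w.card ξI w * GL3.izerginShift c w.card ηI ξI) •
            M.bethe ((u ∪ w) \ ηI) ((v ∪ w) \ ξI)) ∧
    (M.prodT 2 2 w (M.bethe u v) =
      M.prodWeight 1 w •
        ∑ ηI ∈ (u ∪ w).powersetCard w.card, ∑ ξI ∈ (v ∪ w).powersetCard w.card,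
          (M.r3 ξI * GL3.prodOn (GL3.f c) ξI ((v ∪ w) \ ξI) *
              GL3.prodOn (GL3.f c) ηI ((u ∪ w) \ ηI) *
              GL3.prodOn (GL3.fInv c) ξI ((u ∪ w) \ ηI) *
              GL3.izerginShift c w.card w ηI * GL3.izerginShift c w.card ηI ξI) •
            M.bethe ((u ∪ w) \ ηI) ((v ∪ w) \ ξI)) := by

  have hS : ∀ x ∈ u ∪ v ∪ w, ∀ y ∈ u ∪ v ∪ w, x - y + c ≠ 0 := fun x hx y hy e =>
    hgen y hy x hx (by linear_combination -e)
  have hS' : ∀ x ∈ u ∪ v ∪ w, ∀ y ∈ u ∪ v ∪ w, x - y + -c ≠ 0 := fun x hx y hy e =>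
    hgen x hx y hy (by linear_combination e)
  have hu : u ⊆ u ∪ v ∪ w := Finset.subset_union_left.trans Finset.subset_union_left
  have hv : v ⊆ u ∪ v ∪ w := Finset.subset_union_right.trans Finset.subset_union_left
  have hw : w ⊆ u ∪ v ∪ w := Finset.subset_union_right
  have hT : ∀ i, M.prodT i i w (M.bethe u v) =
      M.prodWeight 1 w • M.nProd i i w (M.bethe u v) := fun i => by
    rw [M.prodT_eq_smul_nProd i i fun x hx => hweight x (hw hx), LinearMap.smul_apply]
  refine ⟨?_, ?_, ?_⟩
  · rw [hT, M.nProd_bethe_22 hc hS hweight w hw u hu v hv huw hvw]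
    refine congrArg _ (Finset.sum_congr rfl fun E _ => ?_)
    rw [Finset.smul_sum]
    refine Finset.sum_congr rfl fun D _ => ?_
    rw [smul_smul, GL3.prodOn_neg GL3.f_neg, GL3.izerginShift_neg]
    congr 1
    ring
  · rw [hT, GL3.iterate_action_diagonal hc hS (M.nT 0 0) (M.nProd 0 0) (M.nProd_empty 0 0)
      (M.nProd_insert' 0 0) M.bethe (fun y => M.weight 0 y / M.weight 1 y)
      (fun U hU X hX => M.nT_bethe_11 hc hS U X hU hX) w hw u hu v hv huw hvw]
    rfl
  -- The iteration runs with `-c` and the sets interchanged; the symmetries under `c ↦ -c` then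
  -- restore the arguments to the stated order.
  · rw [hT, GL3.iterate_action_diagonal (neg_ne_zero.2 hc) hS' (M.nT 2 2) (M.nProd 2 2)
      (M.nProd_empty 2 2) (M.nProd_insert' 2 2) (fun X U => M.bethe U X)
      (fun x => M.weight 2 x / M.weight 1 x)
      (fun X hX U hU z hzX hzU => M.nT_bethe_33 hc hS hweight X U hX hU z hzX hzU)
      w hw v hv u hu hvw huw, Finset.sum_comm]
    refine congrArg _ (Finset.sum_congr rfl fun E _ => Finset.sum_congr rfl fun D _ => ?_)
    rw [GL3.prodOn_neg GL3.f_neg, GL3.prodOn_neg GL3.f_neg, GL3.prodOn_neg GL3.fInv_neg,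
      GL3.izerginShift_neg, GL3.izerginShift_neg, GL3.HighestWeightRep.r3]
    congr 1
    ring
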